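/- Let $g\in C([0,\infty),\mathbb R)\cap C^2((0,\infty),\mathbb R)$ with $g(0)=0$ satisfy $$|sg'(s)|+|s^2g''(s)|\le C_0\bigl(s^{\alpha_1/2}+s^{\alpha_2/2}\bigr)\qquad(s>0)$$ for some $C_0>0$ and $1\le\alpha_1\le\alpha_2<\infty$, and put $f(z)=g(|z|^2)z$ for $z\in\mathbb C$. Let $\omega_*>0$, $0<a<1$, $D>0$ be such that for every $0<\omega<\omega_*$ the equation $-\varphi''+\omega\varphi=f(\varphi)$ on $\mathbb R$ has a nontrivial real-valued solution $\varphi=\varphi_\omega\in H^1(\mathbb R)$ with $$|\varphi_\omega(x)|+\omega^{-1/2}|\varphi_\omega'(x)|\le D\,\omega^{1/\alpha_1}e^{-a\omega^{1/2}|x|}\qquad(x\in\mathbb R).$$ Then for every $\rho\in(0,\infty)$ there is a constant $\lambda_0>0$, depending only on $f,C_0,\alpha_1,\alpha_2,\omega_*,a,D$ and $\rho$ (not on the choice of the family $(\varphi_\omega)$), such that for every $\lambda\in[\lambda_0,\infty)$ the following holds. There exist frequencies $\omega_j\in(0,\omega_*)$, pairwise distinct velocities $v_j\in\mathbb R$ and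 phases $\gamma_j\in\mathbb R$ $(j\in\mathbb N)$, and a function $\eta:[0,\infty)\times\mathbb R\to\mathbb C$, such that, with $$R_j(t,x)=e^{i(\omega_jt+\frac12v_jx-\frac14v_j^2t+\gamma_j)}\varphi_{\omega_j}(x-v_jt),\qquad T=\sum_{j\in\mathbb N}R_j,$$ the series $T(t,x)$ converges absolutely for every $t\ge0$ and almost every $x$, the function $u=T+\eta$ is a solution of $$i\partial_tu+\partial_x^2u+f(u)=0\qquad\text{for }t\ge0$$ (that is, $u\in C([0,\infty);L^2_{\rm loc}(\mathbb R))$, $u$ and $f(u)$ are locally integrable on $[0,\infty)\times\mathbb R$, and the equation holds in the sense of distributions on $(0,\infty)\times\mathbb R$), and $$\sup_{t\ge0}e^{\lambda t}\,\|\eta(t)\|_{L^2\cap L^\infty}\le\rho,\qquad \|w\|_{L^2\cap L^\infty}:=\|w\|_{L^2(\mathbb R)}+\|w\|_{L^\infty(\mathbb R)}.$$ -/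

import Mathlib

open MeasureTheory Set Filter Topology

noncomputable section

/-- The nonlinearity `f(z) = g(|z|²) z`. -/
def nlsF (g : ℝ → ℝ) (z : ℂ) : ℂ := (g (‖z‖ ^ 2) : ℂ) * z

/-- The assumption on the nonlinearity (in dimension one, where the only upper bound on
`α₂` is `α₂ < ∞`).  The values of `g` on the negative half-line play no role. -/
structure AssumptionF (g : ℝ → ℝ) (C₀ α₁ α₂ : ℝ) : Prop where
  continuousOn : ContinuousOn g (Ici 0)
  contDiffOn : ContDiffOn ℝ 2 g (Ioi 0)
  map_zero : g 0 = 0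
  C₀_pos : 0 < C₀
  α₁_pos : 0 < α₁
  α₁_le_α₂ : α₁ ≤ α₂
  bound : ∀ s : ℝ, 0 < s →
    |s * deriv g s| + |s ^ 2 * deriv (deriv g) s| ≤ C₀ * (s ^ (α₁ / 2) + s ^ (α₂ / 2))

/-- `ψ` is the weak derivative of `φ` on the real line. -/
def HasWeakDeriv (φ ψ : ℝ → ℝ) : Prop :=
  LocallyIntegrable φ volume ∧ LocallyIntegrable ψ volume ∧
    ∀ θ : ℝ → ℝ, ContDiff ℝ (⊤ : ℕ∞) θ → HasCompactSupport θ →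
      ∫ x, φ x * deriv θ x = -∫ x, ψ x * θ x

/-- `φ` is a nontrivial real-valued `H¹(ℝ)` function with weak derivative `φ'`, and solves
`-φ'' + ω φ = f(φ)` in the weak sense. -/
structure IsBoundState (g : ℝ → ℝ) (ω : ℝ) (φ φ' : ℝ → ℝ) : Prop where
  memLp : MemLp φ 2 volume
  memLp_deriv : MemLp φ' 2 volume
  weakDeriv : HasWeakDeriv φ φ'
  nontrivial : ¬ φ =ᵐ[volume] 0
  equation : ∀ θ : ℝ → ℝ, ContDiff ℝ (⊤ : ℕ∞) θ → HasCompactSupport θ →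
    (∫ x, φ' x * deriv θ x) + ω * ∫ x, φ x * θ x = ∫ x, g (φ x ^ 2) * φ x * θ x

/-- The assumption on the existence of small solitons in dimension one: `φ ω`, for
`0 < ω < ωs`, are bound states with the given size and exponential decay.  (A function in
`H¹(ℝ)` solving the equation has a `C²` representative, for which the almost everywhere
bound holds everywhere.) -/
structure AssumptionT (g : ℝ → ℝ) (α₁ ωs a D : ℝ) (φ : ℝ → ℝ → ℝ) : Prop where
  ωs_pos : 0 < ωs
  a_pos : 0 < a
  a_lt_one : a < 1
  D_pos : 0 < D
  exists_deriv : ∀ ω : ℝ, 0 < ω → ω < ωs → ∃ φ' : ℝ → ℝ,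
    IsBoundState g ω (φ ω) φ' ∧
    ∀ᵐ x : ℝ, |φ ω x| + ω ^ (-(1 / 2 : ℝ)) * |φ' x| ≤
      D * ω ^ (1 / α₁) * Real.exp (-a * ω ^ (1 / 2 : ℝ) * |x|)

/-- The soliton with profile `φ`, frequency `ω`, velocity `v`, initial position `x₀` and
phase `γ`: `exp(i(ωt + vx/2 - v²t/4 + γ)) φ(x - x₀ - vt)`. -/
def soliton (φ : ℝ → ℝ) (ω v x₀ γ : ℝ) (t x : ℝ) : ℂ :=
  Complex.exp (Complex.I * ((ω * t + v * x / 2 - v ^ 2 * t / 4 + γ : ℝ) : ℂ)) *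
    (φ (x - x₀ - v * t) : ℂ)

/-- `u(t,x)` is a solution of `i ∂ₜu + ∂ₓₓu + f(u) = 0` for `t ≥ 0`: `u` belongs to
`C([0,∞); L²_loc(ℝ))`, `u` and `f(u)` are locally integrable on `[0,∞) × ℝ`, and the equation
holds in the sense of distributions on `(0,∞) × ℝ`. -/
structure IsNLSSolution (g : ℝ → ℝ) (u : ℝ → ℝ → ℂ) : Prop where
  memLp_loc : ∀ t : ℝ, 0 ≤ t → ∀ r : ℝ, MemLp (u t) 2 (volume.restrict (Icc (-r) r))
  continuous_loc : ∀ t₀ : ℝ, 0 ≤ t₀ → ∀ r : ℝ,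
    Tendsto (fun t => eLpNorm (fun x => u t x - u t₀ x) 2 (volume.restrict (Icc (-r) r)))
      (𝓝[Ici 0] t₀) (𝓝 0)
  locallyIntegrable : LocallyIntegrableOn (fun p : ℝ × ℝ => u p.1 p.2) (Ici 0 ×ˢ univ) volume
  locallyIntegrable_nonlinearity :
    LocallyIntegrableOn (fun p : ℝ × ℝ => nlsF g (u p.1 p.2)) (Ici 0 ×ˢ univ) volume
  equation : ∀ χ : ℝ × ℝ → ℂ, ContDiff ℝ (⊤ : ℕ∞) χ → HasCompactSupport χ →
    tsupport χ ⊆ Ioi 0 ×ˢ univ →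
    ∫ p : ℝ × ℝ,
      (u p.1 p.2 * (-Complex.I * deriv (fun t => χ (t, p.2)) p.1 +
          iteratedDeriv 2 (fun x => χ (p.1, x)) p.2) +
        nlsF g (u p.1 p.2) * χ p) = 0

/-- The norm of `L²(ℝ) ∩ L^∞(ℝ)`, as an extended nonnegative real. -/
def normL2Linfty (w : ℝ → ℂ) : ENNReal := eLpNorm w 2 volume + eLpNorm w ⊤ volume

end

/-! Each soliton solves the equation, so `T + η` does as soon as `η` solves i∂ₜη + ∂ₓₓη + G = 0 with
G = F(T + η) - ∑ F(R_j). The remainder is sought from infinity backwards, as η(t) = -i ∫₀^∞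
exp(-ir∂ₓ²) G(t + r) dr. Here F is the nonlinearity with `g` frozen beyond modulus two; it is
globally Lipschitz, and |T| ≤ 1 together with |η| ≤ 1 makes the freezing invisible at the end.

The decay rate λ is the large parameter. If F(T) - ∑ F(R_j) is O(e^{-λt}) in L², then in the norm
weighted by e^{λt} the Duhamel map is Lipschitz with constant O(1/λ), because the group is isometric
on L². It is therefore a contraction for large λ, and its fixed point has size O(1/λ)
(`exists_decaying_duhamel_solution`). For the sup norm, α₁ ≥ 1 gives |G| ≤ C(Z + |η|)|η| + C Z
e^{-λt} with a weight Z bounded in L¹ and L². So G is O(e^{-λt}) in L¹, and the dispersive bound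
r^{-1/2} integrated against e^{-λr} gives the small factor √(π/λ) (`ae_norm_le_of_duhamel`). No L²
bound on T is needed.

A soliton of frequency ω has amplitude B = Dω^{1/α₁} and decay rate β = aω^{1/2}, so the L¹ norm of
|R|^{α₁} is O(B^{α₁}/β) = O(ω^{1/2}). Rapidly decreasing frequencies therefore make |T|^{α₁}
integrable, with the explicit majorant Z (`rpow_tsum_envelope_le`). The velocities 2λj/β_j separate
the solitons so fast that the product of two distinct envelopes is at most their amplitudes times
e^{-2λt}. The smaller of the two is then O(e^{-λt}), and this controls the interactions when the
waves are added one by one (`norm_interaction_le`). All parameters are fixed in `exists_trainSeq`.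
The passage from Duhamel's formula to the distributional equation is `integral_inner_slice_duhamel`,
and that each soliton solves the equation is `IsProfile.soliton_equation`. -/

open scoped FourierTransform SchwartzMap BoundedContinuousFunction

/-! ### The truncated nonlinearity -/

/-- The nonlinearity with `g` frozen outside the ball of radius two. -/
noncomputable def truncF (g : ℝ → ℝ) (z : ℂ) : ℂ := (g ((min ‖z‖ 2) ^ 2) : ℂ) * z

/-- `F` vanishes at zero and is Lipschitz, with a constant which is at most `L r ^ α` on the ball of
radius `r ≤ 2`. -/
structure PowerLipschitz (F : ℂ → ℂ) (L α : ℝ) : Prop where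
  map_zero : F 0 = 0
  nonneg : 0 ≤ L
  one_le : 1 ≤ α
  bound : ∀ z w, ‖F z - F w‖ ≤ L * (max (min ‖z‖ 2) (min ‖w‖ 2)) ^ α * ‖z - w‖

theorem truncF_eq_nlsF {g : ℝ → ℝ} {z : ℂ} (hz : ‖z‖ ≤ 2) : truncF g z = nlsF g z := by
  simp [truncF, nlsF, min_eq_left hz]

namespace AssumptionF

variable {g : ℝ → ℝ} {C₀ α₁ α₂ : ℝ}

/-- On s ≤ 4, the square of the truncation radius, the higher power is absorbed by the lower one, so
only α₁ matters from here on. -/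
theorem exists_deriv_bound (hF : AssumptionF g C₀ α₁ α₂) :
    ∃ C : ℝ, 0 < C ∧ ∀ s : ℝ, 0 < s → s ≤ 4 → |s * deriv g s| ≤ C * s ^ (α₁ / 2) := by
  have h0 := hF.C₀_pos
  refine ⟨C₀ * (1 + 4 ^ ((α₂ - α₁) / 2)), by positivity, fun s hs hs4 => ?_⟩
  have h1 := hF.bound s hs
  have h2 : s ^ (α₂ / 2) ≤ s ^ (α₁ / 2) * 4 ^ ((α₂ - α₁) / 2) := by
    rw [show α₂ / 2 = α₁ / 2 + (α₂ - α₁) / 2 by ring, Real.rpow_add hs]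
    gcongr
    linarith [hF.α₁_le_α₂]
  have h3 : 0 ≤ |s ^ 2 * deriv (deriv g) s| := abs_nonneg _
  calc |s * deriv g s| ≤ C₀ * (s ^ (α₁ / 2) + s ^ (α₂ / 2)) := by linarith
    _ ≤ C₀ * (s ^ (α₁ / 2) + s ^ (α₁ / 2) * 4 ^ ((α₂ - α₁) / 2)) := by gcongr
    _ = _ := by ring

theorem differentiableAt (hF : AssumptionF g C₀ α₁ α₂) {s : ℝ} (hs : 0 < s) :
    DifferentiableAt ℝ g s :=
  (hF.contDiffOn.differentiableOn (by norm_num)).differentiableAt (Ioi_mem_nhds hs)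

/-- Integration of the derivative bound from g(0) = 0. As `g` need not be differentiable at zero,
this is done by monotonicity: the power function plus σg, with σ = ±1, has nonnegative derivative
inside the interval and vanishes at zero. -/
theorem exists_bound (hF : AssumptionF g C₀ α₁ α₂) :
    ∃ C : ℝ, 0 < C ∧ ∀ s : ℝ, 0 ≤ s → s ≤ 4 → |g s| ≤ C * s ^ (α₁ / 2) := by
  obtain ⟨C, hC, hb⟩ := hF.exists_deriv_bound
  have hα := hF.α₁_pos
  have key : ∀ σ : ℝ, |σ| = 1 → ∀ s : ℝ, 0 ≤ s → s ≤ 4 →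
      0 ≤ (2 * C / α₁) * s ^ (α₁ / 2) + σ * g s := by
    intro σ hσ s hs hs4
    have hmono : MonotoneOn (fun s => (2 * C / α₁) * s ^ (α₁ / 2) + σ * g s) (Icc 0 4) := by
      have hd : ∀ x ∈ Ioo (0 : ℝ) 4,
          HasDerivAt (fun s => (2 * C / α₁) * s ^ (α₁ / 2) + σ * g s)
            ((2 * C / α₁) * (α₁ / 2 * x ^ (α₁ / 2 - 1)) + σ * deriv g x) x := by
        intro x hx
        exact ((Real.hasDerivAt_rpow_const (Or.inl hx.1.ne')).const_mul _).add
          ((hF.differentiableAt hx.1).hasDerivAt.const_mul _)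
      apply monotoneOn_of_deriv_nonneg (convex_Icc 0 4)
      · apply ContinuousOn.add
        · exact ((Real.continuous_rpow_const (by positivity)).const_mul _).continuousOn
        · exact continuousOn_const.mul (hF.continuousOn.mono fun x hx => hx.1)
      · rw [interior_Icc]
        exact fun x hx => (hd x hx).differentiableAt.differentiableWithinAt
      · rw [interior_Icc]
        intro x hx
        rw [(hd x hx).deriv]
        have h1 := hb x hx.1 hx.2.le
        have h2 : x ^ (α₁ / 2) = x * x ^ (α₁ / 2 - 1) := by
          rw [Real.rpow_sub_one hx.1.ne']; field_simp [hx.1.ne']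
        rw [abs_mul, abs_of_pos hx.1, h2] at h1
        have h3 : |deriv g x| ≤ C * x ^ (α₁ / 2 - 1) := by
          refine le_of_mul_le_mul_left ?_ hx.1
          linarith
        have h4 : -(|deriv g x|) ≤ σ * deriv g x := by
          have := neg_abs_le (σ * deriv g x)
          rwa [abs_mul, hσ, one_mul] at this
        have h5 : (2 * C / α₁) * (α₁ / 2 * x ^ (α₁ / 2 - 1)) = C * x ^ (α₁ / 2 - 1) := by
          field_simp
        linarith
    have := hmono (left_mem_Icc.2 (by norm_num)) (show s ∈ Icc (0 : ℝ) 4 from ⟨hs, hs4⟩) hs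
    simpa [hF.map_zero, Real.zero_rpow (by positivity : α₁ / 2 ≠ 0)] using this
  refine ⟨2 * C / α₁, by positivity, fun s hs hs4 => ?_⟩
  rw [abs_le]
  constructor
  · linarith [key 1 (by simp) s hs hs4]
  · linarith [key (-1) (by simp) s hs hs4]

theorem exists_powerLipschitz (hF : AssumptionF g C₀ α₁ α₂) (hα : 1 ≤ α₁) :
    ∃ L : ℝ, PowerLipschitz (truncF g) L α₁ := by
  obtain ⟨C, hC, hb⟩ := hF.exists_deriv_bound
  obtain ⟨C', hC', hb'⟩ := hF.exists_bound
  have sq_rpow : ∀ r : ℝ, 0 ≤ r → (r ^ 2) ^ (α₁ / 2) = r ^ α₁ := by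
    intro r hr
    rw [← Real.rpow_natCast, ← Real.rpow_mul hr]
    congr 1
    push_cast; ring
  -- The factor r₂ is essential: at the mean value point ξ > r₂ it turns 2ξg'(ξ²) into at most
  -- 2ξ²|g'(ξ²)|, which is what the hypothesis controls.
  have key : ∀ r₁ r₂ : ℝ, 0 ≤ r₂ → r₂ < r₁ → r₁ ≤ 2 →
      |g (r₁ ^ 2) - g (r₂ ^ 2)| * r₂ ≤ 2 * C * r₁ ^ α₁ * (r₁ - r₂) := by
    intro r₁ r₂ h0 hlt h2
    obtain ⟨ξ, hξ, hd⟩ := exists_hasDerivAt_eq_slope (fun r => g (r ^ 2))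
      (fun r => deriv g (r ^ 2) * (2 * r)) hlt
      ((hF.continuousOn.comp (continuous_pow 2).continuousOn fun x _ => sq_nonneg x))
      (by
        intro x hx
        have hx0 : 0 < x := h0.trans_lt hx.1
        have h1 : HasDerivAt (fun r : ℝ => r ^ 2) (2 * x) x := by
          simpa using hasDerivAt_pow 2 x
        exact HasDerivAt.comp (h := fun r : ℝ => r ^ 2) x
          (hF.differentiableAt (pow_pos hx0 2)).hasDerivAt h1)
    have hξ0 : 0 < ξ := h0.trans_lt hξ.1
    have hsub : 0 < r₁ - r₂ := sub_pos.2 hlt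
    rw [eq_div_iff hsub.ne'] at hd
    rw [← hd, abs_mul, abs_of_pos hsub]
    have h1 := hb (ξ ^ 2) (by positivity) (by nlinarith [hξ.2])
    rw [sq_rpow ξ hξ0.le, abs_mul, abs_of_pos (by positivity : 0 < ξ ^ 2)] at h1
    have h3 : ξ ^ α₁ ≤ r₁ ^ α₁ := Real.rpow_le_rpow hξ0.le hξ.2.le (by linarith)
    calc |deriv g (ξ ^ 2) * (2 * ξ)| * (r₁ - r₂) * r₂
        = 2 * (|deriv g (ξ ^ 2)| * ξ * r₂) * (r₁ - r₂) := by
          rw [abs_mul, abs_of_pos (by positivity : 0 < 2 * ξ)]; ring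
      _ ≤ 2 * (|deriv g (ξ ^ 2)| * ξ * ξ) * (r₁ - r₂) := by
          gcongr
          exact hξ.1.le
      _ = 2 * (ξ ^ 2 * |deriv g (ξ ^ 2)|) * (r₁ - r₂) := by ring
      _ ≤ 2 * (C * r₁ ^ α₁) * (r₁ - r₂) := by
          have h4 := h1.trans (mul_le_mul_of_nonneg_left h3 hC.le)
          gcongr
      _ = _ := by ring
  have main : ∀ z w : ℂ, ‖w‖ ≤ ‖z‖ →
      ‖truncF g z - truncF g w‖ ≤ (C' + 2 * C) * (min ‖z‖ 2) ^ α₁ * ‖z - w‖ := by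
    intro z w hzw
    have hm0 : 0 ≤ min ‖z‖ 2 := le_min (norm_nonneg _) (by norm_num)
    have hmz : min ‖z‖ 2 ≤ 2 := min_le_right _ _
    have e : truncF g z - truncF g w =
        (g ((min ‖z‖ 2) ^ 2) : ℂ) * (z - w) +
          ((g ((min ‖z‖ 2) ^ 2) - g ((min ‖w‖ 2) ^ 2) : ℝ) : ℂ) * w := by
      simp only [truncF]; push_cast; ring
    have h1 : ‖(g ((min ‖z‖ 2) ^ 2) : ℂ) * (z - w)‖ ≤ C' * (min ‖z‖ 2) ^ α₁ * ‖z - w‖ := by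
      rw [norm_mul, Complex.norm_real, Real.norm_eq_abs]
      have := hb' ((min ‖z‖ 2) ^ 2) (by positivity) (by nlinarith)
      rw [sq_rpow _ hm0] at this
      gcongr
    have h2 : ‖((g ((min ‖z‖ 2) ^ 2) - g ((min ‖w‖ 2) ^ 2) : ℝ) : ℂ) * w‖ ≤
        2 * C * (min ‖z‖ 2) ^ α₁ * ‖z - w‖ := by
      rw [norm_mul, Complex.norm_real, Real.norm_eq_abs]
      -- Beyond radius two both moduli are frozen at two and the difference of the coefficients
      -- vanishes.
      rcases le_or_gt 2 ‖w‖ with hw | hw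
      · rw [min_eq_right hw, min_eq_right (hw.trans hzw)]
        simp only [sub_self, abs_zero, zero_mul]
        positivity
      · rw [min_eq_left hw.le]
        rcases (le_min hzw hw.le).eq_or_lt with h | h
        · rw [← h]
          simp only [sub_self, abs_zero, zero_mul]
          positivity
        · refine (key _ _ (norm_nonneg _) h hmz).trans ?_
          have : min ‖z‖ 2 - ‖w‖ ≤ ‖z - w‖ :=
            (sub_le_sub_right (min_le_left _ _) _).trans (norm_sub_norm_le z w)
          gcongr
    rw [e]
    refine (norm_add_le _ _).trans ((add_le_add h1 h2).trans (le_of_eq ?_))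
    ring
  refine ⟨C' + 2 * C, by simp [truncF], by positivity, hα, fun z w => ?_⟩
  rcases le_total ‖w‖ ‖z‖ with h | h
  · rw [max_eq_left (min_le_min_right _ h)]
    exact main z w h
  · rw [max_eq_right (min_le_min_right _ h), norm_sub_rev, norm_sub_rev z w]
    exact main w z h

end AssumptionF

/-! ### Dominated convergence and mollification in L² -/

theorem tendsto_eLpNorm_two_of_dominated {α ι : Type*} [MeasurableSpace α] {μ : Measure α}
    {l : Filter ι} [l.IsCountablyGenerated] {f : ι → α → ℂ} {f₀ : α → ℂ} {b : α → ℝ}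
    (hf : ∀ n, AEStronglyMeasurable (f n) μ) (hf₀ : AEStronglyMeasurable f₀ μ)
    (hb : MemLp b 2 μ) (hbound : ∀ᶠ n in l, ∀ᵐ x ∂μ, ‖f n x - f₀ x‖ ≤ b x)
    (hlim : ∀ᵐ x ∂μ, Tendsto (fun n => f n x) l (𝓝 (f₀ x))) :
    Tendsto (fun n => eLpNorm (f n - f₀) 2 μ) l (𝓝 0) := by
  have key : Tendsto (fun n => ∫⁻ x, ‖(f n - f₀) x‖ₑ ^ (2 : ℝ) ∂μ) l (𝓝 (∫⁻ _, 0 ∂μ)) := by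
    refine tendsto_lintegral_filter_of_dominated_convergence' (fun x => ‖b x‖ₑ ^ (2 : ℝ))
      (Eventually.of_forall fun n => ((hf n).sub hf₀).enorm.pow_const _) ?_ ?_ ?_
    · filter_upwards [hbound] with n hn
      filter_upwards [hn] with x hx
      gcongr
      rw [enorm_le_iff_norm_le, Pi.sub_apply]
      exact hx.trans (le_abs_self _)
    · have := hb.eLpNorm_lt_top
      rw [eLpNorm_lt_top_iff_lintegral_rpow_enorm_lt_top (by norm_num) (by norm_num)] at this
      simpa using this.ne
    · filter_upwards [hlim] with x hx
      have h1 : Tendsto (fun n => ‖(f n - f₀) x‖ₑ) l (𝓝 0) := by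
        rw [← tendsto_zero_iff_enorm_tendsto_zero]
        simpa using hx.sub_const (f₀ x)
      simpa using h1.ennrpow_const 2
  have h2 := (key.ennrpow_const (1 / 2))
  simp only [lintegral_zero, ENNReal.zero_rpow_of_pos (show (0 : ℝ) < 1 / 2 by norm_num)] at h2
  refine h2.congr fun n => ?_
  rw [eLpNorm_eq_lintegral_rpow_enorm_toReal (by norm_num) (by norm_num)]
  simp

/-- Gives the continuity in the parameter of the L² curves below (symbols, time slices,
superposition, interactions) from pointwise continuity and a local majorant. -/
theorem continuous_toLp_two_of_dominated {α X : Type*} [MeasurableSpace α] {μ : Measure α}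
    [TopologicalSpace X] [FirstCountableTopology X] {f : X → α → ℂ} (hf : ∀ x, MemLp (f x) 2 μ)
    (hbound : ∀ x₀, ∃ b : α → ℝ, MemLp b 2 μ ∧ ∀ᶠ x in 𝓝 x₀, ∀ᵐ y ∂μ, ‖f x y‖ ≤ b y)
    (hcont : ∀ x₀, ∀ᵐ y ∂μ, ContinuousAt (fun x => f x y) x₀) :
    Continuous fun x => (hf x).toLp (f x) := by
  rw [continuous_iff_continuousAt]
  intro x₀
  rw [ContinuousAt, Lp.tendsto_Lp_iff_tendsto_eLpNorm'']
  obtain ⟨b, hb, hbd⟩ := hbound x₀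
  refine tendsto_eLpNorm_two_of_dominated (b := fun y => b y + ‖f x₀ y‖)
    (fun x => (hf x).aestronglyMeasurable) (hf x₀).aestronglyMeasurable
    (hb.add (hf x₀).norm) ?_ (hcont x₀)
  filter_upwards [hbd] with x hx
  filter_upwards [hx] with y hy
  exact (norm_sub_le _ _).trans (by gcongr)

/-- Complex-valued square-integrable functions on the real line. -/
noncomputable abbrev L2 := Lp ℂ 2 (volume : Measure ℝ)

theorem inner_toLp_eq_integral {h : ℝ → ℂ} (hh : MemLp h 2 volume) (w : L2) :
    inner ℂ (hh.toLp h) w = ∫ x, (starRingEnd ℂ) (h x) * w x := by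
  rw [L2.inner_def]
  refine integral_congr_ae ?_
  filter_upwards [hh.coeFn_toLp] with x hx
  rw [hx, RCLike.inner_apply, mul_comm]

theorem Continuous.memLp_two_of_hasCompactSupport {h : ℝ → ℂ} (hc : Continuous h)
    (hs : HasCompactSupport h) : MemLp h 2 volume := hc.memLp_of_hasCompactSupport hs

/-- A sequence of bump functions on the line shrinking to zero. -/
noncomputable def bumpSeq (n : ℕ) : ContDiffBump (0 : ℝ) where
  rIn := ((n : ℝ) + 1)⁻¹
  rOut := 2 * ((n : ℝ) + 1)⁻¹
  rIn_pos := by positivity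
  rIn_lt_rOut := by
    have : 0 < ((n : ℝ) + 1)⁻¹ := by positivity
    linarith

/-- The associated approximate identity. -/
noncomputable def mollifier (n : ℕ) (x : ℝ) : ℝ := (bumpSeq n).normed volume x

theorem mollifier_nonneg (n : ℕ) (x : ℝ) : 0 ≤ mollifier n x := (bumpSeq n).nonneg_normed x

theorem contDiff_mollifier (n : ℕ) : ContDiff ℝ (⊤ : ℕ∞) (mollifier n) :=
  (bumpSeq n).contDiff_normed

theorem hasCompactSupport_mollifier (n : ℕ) : HasCompactSupport (mollifier n) :=
  (bumpSeq n).hasCompactSupport_normed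

theorem integral_mollifier_sub (n : ℕ) (x : ℝ) : ∫ y, mollifier n (x - y) = 1 := by
  rw [integral_sub_left_eq_self (fun y => mollifier n y) volume x]
  exact (bumpSeq n).integral_normed

theorem hasCompactSupport_mollifier_sub (n : ℕ) (x : ℝ) :
    HasCompactSupport fun y => mollifier n (x - y) :=
  (hasCompactSupport_mollifier n).comp_homeomorph (Homeomorph.subLeft x)

theorem contDiff_mollifier_sub (n : ℕ) (x : ℝ) :
    ContDiff ℝ (⊤ : ℕ∞) fun y => mollifier n (x - y) :=
  (contDiff_mollifier n).comp (contDiff_const.sub contDiff_id)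

theorem ae_tendsto_mollifier {E : Type*} [NormedAddCommGroup E] [NormedSpace ℝ E] [CompleteSpace E]
    {w : ℝ → E} (hw : LocallyIntegrable w volume) :
    ∀ᵐ x, Tendsto (fun n => ∫ y, mollifier n (x - y) • w y) atTop (𝓝 (w x)) := by
  have h1 : Tendsto (fun n => (bumpSeq n).rOut) atTop (𝓝 0) := by
    have h := (tendsto_one_div_add_atTop_nhds_zero_nat (𝕜 := ℝ)).const_mul 2
    simp only [mul_zero, one_div] at h
    exact h
  have := ContDiffBump.ae_convolution_tendsto_right_of_locallyIntegrable (φ := bumpSeq) (K := 2)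
    h1 (Eventually.of_forall fun n => le_rfl) hw
  filter_upwards [this] with x hx
  refine hx.congr fun n => ?_
  rw [convolution_eq_swap]
  rfl

/-- A sup bound by duality in which nonnegative smooth tests suffice: the mollifiers centred at x
are such tests of mass one, and the averages converge to w(x) almost everywhere. -/
theorem ae_norm_le_of_integral_le {w : ℝ → ℂ} (hw : LocallyIntegrable w volume) {C : ℝ}
    (h : ∀ θ : ℝ → ℝ, ContDiff ℝ (⊤ : ℕ∞) θ → HasCompactSupport θ → (∀ x, 0 ≤ θ x) →
      ‖∫ x, (θ x : ℂ) * w x‖ ≤ C * ∫ x, θ x) :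
    ∀ᵐ x, ‖w x‖ ≤ C := by
  filter_upwards [ae_tendsto_mollifier hw] with x hx
  refine le_of_tendsto hx.norm (Eventually.of_forall fun n => ?_)
  have := h (fun y => mollifier n (x - y)) (contDiff_mollifier_sub n x)
    (hasCompactSupport_mollifier_sub n x) (fun y => mollifier_nonneg n _)
  rw [integral_mollifier_sub, mul_one] at this
  simpa [Complex.real_smul] using this

theorem locallyIntegrable_L2 (w : L2) : LocallyIntegrable w volume :=
  (Lp.memLp w).locallyIntegrable (by norm_num)

theorem memLp_mollifier_sub (n : ℕ) (x : ℝ) :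
    MemLp (fun y => (mollifier n (x - y) : ℂ)) 2 volume := by
  apply Continuous.memLp_two_of_hasCompactSupport
  · exact Complex.continuous_ofReal.comp (contDiff_mollifier_sub n x).continuous
  · exact (hasCompactSupport_mollifier_sub n x).comp_left (g := fun r : ℝ => (r : ℂ)) rfl

theorem continuous_toLp_mollifier_sub (n : ℕ) :
    Continuous fun x => (memLp_mollifier_sub n x).toLp _ := by
  refine continuous_toLp_two_of_dominated (memLp_mollifier_sub n) (fun x₀ => ?_) fun x₀ => ?_
  · obtain ⟨M, hM⟩ := (hasCompactSupport_mollifier n).exists_bound_of_continuous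
      (contDiff_mollifier n).continuous
    obtain ⟨R, hR⟩ := (hasCompactSupport_mollifier n).isCompact.isBounded.subset_closedBall 0
    refine ⟨(Metric.closedBall x₀ (R + 1)).indicator fun _ => M,
      memLp_indicator_const 2 measurableSet_closedBall M
        (Or.inr (isCompact_closedBall x₀ (R + 1)).measure_lt_top.ne), ?_⟩
    filter_upwards [Metric.ball_mem_nhds x₀ one_pos] with x hx
    refine Eventually.of_forall fun y => ?_
    by_cases hy : y ∈ Metric.closedBall x₀ (R + 1)
    · rw [indicator_of_mem hy, Complex.norm_real]
      exact hM _
    · rw [indicator_of_notMem hy]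
      suffices mollifier n (x - y) = 0 by simp [this]
      by_contra hne
      have h1 := hR (subset_tsupport _ hne)
      rw [Metric.mem_closedBall, Real.dist_eq, sub_zero] at h1
      apply hy
      rw [Metric.mem_closedBall, Real.dist_eq]
      rw [Metric.mem_ball, Real.dist_eq] at hx
      calc |y - x₀| = |(x - x₀) - (x - y)| := by ring_nf
        _ ≤ |x - x₀| + |x - y| := abs_sub _ _
        _ ≤ R + 1 := by linarith
  · refine Eventually.of_forall fun y => Continuous.continuousAt ?_
    exact Complex.continuous_ofReal.comp ((contDiff_mollifier n).continuous.comp (by fun_prop))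

/-- A continuous curve in `L²` is represented by a jointly measurable function. -/
theorem exists_measurable_representative {ζ : ℝ → L2} (hζ : Continuous ζ) :
    ∃ W : ℝ → ℝ → ℂ, StronglyMeasurable (fun p : ℝ × ℝ => W p.1 p.2) ∧ ∀ t, W t =ᵐ[volume] ζ t := by
  have hm : ∀ n : ℕ, StronglyMeasurable fun p : ℝ × ℝ =>
      inner ℂ ((memLp_mollifier_sub n p.2).toLp _) (ζ p.1) := by
    intro n
    apply Continuous.stronglyMeasurable
    exact ((continuous_toLp_mollifier_sub n).comp continuous_snd).inner (hζ.comp continuous_fst)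
  -- The mollified averages are inner products of two continuous curves, hence jointly continuous in
  -- (t, x). `limUnder` is measurable whether or not the sequence converges, and for each t it does
  -- converge at almost every x.
  refine ⟨fun t x => limUnder atTop fun n =>
      inner ℂ ((memLp_mollifier_sub n x).toLp _) (ζ t), StronglyMeasurable.limUnder hm, fun t => ?_⟩
  filter_upwards [ae_tendsto_mollifier (locallyIntegrable_L2 (ζ t))] with x hx
  apply Tendsto.limUnder_eq
  refine hx.congr fun n => ?_
  rw [inner_toLp_eq_integral]
  simp [Complex.real_smul]

/-! ### The free Schrödinger group and its dispersive estimate -/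

/-- The Fourier multiplier of `exp(-i r ∂ₓ²)`. -/
noncomputable def schrSymbol (r ξ : ℝ) : ℂ :=
  Complex.exp (((4 * Real.pi ^ 2 * r * ξ ^ 2 : ℝ) : ℂ) * Complex.I)

@[simp] theorem norm_schrSymbol (r ξ : ℝ) : ‖schrSymbol r ξ‖ = 1 :=
  Complex.norm_exp_ofReal_mul_I _

theorem conj_schrSymbol (r ξ : ℝ) : (starRingEnd ℂ) (schrSymbol r ξ) = schrSymbol (-r) ξ := by
  rw [schrSymbol, schrSymbol, ← Complex.exp_conj, map_mul, Complex.conj_ofReal, Complex.conj_I]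
  congr 1
  push_cast; ring

theorem continuous_schrSymbol : Continuous fun p : ℝ × ℝ => schrSymbol p.1 p.2 := by
  unfold schrSymbol
  fun_prop

/-- All derivatives are unimodular up to a power of i. Composed with a quadratic polynomial, this
lets the symbol act on Schwartz functions. -/
theorem hasTemperateGrowth_exp_ofReal_mul_I :
    (fun x : ℝ => Complex.exp ((x : ℂ) * Complex.I)).HasTemperateGrowth := by
  have hd : ∀ n : ℕ, iteratedDeriv n (fun x : ℝ => Complex.exp ((x : ℂ) * Complex.I)) =
      fun x : ℝ => Complex.I ^ n * Complex.exp ((x : ℂ) * Complex.I) := by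
    intro n
    induction n with
    | zero => simp
    | succ n ih =>
      rw [iteratedDeriv_succ, ih]
      ext x
      have h : HasDerivAt (fun x : ℝ => (x : ℂ) * Complex.I) (1 * Complex.I) x :=
        (Complex.ofRealCLM.hasDerivAt (x := x)).mul_const Complex.I
      rw [(h.cexp.const_mul (Complex.I ^ n)).deriv]
      ring
  refine ⟨?_, fun n => ⟨0, 1, fun x => ?_⟩⟩
  · exact (Complex.ofRealCLM.contDiff.mul contDiff_const).cexp
  · rw [norm_iteratedFDeriv_eq_norm_iteratedDeriv, hd]
    simp [Complex.norm_exp_ofReal_mul_I]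

theorem hasTemperateGrowth_schrSymbol (r : ℝ) : (schrSymbol r).HasTemperateGrowth := by
  have h : (fun ξ : ℝ => 4 * Real.pi ^ 2 * r * ξ ^ 2).HasTemperateGrowth :=
    (Function.HasTemperateGrowth.const (4 * Real.pi ^ 2 * r)).mul
      (Function.HasTemperateGrowth.id'.pow 2)
  exact hasTemperateGrowth_exp_ofReal_mul_I.comp h

theorem memLp_schrSymbol_mul (r : ℝ) (w : L2) :
    MemLp (fun ξ => schrSymbol r ξ * w ξ) 2 volume := by
  refine (Lp.memLp w).of_le ?_ (Eventually.of_forall fun ξ => by simp)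
  exact (continuous_schrSymbol.comp (Continuous.prodMk_right r)).aestronglyMeasurable.mul
    (Lp.aestronglyMeasurable w)

/-- Multiplication by the symbol of `exp(-i r ∂ₓ²)`. -/
noncomputable def schrMul (r : ℝ) : L2 →ₗᵢ[ℂ] L2 where
  toFun w := (memLp_schrSymbol_mul r w).toLp _
  map_add' v w := by
    rw [← MemLp.toLp_add]
    apply MemLp.toLp_congr
    filter_upwards [Lp.coeFn_add v w] with ξ hξ
    rw [hξ, Pi.add_apply, Pi.add_apply, mul_add]
  map_smul' c w := by
    rw [RingHom.id_apply, ← MemLp.toLp_const_smul]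
    apply MemLp.toLp_congr
    filter_upwards [Lp.coeFn_smul c w] with ξ hξ
    simp only [hξ, Pi.smul_apply, smul_eq_mul]
    ring
  norm_map' w := by
    change ‖(memLp_schrSymbol_mul r w).toLp _‖ = ‖w‖
    rw [Lp.norm_toLp, Lp.norm_def]
    congr 1
    exact eLpNorm_congr_norm_ae (Eventually.of_forall fun ξ => by simp)

theorem schrMul_apply (r : ℝ) (w : L2) : schrMul r w = (memLp_schrSymbol_mul r w).toLp _ := rfl

theorem continuous_schrMul (w : L2) : Continuous fun r => schrMul r w := by
  refine continuous_toLp_two_of_dominated (fun r => memLp_schrSymbol_mul r w) (fun r₀ => ?_)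
    fun r₀ => ?_
  · exact ⟨fun ξ => ‖w ξ‖, (Lp.memLp w).norm,
      Eventually.of_forall fun r => Eventually.of_forall fun ξ => by simp⟩
  · exact Eventually.of_forall fun ξ => Continuous.continuousAt
      ((continuous_schrSymbol.comp (Continuous.prodMk_left ξ)).mul continuous_const)

theorem inner_schrMul_left (r : ℝ) (v w : L2) :
    inner ℂ v (schrMul r w) = ∫ ξ, (starRingEnd ℂ) (v ξ) * (schrSymbol r ξ * w ξ) := by
  rw [L2.inner_def]
  refine integral_congr_ae ?_
  filter_upwards [(memLp_schrSymbol_mul r w).coeFn_toLp] with ξ hξ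
  rw [schrMul_apply, hξ, RCLike.inner_apply, mul_comm]

/-- The operator `exp(-i r ∂ₓ²)` on `L²(ℝ)`. -/
noncomputable def schr (r : ℝ) : L2 →ₗᵢ[ℂ] L2 :=
  (Lp.fourierTransformₗᵢ ℝ ℂ).symm.toLinearIsometry.comp
    ((schrMul r).comp (Lp.fourierTransformₗᵢ ℝ ℂ).toLinearIsometry)

theorem schr_apply (r : ℝ) (w : L2) : schr r w = 𝓕⁻ (schrMul r (𝓕 w)) := rfl

theorem continuous_schr : Continuous fun p : ℝ × L2 => schr p.1 p.2 := by
  refine continuous_prod_of_continuous_lipschitzWith' _ 1 (fun r => (schr r).lipschitz) fun w => ?_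
  exact (Lp.fourierTransformₗᵢ ℝ ℂ).symm.continuous.comp (continuous_schrMul (𝓕 w))

theorem Continuous.schr {X : Type*} [TopologicalSpace X] {f : X → ℝ} {g : X → L2}
    (hf : Continuous f) (hg : Continuous g) : Continuous fun x => schr (f x) (g x) :=
  Continuous.comp (g := fun p : ℝ × L2 => _root_.schr p.1 p.2) (f := fun x => (f x, g x))
    continuous_schr (hf.prodMk hg)

theorem inner_schr (r : ℝ) (v w : L2) : inner ℂ v (schr r w) = inner ℂ (𝓕 v) (schrMul r (𝓕 w)) := by
  rw [schr_apply, ← Lp.inner_fourier_eq]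
  congr 1
  exact (Lp.fourierTransformₗᵢ ℝ ℂ).apply_symm_apply _

/-- The operator `exp(-i r ∂ₓ²)` on Schwartz functions. -/
noncomputable def schrS (r : ℝ) (h : 𝓢(ℝ, ℂ)) : 𝓢(ℝ, ℂ) :=
  SchwartzMap.fourierMultiplierCLM ℂ (schrSymbol r) h

/-- The adjoint of the group is the group at the opposite time, since conjugating the symbol changes
the sign of r. With it the dispersive estimate, proved for Schwartz functions, passes to L² by
duality. -/
theorem inner_toLp_schr (r : ℝ) (h : 𝓢(ℝ, ℂ)) (w : L2) :
    inner ℂ (h.toLp 2) (schr r w) = inner ℂ ((schrS (-r) h).toLp 2) w := by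
  rw [inner_schr, ← Lp.inner_fourier_eq ((schrS (-r) h).toLp 2 volume) w, SchwartzMap.toLp_fourier_eq,
    SchwartzMap.toLp_fourier_eq, inner_schrMul_left]
  have e : 𝓕 (schrS (-r) h) = SchwartzMap.smulLeftCLM ℂ (schrSymbol (-r)) (𝓕 h) := by
    rw [schrS, SchwartzMap.fourierMultiplierCLM_apply, FourierTransform.fourier_fourierInv_eq]
  rw [e, L2.inner_def]
  refine integral_congr_ae ?_
  filter_upwards [(𝓕 h).coeFn_toLp 2,
    (SchwartzMap.smulLeftCLM ℂ (schrSymbol (-r)) (𝓕 h)).coeFn_toLp 2] with ξ h1 h2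
  rw [h1, h2, RCLike.inner_apply,
    SchwartzMap.smulLeftCLM_apply_apply (hasTemperateGrowth_schrSymbol (-r)), smul_eq_mul, map_mul,
    conj_schrSymbol, neg_neg]
  ring

/-- Moving the Fourier transform from `h` to the Gaussian produces the kernel b^{-1/2} exp(-π(y -
x)²/b). Its modulus is at most |b|^{-1/2}, because 1/b has nonnegative real part. -/
theorem norm_integral_gaussian_mul_fourier_le {b : ℂ} (hb : 0 < b.re) (x : ℝ) (h : 𝓢(ℝ, ℂ)) :
    ‖∫ ξ : ℝ, Complex.exp (-Real.pi * b * ξ ^ 2 + 2 * Real.pi * (Complex.I * x) * ξ) * 𝓕 h ξ‖ ≤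
      ‖b‖ ^ (-(1 / 2) : ℝ) * ∫ y, ‖h y‖ := by
  set k : ℝ → ℂ := fun ξ =>
    Complex.exp (-Real.pi * b * ξ ^ 2 + 2 * Real.pi * (Complex.I * x) * ξ) with hk
  have hki : Integrable k := by
    have := GaussianFourier.integrable_cexp_neg_mul_sq_add_real_mul_I hb 0
    have h2 := integrable_cexp_quadratic (b := Real.pi * b) (by
      simpa using mul_pos Real.pi_pos hb) (2 * Real.pi * (Complex.I * x)) 0
    refine h2.congr (Eventually.of_forall fun ξ => ?_)
    simp only [hk]
    congr 1
    ring
  have flip : ∫ ξ : ℝ, k ξ * 𝓕 h ξ = ∫ y : ℝ, 𝓕 k y * h y := by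
    have := VectorFourier.integral_fourierIntegral_smul_eq_flip (L := innerₗ ℝ)
      (μ := volume) (ν := volume) Real.continuous_fourierChar continuous_inner hki h.integrable
    rw [flip_innerₗ] at this
    exact this.symm
  rw [flip, fourier_gaussian_pi' hb]
  have hb0 : b ≠ 0 := by
    rintro rfl
    simp at hb
  calc _ ≤ ∫ y : ℝ, ‖b‖ ^ (-(1 / 2) : ℝ) * ‖h y‖ := by
        refine norm_integral_le_of_norm_le (h.integrable.norm.const_mul _)
          (Eventually.of_forall fun y => ?_)
        rw [norm_mul]
        gcongr
        rw [norm_mul, norm_div, norm_one]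
        have h1 : ‖b ^ (1 / 2 : ℂ)‖ = ‖b‖ ^ (1 / 2 : ℝ) := by
          have := Complex.norm_cpow_real b (1 / 2)
          push_cast at this
          exact this
        rw [h1, Real.rpow_neg (norm_nonneg _), one_div]
        refine mul_le_of_le_one_right (by positivity) ?_
        rw [Complex.norm_exp, Real.exp_le_one_iff]
        have e : -(Real.pi : ℂ) / b * (y + Complex.I * (Complex.I * x)) ^ 2 =
            ((-(Real.pi * (y - x) ^ 2) : ℝ) : ℂ) * b⁻¹ := by
          rw [← mul_assoc, Complex.I_mul_I]
          push_cast
          ring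
        rw [e, Complex.re_ofReal_mul, Complex.inv_re]
        have : 0 ≤ b.re / Complex.normSq b := div_nonneg hb.le (Complex.normSq_nonneg _)
        have h2 : 0 ≤ Real.pi * (y - x) ^ 2 := by positivity
        nlinarith
    _ = _ := integral_const_mul _ _

/-- The dispersive estimate. -/
theorem norm_schrS_apply_le {r : ℝ} (hr : r ≠ 0) (h : 𝓢(ℝ, ℂ)) (x : ℝ) :
    ‖schrS r h x‖ ≤ |r| ^ (-(1 / 2) : ℝ) * ∫ y, ‖h y‖ := by
  have e1 : schrS r h x =
      ∫ ξ : ℝ, Complex.exp (2 * Real.pi * (Complex.I * x) * ξ) * (schrSymbol r ξ * 𝓕 h ξ) := by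
    rw [schrS, SchwartzMap.fourierMultiplierCLM_apply, SchwartzMap.fourierInv_coe,
      Real.fourierInv_eq']
    refine integral_congr_ae (Eventually.of_forall fun ξ => ?_)
    simp only [SchwartzMap.smulLeftCLM_apply_apply (hasTemperateGrowth_schrSymbol r), smul_eq_mul]
    congr 2
    simp only [RCLike.inner_apply, conj_trivial]
    push_cast
    ring
  -- The oscillating symbol is exp(-πbξ²) at b = -4πir. The added real part 1/(n + 1) makes the
  -- Gaussian integrable and is then sent to zero.
  set b : ℕ → ℂ := fun n => ((1 / ((n : ℝ) + 1) : ℝ) : ℂ) - ((4 * Real.pi * r : ℝ) : ℂ) * Complex.I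
  have hbre : ∀ n, (b n).re = 1 / ((n : ℝ) + 1) := by
    intro n
    simp only [b, Complex.sub_re, Complex.ofReal_re, Complex.re_ofReal_mul, Complex.I_re, mul_zero,
      sub_zero]
  have hbim : ∀ n, (b n).im = -(4 * Real.pi * r) := by
    intro n
    simp only [b, Complex.sub_im, Complex.ofReal_im, Complex.mul_im,
      Complex.ofReal_re, Complex.I_re, Complex.I_im]
    ring
  have hlim : Tendsto (fun n => ∫ ξ : ℝ,
      Complex.exp (-Real.pi * b n * ξ ^ 2 + 2 * Real.pi * (Complex.I * x) * ξ) * 𝓕 h ξ) atTop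
      (𝓝 (schrS r h x)) := by
    rw [e1]
    refine tendsto_integral_of_dominated_convergence (fun ξ => ‖𝓕 h ξ‖) (fun n => ?_)
      (𝓕 h).integrable.norm (fun n => ?_) ?_
    · refine (Continuous.mul ?_ (𝓕 h).continuous).aestronglyMeasurable
      fun_prop
    · refine Eventually.of_forall fun ξ => ?_
      rw [norm_mul]
      refine mul_le_of_le_one_left (norm_nonneg _) ?_
      rw [Complex.norm_exp, Real.exp_le_one_iff]
      have : (-Real.pi * b n * ξ ^ 2 + 2 * Real.pi * (Complex.I * x) * ξ).re =
          -(Real.pi * (b n).re * ξ ^ 2) := by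
        rw [show (-Real.pi * b n * ξ ^ 2 + 2 * Real.pi * (Complex.I * x) * ξ : ℂ) =
          ((-(Real.pi * ξ ^ 2) : ℝ) : ℂ) * b n + ((2 * Real.pi * x * ξ : ℝ) : ℂ) * Complex.I by
            push_cast; ring]
        rw [Complex.add_re, Complex.re_ofReal_mul, Complex.re_ofReal_mul, Complex.I_re]
        ring
      rw [this, hbre]
      have : 0 ≤ Real.pi * (1 / ((n : ℝ) + 1)) * ξ ^ 2 := by positivity
      linarith
    · refine Eventually.of_forall fun ξ => ?_
      have hb0 : Tendsto b atTop (𝓝 (((0 : ℝ) : ℂ) - ((4 * Real.pi * r : ℝ) : ℂ) * Complex.I)) :=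
        ((Complex.continuous_ofReal.tendsto 0).comp
          (tendsto_one_div_add_atTop_nhds_zero_nat (𝕜 := ℝ))).sub_const _
      have hc : Continuous fun β : ℂ =>
          Complex.exp (-Real.pi * β * ξ ^ 2 + 2 * Real.pi * (Complex.I * x) * ξ) * 𝓕 h ξ := by
        fun_prop
      have := (hc.tendsto _).comp hb0
      refine this.trans (le_of_eq ?_)
      congr 1
      rw [schrSymbol, ← mul_assoc (Complex.exp _), ← Complex.exp_add]
      congr 2
      push_cast
      ring
  refine le_of_tendsto hlim.norm (Eventually.of_forall fun n => ?_)
  refine (norm_integral_gaussian_mul_fourier_le (by rw [hbre]; positivity) x h).trans ?_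
  have hI : 0 ≤ ∫ y, ‖h y‖ := integral_nonneg fun y => norm_nonneg _
  refine mul_le_mul_of_nonneg_right ?_ hI
  refine Real.rpow_le_rpow_of_nonpos (abs_pos.2 hr) ?_ (by norm_num)
  -- |b n| ≥ 4π|r| ≥ |r| uniformly in n; the factor 4π is given away.
  have h1 := Complex.abs_im_le_norm (b n)
  rw [hbim, abs_neg, abs_mul, abs_of_pos (by positivity : 0 < 4 * Real.pi)] at h1
  have h2 : |r| ≤ 4 * Real.pi * |r| :=
    le_mul_of_one_le_left (abs_nonneg _) (by linarith [Real.pi_gt_three])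
  exact h2.trans h1

/-- The dispersive estimate in dual form. -/
theorem norm_inner_toLp_schr_le {r : ℝ} (hr : r ≠ 0) (h : 𝓢(ℝ, ℂ)) (w : L2)
    (hw : Integrable w volume) :
    ‖inner ℂ (h.toLp 2) (schr r w)‖ ≤
      |r| ^ (-(1 / 2) : ℝ) * (∫ y, ‖h y‖) * ∫ y, ‖w y‖ := by
  rw [inner_toLp_schr, SchwartzMap.toLp, inner_toLp_eq_integral, ← integral_const_mul]
  refine norm_integral_le_of_norm_le (hw.norm.const_mul _) (Eventually.of_forall fun y => ?_)
  rw [norm_mul, RCLike.norm_conj]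
  gcongr
  have := norm_schrS_apply_le (neg_ne_zero.2 hr) h y
  rwa [abs_neg] at this

/-! ### Duhamel's equation with zero data at infinity -/

theorem integral_exp_neg_mul_Ioi_zero {lam : ℝ} (hlam : 0 < lam) :
    ∫ r in Ioi (0 : ℝ), Real.exp (-lam * r) = 1 / lam := by
  rw [integral_exp_mul_Ioi (neg_lt_zero.2 hlam)]
  simp

theorem integrableOn_exp_neg_mul_Ioi_zero {lam : ℝ} (hlam : 0 < lam) :
    IntegrableOn (fun r => Real.exp (-lam * r)) (Ioi (0 : ℝ)) :=
  integrableOn_exp_mul_Ioi (neg_lt_zero.2 hlam) 0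


section Duhamel

variable {E : Type*} [NormedAddCommGroup E] [NormedSpace ℂ E]

/-- The weighted Duhamel integrand, with data at infinity. -/
noncomputable def duhamelIntegrand (V : ℝ → E →ₗᵢ[ℂ] E) (N : ℝ → E → E) (lam : ℝ) (ζ : ℝ → E)
    (t r : ℝ) : E :=
  V r ((Real.exp (lam * max t 0) : ℂ) •
    N (max t 0 + r) ((Real.exp (-lam * (max t 0 + r)) : ℂ) • ζ (max t 0 + r)))

theorem norm_exp_smul (x : ℝ) (v : E) : ‖(Real.exp x : ℂ) • v‖ = Real.exp x * ‖v‖ := by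
  rw [norm_smul, Complex.norm_real, Real.norm_eq_abs, Real.abs_exp]

theorem continuous_duhamelIntegrand {V : ℝ → E →ₗᵢ[ℂ] E} {N : ℝ → E → E}
    (hV : Continuous fun p : ℝ × E => V p.1 p.2) (hN : Continuous fun p : ℝ × E => N p.1 p.2)
    (lam : ℝ) {ζ : ℝ → E} (hζ : Continuous ζ) :
    Continuous fun p : ℝ × ℝ => duhamelIntegrand V N lam ζ p.1 p.2 := by
  unfold duhamelIntegrand
  have h1 : Continuous fun p : ℝ × ℝ => max p.1 0 + p.2 := by fun_prop
  refine hV.comp (continuous_snd.prodMk (Continuous.smul (by fun_prop) ?_))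
  refine hN.comp (h1.prodMk (Continuous.smul ?_ (hζ.comp h1)))
  fun_prop

variable {V : ℝ → E →ₗᵢ[ℂ] E} {N : ℝ → E → E} {K Lip lam : ℝ}

/-- The weight e^{λt} against the decay e^{-λ(t+r)} leaves e^{-λr}, which is integrable in r
uniformly in t; the isometry `V r` costs nothing. -/
theorem norm_duhamelIntegrand_le (hLip : ∀ t v w, ‖N t v - N t w‖ ≤ Lip * ‖v - w‖)
    (hK : ∀ t, 0 ≤ t → ‖N t 0‖ ≤ K * Real.exp (-lam * t)) (hLip0 : 0 ≤ Lip) (ζ : ℝ →ᵇ E)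
    (t : ℝ) {r : ℝ} (hr : 0 < r) :
    ‖duhamelIntegrand V N lam ζ t r‖ ≤ (K + Lip * ‖ζ‖) * Real.exp (-lam * r) := by
  have hs : 0 ≤ max t 0 + r := add_nonneg (le_max_right _ _) hr.le
  rw [duhamelIntegrand, LinearIsometry.norm_map, norm_exp_smul]
  have h1 : ‖N (max t 0 + r) ((Real.exp (-lam * (max t 0 + r)) : ℂ) • ζ (max t 0 + r))‖ ≤
      (K + Lip * ‖ζ‖) * Real.exp (-lam * (max t 0 + r)) := by
    have h2 := hLip (max t 0 + r) ((Real.exp (-lam * (max t 0 + r)) : ℂ) • ζ (max t 0 + r)) 0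
    rw [sub_zero, norm_exp_smul] at h2
    have h3 := norm_le_norm_add_norm_sub' (N (max t 0 + r)
      ((Real.exp (-lam * (max t 0 + r)) : ℂ) • ζ (max t 0 + r))) (N (max t 0 + r) 0)
    have h4 := hK _ hs
    have h5 : Lip * (Real.exp (-lam * (max t 0 + r)) * ‖ζ (max t 0 + r)‖) ≤
        Lip * (Real.exp (-lam * (max t 0 + r)) * ‖ζ‖) := by
      gcongr
      exact ζ.norm_coe_le_norm _
    linarith
  calc _ ≤ Real.exp (lam * max t 0) *
        ((K + Lip * ‖ζ‖) * Real.exp (-lam * (max t 0 + r))) := by gcongr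
    _ = (K + Lip * ‖ζ‖) * (Real.exp (lam * max t 0) * Real.exp (-lam * (max t 0 + r))) := by ring
    _ = _ := by rw [← Real.exp_add]; ring_nf

theorem norm_duhamelIntegrand_sub_le (hLip : ∀ t v w, ‖N t v - N t w‖ ≤ Lip * ‖v - w‖)
    (hLip0 : 0 ≤ Lip) (ζ ζ' : ℝ →ᵇ E) (t r : ℝ) :
    ‖duhamelIntegrand V N lam ζ t r - duhamelIntegrand V N lam ζ' t r‖ ≤
      (Lip * ‖ζ - ζ'‖) * Real.exp (-lam * r) := by
  rw [duhamelIntegrand, duhamelIntegrand, ← map_sub, LinearIsometry.norm_map, ← smul_sub,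
    norm_exp_smul]
  have h2 := hLip (max t 0 + r) ((Real.exp (-lam * (max t 0 + r)) : ℂ) • ζ (max t 0 + r))
    ((Real.exp (-lam * (max t 0 + r)) : ℂ) • ζ' (max t 0 + r))
  rw [← smul_sub, norm_exp_smul] at h2
  have h5 : Lip * (Real.exp (-lam * (max t 0 + r)) * ‖ζ (max t 0 + r) - ζ' (max t 0 + r)‖) ≤
      Lip * (Real.exp (-lam * (max t 0 + r)) * ‖ζ - ζ'‖) := by
    gcongr
    exact (ζ - ζ').norm_coe_le_norm _
  calc _ ≤ Real.exp (lam * max t 0) *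
        (Lip * (Real.exp (-lam * (max t 0 + r)) * ‖ζ - ζ'‖)) := by
        gcongr
        exact h2.trans h5
    _ = (Lip * ‖ζ - ζ'‖) * (Real.exp (lam * max t 0) * Real.exp (-lam * (max t 0 + r))) := by ring
    _ = _ := by rw [← Real.exp_add]; ring_nf

/-- Existence of an exponentially decaying solution of a semilinear Duhamel equation with zero data
at infinity. -/
theorem exists_decaying_duhamel_solution [CompleteSpace E]
    (hV : Continuous fun p : ℝ × E => V p.1 p.2) (hN : Continuous fun p : ℝ × E => N p.1 p.2)
    (hLip : ∀ t v w, ‖N t v - N t w‖ ≤ Lip * ‖v - w‖)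
    (hK : ∀ t, 0 ≤ t → ‖N t 0‖ ≤ K * Real.exp (-lam * t)) (hLip0 : 0 ≤ Lip)
    (hlam : 0 < lam) (hlamLip : 2 * Lip ≤ lam) :
    ∃ η : ℝ → E, Continuous η ∧
      (∀ t, 0 ≤ t → η t = (-Complex.I) • ∫ r in Ioi (0 : ℝ), V r (N (t + r) (η (t + r)))) ∧
      ∀ t, 0 ≤ t → ‖η t‖ ≤ 2 * K / lam * Real.exp (-lam * t) := by
  have hint : ∀ (ζ : ℝ →ᵇ E) (t : ℝ),
      IntegrableOn (duhamelIntegrand V N lam ζ t) (Ioi (0 : ℝ)) := by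
    intro ζ t
    refine Integrable.mono' ((integrableOn_exp_neg_mul_Ioi_zero hlam).const_mul (K + Lip * ‖ζ‖))
      ((continuous_duhamelIntegrand hV hN lam ζ.continuous).comp
        (Continuous.prodMk_right t)).aestronglyMeasurable ?_
    filter_upwards [self_mem_ae_restrict measurableSet_Ioi] with r hr
    exact norm_duhamelIntegrand_le hLip hK hLip0 ζ t hr
  have hnorm : ∀ (ζ : ℝ →ᵇ E) (t : ℝ),
      ‖(-Complex.I) • ∫ r in Ioi (0 : ℝ), duhamelIntegrand V N lam ζ t r‖ ≤
        (K + Lip * ‖ζ‖) / lam := by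
    intro ζ t
    rw [norm_smul, norm_neg, Complex.norm_I, one_mul]
    refine (norm_integral_le_of_norm_le
      ((integrableOn_exp_neg_mul_Ioi_zero hlam).const_mul (K + Lip * ‖ζ‖)) ?_).trans ?_
    · filter_upwards [self_mem_ae_restrict measurableSet_Ioi] with r hr
      exact norm_duhamelIntegrand_le hLip hK hLip0 ζ t hr
    · rw [integral_const_mul, integral_exp_neg_mul_Ioi_zero hlam]
      exact le_of_eq (by ring)
  have hcont : ∀ ζ : ℝ →ᵇ E,
      Continuous fun t => (-Complex.I) • ∫ r in Ioi (0 : ℝ), duhamelIntegrand V N lam ζ t r := by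
    intro ζ
    refine Continuous.const_smul ?_ _
    refine continuous_of_dominated
      (bound := fun r => (K + Lip * ‖ζ‖) * Real.exp (-lam * r)) (fun t => (hint ζ t).1) (fun t => ?_)
      ((integrableOn_exp_neg_mul_Ioi_zero hlam).const_mul (K + Lip * ‖ζ‖))
      (Eventually.of_forall fun r => (continuous_duhamelIntegrand hV hN lam ζ.continuous).comp
        (Continuous.prodMk_left r))
    filter_upwards [self_mem_ae_restrict measurableSet_Ioi] with r hr
    exact norm_duhamelIntegrand_le hLip hK hLip0 ζ t hr
  -- The unknown is ζ(t) = e^{λt}η(t). Freezing negative times at zero by `max t 0` lets it live on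
  -- all of ℝ. Integrating e^{-λr} shows that Φ has Lipschitz constant Lip/λ ≤ 1/2.
  let Φ : (ℝ →ᵇ E) → (ℝ →ᵇ E) := fun ζ => BoundedContinuousFunction.ofNormedAddCommGroup
    (fun t => (-Complex.I) • ∫ r in Ioi (0 : ℝ), duhamelIntegrand V N lam ζ t r) (hcont ζ) _
    (hnorm ζ)
  have hΦ : ∀ ζ t, Φ ζ t = (-Complex.I) • ∫ r in Ioi (0 : ℝ), duhamelIntegrand V N lam ζ t r :=
    fun ζ t => rfl
  have hcontr : ContractingWith (1 / 2) Φ := by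
    refine ⟨by norm_num, LipschitzWith.of_dist_le_mul fun ζ ζ' => ?_⟩
    rw [BoundedContinuousFunction.dist_le (by positivity)]
    intro t
    rw [dist_eq_norm, dist_eq_norm, hΦ, hΦ, ← smul_sub, norm_smul, norm_neg, Complex.norm_I,
      one_mul, ← integral_sub (hint ζ t) (hint ζ' t)]
    refine (norm_integral_le_of_norm_le
      ((integrableOn_exp_neg_mul_Ioi_zero hlam).const_mul (Lip * ‖ζ - ζ'‖))
      (Eventually.of_forall fun r => norm_duhamelIntegrand_sub_le hLip hLip0 ζ ζ' t r)).trans ?_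
    rw [integral_const_mul, integral_exp_neg_mul_Ioi_zero hlam]
    have : Lip * (1 / lam) ≤ 1 / 2 := by
      rw [mul_one_div, div_le_iff₀ hlam]
      linarith
    calc Lip * ‖ζ - ζ'‖ * (1 / lam) = Lip * (1 / lam) * ‖ζ - ζ'‖ := by ring
      _ ≤ 1 / 2 * ‖ζ - ζ'‖ := by gcongr
      _ = _ := by simp
  obtain ⟨ζ, hζ⟩ : ∃ ζ, Φ ζ = ζ := ⟨_, hcontr.fixedPoint_isFixedPt⟩
  have hζ' : ∀ t, ζ t = (-Complex.I) • ∫ r in Ioi (0 : ℝ), duhamelIntegrand V N lam ζ t r :=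
    fun t => by rw [← hΦ, hζ]
  -- The fixed point satisfies λ‖ζ‖ ≤ K + Lip‖ζ‖, and Lip ≤ λ/2 absorbs the last term.
  have hbd : ‖ζ‖ ≤ 2 * K / lam := by
    have hK0 : 0 ≤ K := by
      have := hK 0 le_rfl
      rw [mul_zero, Real.exp_zero, mul_one] at this
      exact (norm_nonneg _).trans this
    have h1 : ‖ζ‖ ≤ (K + Lip * ‖ζ‖) / lam := by
      refine (BoundedContinuousFunction.norm_le (by positivity)).2 fun t => ?_
      rw [hζ' t]
      exact hnorm ζ t
    rw [le_div_iff₀ hlam] at h1 ⊢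
    nlinarith [norm_nonneg ζ]
  refine ⟨fun t => (Real.exp (-lam * max t 0) : ℂ) • ζ t, ?_, fun t ht => ?_, fun t ht => ?_⟩
  · exact Continuous.smul (by fun_prop) ζ.continuous
  · simp only [max_eq_left ht]
    rw [hζ' t, smul_comm, ← integral_smul]
    congr 1
    refine setIntegral_congr_fun measurableSet_Ioi fun r hr => ?_
    have hs : 0 ≤ t + r := add_nonneg ht (le_of_lt hr)
    simp only [duhamelIntegrand, max_eq_left ht, max_eq_left hs]
    rw [← map_smul, smul_smul, ← Complex.ofReal_mul, ← Real.exp_add]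
    simp
  · simp only [max_eq_left ht]
    rw [norm_exp_smul, mul_comm]
    gcongr
    exact (ζ.norm_coe_le_norm t).trans hbd

end Duhamel

/-! ### Space-time test functions and the weak form of Duhamel's formula -/

/-- Smooth compactly supported functions of time and space. -/
structure IsTest (χ : ℝ × ℝ → ℂ) : Prop where
  smooth : ContDiff ℝ (⊤ : ℕ∞) χ
  compact : HasCompactSupport χ

/-- The time derivative. -/
noncomputable def dT (χ : ℝ × ℝ → ℂ) (p : ℝ × ℝ) : ℂ := fderiv ℝ χ p (1, 0)

/-- The space derivative. -/
noncomputable def dX (χ : ℝ × ℝ → ℂ) (p : ℝ × ℝ) : ℂ := fderiv ℝ χ p (0, 1)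

/-- The transpose of the linear Schrödinger operator. -/
noncomputable def adjSchr (χ : ℝ × ℝ → ℂ) (p : ℝ × ℝ) : ℂ := -Complex.I * dT χ p + dX (dX χ) p

namespace IsTest

variable {χ : ℝ × ℝ → ℂ}

theorem continuous (h : IsTest χ) : Continuous χ := h.smooth.continuous

theorem dT (h : IsTest χ) : IsTest (dT χ) where
  smooth := (h.smooth.fderiv_right (by norm_num)).clm_apply contDiff_const
  compact := h.compact.fderiv_apply ℝ _

theorem dX (h : IsTest χ) : IsTest (dX χ) where
  smooth := (h.smooth.fderiv_right (by norm_num)).clm_apply contDiff_const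
  compact := h.compact.fderiv_apply ℝ _

theorem adjSchr (h : IsTest χ) : IsTest (adjSchr χ) where
  smooth := (contDiff_const.mul h.dT.smooth).add h.dX.dX.smooth
  compact := (h.dT.compact.mul_left (f := fun _ => -Complex.I)).add h.dX.dX.compact

theorem hasDerivAt_fst (h : IsTest χ) (t x : ℝ) :
    HasDerivAt (fun t => χ (t, x)) (_root_.dT χ (t, x)) t := by
  have h1 : HasDerivAt (fun t : ℝ => ((t, x) : ℝ × ℝ)) (1, 0) t :=
    (hasDerivAt_id t).prodMk (hasDerivAt_const t x)
  exact ((h.smooth.differentiable (by norm_num)) (t, x)).hasFDerivAt.comp_hasDerivAt t h1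

theorem hasDerivAt_snd (h : IsTest χ) (t x : ℝ) :
    HasDerivAt (fun x => χ (t, x)) (_root_.dX χ (t, x)) x := by
  have h1 : HasDerivAt (fun x : ℝ => ((t, x) : ℝ × ℝ)) (0, 1) x :=
    (hasDerivAt_const x t).prodMk (hasDerivAt_id x)
  exact ((h.smooth.differentiable (by norm_num)) (t, x)).hasFDerivAt.comp_hasDerivAt x h1

theorem deriv_add_iteratedDeriv_eq (h : IsTest χ) (p : ℝ × ℝ) :
    -Complex.I * deriv (fun t => χ (t, p.2)) p.1 + iteratedDeriv 2 (fun x => χ (p.1, x)) p.2 =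
      _root_.adjSchr χ p := by
  have h1 : deriv (fun x => χ (p.1, x)) = fun x => _root_.dX χ (p.1, x) :=
    funext fun x => (h.hasDerivAt_snd p.1 x).deriv
  rw [iteratedDeriv_succ, iteratedDeriv_one, h1, (h.hasDerivAt_fst p.1 p.2).deriv,
    (h.dX.hasDerivAt_snd p.1 p.2).deriv, _root_.adjSchr]

theorem exists_bound (h : IsTest χ) : ∃ M R : ℝ, 0 ≤ M ∧ (∀ p, ‖χ p‖ ≤ M) ∧
    (∀ p, p.1 ∉ Icc (-R) R → χ p = 0) ∧ (∀ p, p.2 ∉ Icc (-R) R → χ p = 0) := by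
  obtain ⟨M, hM⟩ := h.compact.exists_bound_of_continuous h.continuous
  obtain ⟨R, hR⟩ := h.compact.isCompact.isBounded.subset_closedBall 0
  have key : ∀ p, χ p ≠ 0 → |p.1| ≤ R ∧ |p.2| ≤ R := by
    intro p hp
    have := hR (subset_tsupport _ hp)
    rw [mem_closedBall_zero_iff, Prod.norm_def] at this
    exact ⟨(le_max_left _ _).trans this, (le_max_right _ _).trans this⟩
  refine ⟨M, R, (norm_nonneg _).trans (hM 0), hM, fun p hp => ?_, fun p hp => ?_⟩
  · by_contra hne
    exact hp (abs_le.1 (key p hne).1)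
  · by_contra hne
    exact hp (abs_le.1 (key p hne).2)

theorem exists_indicator_bound (h : IsTest χ) : ∃ M R : ℝ, 0 ≤ M ∧
    (∀ t x, ‖χ (t, x)‖ ≤ (Icc (-R) R).indicator (fun _ => M) x) ∧
    (∀ t x, ‖χ (t, x)‖ ≤ (Icc (-R) R).indicator (fun _ => M) t) ∧
    ∀ t, t ∉ Icc (-R) R → ∀ x, χ (t, x) = 0 := by
  obtain ⟨M, R, hM, h1, h2, h3⟩ := h.exists_bound
  refine ⟨M, R, hM, fun t x => ?_, fun t x => ?_, fun t ht x => h2 (t, x) ht⟩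
  · by_cases hx : x ∈ Icc (-R) R
    · rw [indicator_of_mem hx]; exact h1 _
    · rw [indicator_of_notMem hx, h3 (t, x) hx, norm_zero]
  · by_cases hx : t ∈ Icc (-R) R
    · rw [indicator_of_mem hx]; exact h1 _
    · rw [indicator_of_notMem hx, h2 (t, x) hx, norm_zero]

theorem slice_contDiff (h : IsTest χ) (t : ℝ) : ContDiff ℝ (⊤ : ℕ∞) fun x => χ (t, x) :=
  h.smooth.comp (contDiff_const.prodMk contDiff_id)

theorem slice_hasCompactSupport (h : IsTest χ) (t : ℝ) : HasCompactSupport fun x => χ (t, x) := by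
  obtain ⟨M, R, -, -, -, h3⟩ := h.exists_bound
  exact HasCompactSupport.intro isCompact_Icc fun x hx => h3 (t, x) hx

theorem slice_integrable (h : IsTest χ) (t : ℝ) : Integrable fun x => χ (t, x) :=
  (h.slice_contDiff t).continuous.integrable_of_hasCompactSupport (h.slice_hasCompactSupport t)

theorem integrable (h : IsTest χ) : Integrable χ volume :=
  h.continuous.integrable_of_hasCompactSupport h.compact

/-- The conjugate of a time slice, as a Schwartz function. -/
noncomputable def conjSlice (h : IsTest χ) (t : ℝ) : 𝓢(ℝ, ℂ) :=
  HasCompactSupport.toSchwartzMap (f := fun x => (starRingEnd ℂ) (χ (t, x)))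
    ((h.slice_hasCompactSupport t).comp_left (g := starRingEnd ℂ) (map_zero _))
    (Complex.conjCLE.contDiff.comp (h.slice_contDiff t))

@[simp] theorem conjSlice_apply (h : IsTest χ) (t x : ℝ) :
    h.conjSlice t x = (starRingEnd ℂ) (χ (t, x)) := rfl

/-- The conjugate of a time slice, as a square-integrable function. -/
noncomputable def slice (h : IsTest χ) (t : ℝ) : L2 := (h.conjSlice t).toLp 2 volume

/-- The conjugate in `conjSlice` undoes the one in the inner product, so the pairing is bilinear, as
in the distributional equation. -/
theorem inner_slice (h : IsTest χ) (t : ℝ) (w : L2) :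
    inner ℂ (h.slice t) w = ∫ x, χ (t, x) * w x := by
  rw [slice, SchwartzMap.toLp, inner_toLp_eq_integral]
  simp

theorem continuous_slice (h : IsTest χ) : Continuous h.slice := by
  obtain ⟨M, R, hM, h1, -, -⟩ := h.exists_indicator_bound
  refine continuous_toLp_two_of_dominated (fun t => (h.conjSlice t).memLp 2 volume)
    (fun t₀ => ⟨(Icc (-R) R).indicator fun _ => M, memLp_indicator_const 2 measurableSet_Icc M
      (Or.inr isCompact_Icc.measure_lt_top.ne), Eventually.of_forall fun t =>
        Eventually.of_forall fun x => ?_⟩) fun t₀ => Eventually.of_forall fun x => ?_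
  · rw [conjSlice_apply, RCLike.norm_conj]
    exact h1 t x
  · simp only [conjSlice_apply]
    exact (Complex.continuous_conj.comp
      (h.continuous.comp (Continuous.prodMk_left x))).continuousAt

theorem slice_eq_zero (h : IsTest χ) {t : ℝ} (ht : ∀ x, χ (t, x) = 0) : h.slice t = 0 := by
  have : h.conjSlice t = 0 := by
    ext x
    simp [ht x]
  rw [slice, this]
  exact (SchwartzMap.toLpCLM ℂ ℂ 2 volume).map_zero

theorem slice_hasCompactSupport' (h : IsTest χ) : HasCompactSupport h.slice := by
  obtain ⟨M, R, -, -, -, h2⟩ := h.exists_indicator_bound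
  exact HasCompactSupport.intro isCompact_Icc fun t ht => h.slice_eq_zero (h2 t ht)

theorem integrable_norm_slice (h : IsTest χ) : Integrable fun t => ‖h.slice t‖ :=
  (h.continuous_slice.integrable_of_hasCompactSupport h.slice_hasCompactSupport').norm

/-- The partial (inverse) Fourier transform in space. -/
noncomputable def _root_.partialFourier (χ : ℝ × ℝ → ℂ) (t ξ : ℝ) : ℂ :=
  ∫ x, Complex.exp (((2 * Real.pi * x * ξ : ℝ) : ℂ) * Complex.I) * χ (t, x)

theorem continuous_partialFourier (h : IsTest χ) :
    Continuous fun p : ℝ × ℝ => partialFourier χ p.1 p.2 := by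
  obtain ⟨M, R, hM, h1, -, -⟩ := h.exists_indicator_bound
  refine continuous_of_dominated (bound := (Icc (-R) R).indicator fun _ => M) (fun p => ?_)
    (fun p => Eventually.of_forall fun x => ?_)
    ((integrable_indicator_iff measurableSet_Icc).2 (integrableOn_const isCompact_Icc.measure_lt_top.ne))
    (Eventually.of_forall fun x => ?_)
  · refine Continuous.aestronglyMeasurable (Continuous.mul (by fun_prop) ?_)
    exact h.continuous.comp (Continuous.prodMk_right p.1)
  · rw [norm_mul, Complex.norm_exp_ofReal_mul_I, one_mul]
    exact h1 p.1 x
  · refine Continuous.mul (by fun_prop) ?_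
    exact h.continuous.comp (continuous_fst.prodMk continuous_const)

/-- Only compactness in time is retained: integrability in frequency will come from the Schwartz
function on the other side of the pairing. -/
theorem norm_partialFourier_le (h : IsTest χ) : ∃ M R : ℝ, 0 ≤ M ∧
    ∀ t ξ, ‖partialFourier χ t ξ‖ ≤ (Icc (-R) R).indicator (fun _ => M) t := by
  obtain ⟨M, R, hM, h1, -, h2⟩ := h.exists_indicator_bound
  refine ⟨∫ x, (Icc (-R) R).indicator (fun _ => M) x, R,
    integral_nonneg fun x => indicator_nonneg (fun _ _ => hM) x, fun t ξ => ?_⟩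
  by_cases ht : t ∈ Icc (-R) R
  · rw [indicator_of_mem ht]
    refine norm_integral_le_of_norm_le ((integrable_indicator_iff measurableSet_Icc).2
      (integrableOn_const isCompact_Icc.measure_lt_top.ne)) (Eventually.of_forall fun x => ?_)
    rw [norm_mul, Complex.norm_exp_ofReal_mul_I, one_mul]
    exact h1 t x
  · rw [indicator_of_notMem ht]
    simp [partialFourier, h2 t ht]

theorem conj_fourier_conjSlice (h : IsTest χ) (t ξ : ℝ) :
    (starRingEnd ℂ) (𝓕 (h.conjSlice t) ξ) = partialFourier χ t ξ := by
  rw [SchwartzMap.fourier_coe, Real.fourier_real_eq_integral_exp_smul, ← integral_conj]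
  refine integral_congr_ae (Eventually.of_forall fun x => ?_)
  simp only [smul_eq_mul, map_mul, conjSlice_apply, Complex.conj_conj, ← Complex.exp_conj,
    Complex.conj_ofReal, Complex.conj_I]
  congr 2
  push_cast
  ring

theorem hasDerivAt_partialFourier (h : IsTest χ) (t ξ : ℝ) :
    HasDerivAt (fun t => partialFourier χ t ξ) (partialFourier (_root_.dT χ) t ξ) t := by
  obtain ⟨M, R, hM, h1, -, -⟩ := h.dT.exists_indicator_bound
  have hmeas : ∀ {χ' : ℝ × ℝ → ℂ}, IsTest χ' → ∀ t, Integrable fun x =>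
      Complex.exp (((2 * Real.pi * x * ξ : ℝ) : ℂ) * Complex.I) * χ' (t, x) := by
    intro χ' h' t
    refine (h'.slice_integrable t).mono ?_ (Eventually.of_forall fun x => ?_)
    · exact Continuous.aestronglyMeasurable
        (Continuous.mul (by fun_prop) (h'.slice_contDiff t).continuous)
    · rw [norm_mul, Complex.norm_exp_ofReal_mul_I, one_mul]
  refine (hasDerivAt_integral_of_dominated_loc_of_deriv_le
    (F := fun t x => Complex.exp (((2 * Real.pi * x * ξ : ℝ) : ℂ) * Complex.I) * χ (t, x))
    (F' := fun t x => Complex.exp (((2 * Real.pi * x * ξ : ℝ) : ℂ) * Complex.I) * _root_.dT χ (t, x))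
    (bound := (Icc (-R) R).indicator fun _ => M) univ_mem
    (Eventually.of_forall fun s => (hmeas h s).1) (hmeas h t) (hmeas h.dT t).1
    (Eventually.of_forall fun x s _ => ?_)
    ((integrable_indicator_iff measurableSet_Icc).2
      (integrableOn_const isCompact_Icc.measure_lt_top.ne))
    (Eventually.of_forall fun x s _ => (h.hasDerivAt_fst s x).const_mul _)).2
  rw [norm_mul, Complex.norm_exp_ofReal_mul_I, one_mul]
  exact h1 s x

theorem partialFourier_adjSchr (h : IsTest χ) (t ξ : ℝ) :
    partialFourier (_root_.adjSchr χ) t ξ = -Complex.I * partialFourier (_root_.dT χ) t ξ -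
      ((4 * Real.pi ^ 2 * ξ ^ 2 : ℝ) : ℂ) * partialFourier χ t ξ := by
  set e : ℝ → ℂ := fun x => Complex.exp (((2 * Real.pi * x * ξ : ℝ) : ℂ) * Complex.I) with he
  set κ : ℂ := ((2 * Real.pi * ξ : ℝ) : ℂ) * Complex.I with hκ
  have hκ2 : κ * κ = -((4 * Real.pi ^ 2 * ξ ^ 2 : ℝ) : ℂ) := by
    rw [hκ]
    linear_combination (((2 * Real.pi * ξ : ℝ) : ℂ)) ^ 2 * Complex.I_mul_I +
      (by push_cast; ring : -(((2 * Real.pi * ξ : ℝ) : ℂ)) ^ 2 = -((4 * Real.pi ^ 2 * ξ ^ 2 : ℝ) : ℂ))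
  have hde : ∀ x, HasDerivAt e (e x * κ) x := by
    intro x
    have h1 : HasDerivAt (fun x : ℝ => (x : ℂ) * κ) (1 * κ) x :=
      (Complex.ofRealCLM.hasDerivAt (x := x)).mul_const κ
    have h2 := h1.cexp
    have h3 : e = fun x : ℝ => Complex.exp ((x : ℂ) * κ) := by
      ext x
      simp only [he, hκ]
      congr 1
      push_cast
      ring
    rw [h3]
    simpa using h2
  have hec : Continuous e := by
    simp only [he]
    fun_prop
  have hmeas : ∀ {χ' : ℝ × ℝ → ℂ}, IsTest χ' → Integrable fun x => e x * χ' (t, x) := by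
    intro χ' h'
    refine (h'.slice_integrable t).mono ?_ (Eventually.of_forall fun x => ?_)
    · exact (hec.mul (h'.slice_contDiff t).continuous).aestronglyMeasurable
    · rw [norm_mul, he, Complex.norm_exp_ofReal_mul_I, one_mul]
  -- Two integrations by parts at once: the integrand is the derivative of eχₓ - κeχ, the cross
  -- terms cancelling and -κ² being 4π²ξ².
  have hzero : ∫ x, (e x * _root_.dX (_root_.dX χ) (t, x) +
      ((4 * Real.pi ^ 2 * ξ ^ 2 : ℝ) : ℂ) * (e x * χ (t, x))) = 0 := by
    refine integral_eq_zero_of_hasDerivAt_of_integrable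
      (f := fun x => e x * _root_.dX χ (t, x) - κ * (e x * χ (t, x))) (fun x => ?_)
      ((hmeas h.dX.dX).add ((hmeas h).const_mul _)) ((hmeas h.dX).sub ((hmeas h).const_mul _))
    have h1 := ((hde x).mul (h.dX.hasDerivAt_snd t x)).sub
      (((hde x).mul (h.hasDerivAt_snd t x)).const_mul κ)
    refine h1.congr_deriv ?_
    linear_combination -(e x * χ (t, x)) * hκ2
  rw [integral_add (hmeas h.dX.dX) ((hmeas h).const_mul _), integral_const_mul] at hzero
  have hsplit : partialFourier (_root_.adjSchr χ) t ξ =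
      -Complex.I * (∫ x, e x * _root_.dT χ (t, x)) + ∫ x, e x * _root_.dX (_root_.dX χ) (t, x) := by
    rw [← integral_const_mul, ← integral_add ((hmeas h.dT).const_mul _) (hmeas h.dX.dX)]
    refine integral_congr_ae (Eventually.of_forall fun x => ?_)
    simp only [_root_.adjSchr, he]
    ring
  rw [hsplit]
  unfold partialFourier
  linear_combination hzero

theorem schrSymbol_hasDerivAt (r ξ : ℝ) : HasDerivAt (fun r => schrSymbol r ξ)
    (schrSymbol r ξ * (((4 * Real.pi ^ 2 * ξ ^ 2 : ℝ) : ℂ) * Complex.I)) r := by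
  set κ : ℂ := ((4 * Real.pi ^ 2 * ξ ^ 2 : ℝ) : ℂ) * Complex.I with hκ
  have h1 : HasDerivAt (fun x : ℝ => (x : ℂ) * κ) (1 * κ) r :=
    (Complex.ofRealCLM.hasDerivAt (x := r)).mul_const κ
  have h3 : (fun r => schrSymbol r ξ) = fun x : ℝ => Complex.exp ((x : ℂ) * κ) := by
    ext x
    simp only [schrSymbol, hκ]
    congr 1
    push_cast
    ring
  rw [show schrSymbol r ξ = Complex.exp ((r : ℂ) * κ) from congrFun h3 r, h3]
  simpa using h1.cexp

/-- At fixed frequency the integrand is the r-derivative of i times the transform of χ at s - r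
times the symbol at r. Compact support removes the end at infinity, and r = 0 gives the right-hand
side. -/
theorem integral_partialFourier_adjSchr (h : IsTest χ) (s ξ : ℝ) :
    ∫ r in Ioi (0 : ℝ), partialFourier (_root_.adjSchr χ) (s - r) ξ * schrSymbol r ξ =
      -Complex.I * partialFourier χ s ξ := by
  have hsymb : Continuous fun r => schrSymbol r ξ :=
    continuous_schrSymbol.comp (Continuous.prodMk_left ξ)
  have hc : ∀ {χ' : ℝ × ℝ → ℂ}, IsTest χ' → Continuous fun r => partialFourier χ' (s - r) ξ := by
    intro χ' h'
    exact h'.continuous_partialFourier.comp (by fun_prop : Continuous fun r : ℝ => (s - r, ξ))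
  have hd : ∀ r ∈ Ici (0 : ℝ), HasDerivAt
      (fun r => Complex.I * (partialFourier χ (s - r) ξ * schrSymbol r ξ))
      (partialFourier (_root_.adjSchr χ) (s - r) ξ * schrSymbol r ξ) r := by
    intro r _
    have h1 : HasDerivAt (fun r => partialFourier χ (s - r) ξ)
        ((-1 : ℝ) • partialFourier (_root_.dT χ) (s - r) ξ) r :=
      (h.hasDerivAt_partialFourier (s - r) ξ).scomp r ((hasDerivAt_id r).const_sub s)
    have h2 := (h1.mul (schrSymbol_hasDerivAt r ξ)).const_mul Complex.I
    refine h2.congr_deriv ?_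
    rw [h.partialFourier_adjSchr]
    simp only [Complex.real_smul]
    push_cast
    linear_combination ((4 * (Real.pi : ℂ) ^ 2 * ξ ^ 2) * partialFourier χ (s - r) ξ *
      schrSymbol r ξ) * Complex.I_mul_I
  obtain ⟨M, R, hM, hb⟩ := h.norm_partialFourier_le
  obtain ⟨M', R', hM', hb'⟩ := h.adjSchr.norm_partialFourier_le
  have hint : IntegrableOn
      (fun r => partialFourier (_root_.adjSchr χ) (s - r) ξ * schrSymbol r ξ) (Ioi 0) := by
    refine Integrable.integrableOn ?_
    refine Continuous.integrable_of_hasCompactSupport ((hc h.adjSchr).mul hsymb) ?_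
    refine HasCompactSupport.intro (isCompact_Icc (a := s - R') (b := s + R')) fun r hr => ?_
    have := hb' (s - r) ξ
    rw [indicator_of_notMem (fun hh => hr ⟨by linarith [hh.2], by linarith [hh.1]⟩),
      norm_le_zero_iff] at this
    rw [this, zero_mul]
  have hlim : Tendsto (fun r => Complex.I * (partialFourier χ (s - r) ξ * schrSymbol r ξ)) atTop
      (𝓝 0) := by
    refine tendsto_const_nhds.congr' ?_
    filter_upwards [eventually_gt_atTop (s + R)] with r hr
    have := hb (s - r) ξ
    rw [indicator_of_notMem (fun hh => by linarith [hh.1]), norm_le_zero_iff] at this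
    rw [this, zero_mul, mul_zero]
  rw [integral_Ioi_of_hasDerivAt_of_tendsto' hd hint hlim]
  simp [schrSymbol]

theorem inner_slice_schr_toLp (h : IsTest χ) (t r : ℝ) (W : 𝓢(ℝ, ℂ)) :
    inner ℂ (h.slice t) (schr r (W.toLp 2 volume)) =
      ∫ ξ, partialFourier χ t ξ * (schrSymbol r ξ * 𝓕 W ξ) := by
  rw [inner_schr, slice, SchwartzMap.toLp_fourier_eq, SchwartzMap.toLp_fourier_eq,
    inner_schrMul_left]
  refine integral_congr_ae ?_
  filter_upwards [(𝓕 (h.conjSlice t)).coeFn_toLp 2 volume, (𝓕 W).coeFn_toLp 2 volume] with ξ h1 h2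
  rw [h1, h2, conj_fourier_conjSlice]

theorem inner_slice_toLp (h : IsTest χ) (t : ℝ) (W : 𝓢(ℝ, ℂ)) :
    inner ℂ (h.slice t) (W.toLp 2 volume) = ∫ ξ, partialFourier χ t ξ * 𝓕 W ξ := by
  rw [slice, ← Lp.inner_fourier_eq, SchwartzMap.toLp_fourier_eq, SchwartzMap.toLp_fourier_eq,
    L2.inner_def]
  refine integral_congr_ae ?_
  filter_upwards [(𝓕 (h.conjSlice t)).coeFn_toLp 2 volume, (𝓕 W).coeFn_toLp 2 volume] with ξ h1 h2
  rw [h1, h2, RCLike.inner_apply, conj_fourier_conjSlice, mul_comm]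

/-- Fubini in time and frequency reduces this to the identity at each fixed frequency. -/
theorem integral_inner_slice_schr_toLp (h : IsTest χ) (s : ℝ) (W : 𝓢(ℝ, ℂ)) :
    ∫ r in Ioi (0 : ℝ), inner ℂ (h.adjSchr.slice (s - r)) (schr r (W.toLp 2 volume)) =
      -Complex.I * inner ℂ (h.slice s) (W.toLp 2 volume) := by
  obtain ⟨M, R, hM, hb⟩ := h.adjSchr.norm_partialFourier_le
  have hcont : Continuous fun p : ℝ × ℝ =>
      partialFourier (_root_.adjSchr χ) (s - p.1) p.2 * (schrSymbol p.1 p.2 * 𝓕 W p.2) := by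
    refine Continuous.mul ?_ (continuous_schrSymbol.mul ((𝓕 W).continuous.comp continuous_snd))
    exact h.adjSchr.continuous_partialFourier.comp
      (by fun_prop : Continuous fun p : ℝ × ℝ => (s - p.1, p.2))
  have hb1 : Integrable (fun r : ℝ => (Icc (s - R) (s + R)).indicator (fun _ => M) r)
      (volume.restrict (Ioi 0)) :=
    ((integrable_indicator_iff measurableSet_Icc).2
      (integrableOn_const isCompact_Icc.measure_lt_top.ne)).restrict
  have hint : Integrable (Function.uncurry fun r ξ =>
      partialFourier (_root_.adjSchr χ) (s - r) ξ * (schrSymbol r ξ * 𝓕 W ξ))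
      ((volume.restrict (Ioi 0)).prod volume) := by
    refine (hb1.mul_prod (𝓕 W).integrable.norm).mono' hcont.aestronglyMeasurable
      (Eventually.of_forall fun p => ?_)
    simp only [Function.uncurry, norm_mul, norm_schrSymbol, one_mul]
    gcongr
    refine (hb (s - p.1) p.2).trans (le_of_eq ?_)
    by_cases hp : p.1 ∈ Icc (s - R) (s + R)
    · have hp' : s - p.1 ∈ Icc (-R) R := ⟨by linarith [hp.2], by linarith [hp.1]⟩
      rw [indicator_of_mem hp, indicator_of_mem hp']
    · rw [indicator_of_notMem hp, indicator_of_notMem]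
      exact fun hh => hp ⟨by linarith [hh.2], by linarith [hh.1]⟩
  simp_rw [inner_slice_schr_toLp, inner_slice_toLp]
  rw [integral_integral_swap hint, ← integral_const_mul]
  refine integral_congr_ae (Eventually.of_forall fun ξ => ?_)
  simp only
  simp_rw [← mul_assoc]
  rw [integral_mul_const, h.integral_partialFourier_adjSchr]

/-- Extension from Schwartz functions by density. Both sides are continuous in `w`: the group is
isometric and the norms of the slices are integrable in time. -/
theorem integral_inner_slice_schr (h : IsTest χ) (s : ℝ) (w : L2) :
    ∫ r in Ioi (0 : ℝ), inner ℂ (h.adjSchr.slice (s - r)) (schr r w) =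
      -Complex.I * inner ℂ (h.slice s) w := by
  refine DenseRange.induction_on (p := fun w : L2 =>
    ∫ r in Ioi (0 : ℝ), inner ℂ (h.adjSchr.slice (s - r)) (schr r w) =
      -Complex.I * inner ℂ (h.slice s) w)
    (SchwartzMap.denseRange_toLpCLM (F := ℂ) (p := 2) (μ := (volume : Measure ℝ))
      ENNReal.ofNat_ne_top) w ?_ fun W => h.integral_inner_slice_schr_toLp s W
  refine isClosed_eq ?_ (continuous_const.mul (continuous_const.inner continuous_id))
  have hcs : Continuous fun r => h.adjSchr.slice (s - r) :=
    h.adjSchr.continuous_slice.comp (by fun_prop)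
  rw [continuous_iff_continuousAt]
  intro w₀
  refine continuousAt_of_dominated
    (bound := fun r => ‖h.adjSchr.slice (s - r)‖ * (‖w₀‖ + 1)) (Eventually.of_forall fun w => ?_)
    ?_ ?_ (Eventually.of_forall fun r => ?_)
  · exact (hcs.inner (continuous_schr.comp (Continuous.prodMk_left w))).aestronglyMeasurable
  · filter_upwards [Metric.ball_mem_nhds w₀ one_pos] with w hw
    refine Eventually.of_forall fun r => (norm_inner_le_norm _ _).trans ?_
    rw [LinearIsometry.norm_map]
    gcongr
    rw [Metric.mem_ball, dist_eq_norm] at hw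
    linarith [norm_le_norm_add_norm_sub' w w₀]
  · exact ((h.adjSchr.integrable_norm_slice.comp_sub_left s).mul_const _).restrict
  · exact (continuous_const.inner (schr r).continuous).continuousAt

theorem adjSchr_eq_zero (h : IsTest χ) (hpos : ∀ t ≤ 0, ∀ x, χ (t, x) = 0) (t : ℝ) (ht : t ≤ 0)
    (x : ℝ) : _root_.adjSchr χ (t, x) = 0 := by
  have hsupp : tsupport (_root_.adjSchr χ) ⊆ tsupport χ := by
    have hsub : ∀ {a : ℝ × ℝ → ℂ}, ∀ v, tsupport (fun p => fderiv ℝ a p v) ⊆ tsupport a :=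
      fun {a} v => tsupport_fderiv_apply_subset ℝ v
    refine (tsupport_add _ _).trans (union_subset ?_ ?_)
    · exact (tsupport_mul_subset_right (f := fun _ => -Complex.I)).trans (hsub _)
    · exact (hsub _).trans (hsub _)
  have hlt : ∀ t < 0, _root_.adjSchr χ (t, x) = 0 := by
    intro t ht
    refine image_eq_zero_of_notMem_tsupport fun hmem => ?_
    have hcl : tsupport χ ⊆ Ici 0 ×ˢ univ := by
      refine closure_minimal (fun p hp => ?_) (isClosed_Ici.prod isClosed_univ)
      refine ⟨?_, mem_univ _⟩
      by_contra hneg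
      exact hp (hpos p.1 (not_le.1 hneg).le p.2)
    exact absurd (hcl (hsupp hmem)).1 (not_le.2 ht)
  have hcont : Continuous fun t => _root_.adjSchr χ (t, x) :=
    h.adjSchr.continuous.comp (Continuous.prodMk_left x)
  have hclosed : closure (Iio (0 : ℝ)) ⊆ {t | _root_.adjSchr χ (t, x) = 0} :=
    closure_minimal (fun t ht => hlt t ht) (isClosed_eq hcont continuous_const)
  rw [closure_Iio] at hclosed
  exact hclosed ht

/-- The Duhamel integral solves the inhomogeneous linear Schrödinger equation. -/
theorem integral_inner_slice_duhamel (h : IsTest χ) (hpos : ∀ t ≤ 0, ∀ x, χ (t, x) = 0)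
    {G η : ℝ → L2} (hG : Continuous G) {K lam : ℝ} (hlam : 0 < lam)
    (hGb : ∀ s, 0 ≤ s → ‖G s‖ ≤ K * Real.exp (-lam * s))
    (hη : ∀ t, 0 ≤ t → η t = (-Complex.I) • ∫ r in Ioi (0 : ℝ), schr r (G (t + r))) :
    ∫ t, inner ℂ (h.adjSchr.slice t) (η t) = -∫ t, inner ℂ (h.slice t) (G t) := by
  have hpos' : ∀ t ≤ 0, h.adjSchr.slice t = 0 := fun t ht =>
    h.adjSchr.slice_eq_zero (h.adjSchr_eq_zero hpos t ht)
  set μ : Measure ℝ := volume.restrict (Ioi 0) with hμ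
  set f : ℝ → ℝ → ℂ := fun r t => inner ℂ (h.adjSchr.slice t) (schr r (G (t + r))) with hf
  have hfc : Continuous (Function.uncurry f) := by
    have h1 : Continuous fun p : ℝ × ℝ => h.adjSchr.slice p.2 :=
      h.adjSchr.continuous_slice.comp continuous_snd
    have h2 : Continuous fun p : ℝ × ℝ => G (p.2 + p.1) :=
      hG.comp (continuous_snd.add continuous_fst)
    have h3 : Continuous fun p : ℝ × ℝ => schr p.1 (G (p.2 + p.1)) := continuous_fst.schr h2
    exact Continuous.inner (𝕜 := ℂ) h1 h3
  have hK : 0 ≤ K := by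
    have := hGb 0 le_rfl
    rw [mul_zero, Real.exp_zero, mul_one] at this
    exact (norm_nonneg _).trans this
  have hbG : ∀ t, 0 ≤ t → ∀ r ∈ Ioi (0 : ℝ),
      ‖schr r (G (t + r))‖ ≤ K * Real.exp (-lam * r) := by
    intro t ht r hr
    rw [LinearIsometry.norm_map]
    refine (hGb _ (add_nonneg ht (le_of_lt hr))).trans ?_
    gcongr K * Real.exp ?_
    nlinarith
  have hint : Integrable (Function.uncurry f) (μ.prod volume) := by
    have hmaj : Integrable (fun p : ℝ × ℝ => K * Real.exp (-lam * p.1) * ‖h.adjSchr.slice p.2‖)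
        (μ.prod volume) :=
      Integrable.mul_prod (f := fun r => K * Real.exp (-lam * r))
        ((integrableOn_exp_neg_mul_Ioi_zero hlam).const_mul K) h.adjSchr.integrable_norm_slice
    refine hmaj.mono' hfc.aestronglyMeasurable ?_
    have hae : ∀ᵐ r ∂μ, r ∈ Ioi (0 : ℝ) := self_mem_ae_restrict measurableSet_Ioi
    have : ∀ᵐ p ∂(μ.prod (volume : Measure ℝ)), p.1 ∈ Ioi (0 : ℝ) :=
      Measure.quasiMeasurePreserving_fst.ae hae
    filter_upwards [this] with p hp
    simp only [Function.uncurry, hf]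
    rcases le_or_gt p.2 0 with h0 | h0
    · rw [hpos' _ h0, inner_zero_left, norm_zero, norm_zero, mul_zero]
    · refine (norm_inner_le_norm _ _).trans ?_
      rw [mul_comm]
      gcongr
      exact hbG _ h0.le _ hp
  have hshift : Integrable (Function.uncurry fun r s => f r (-r + s)) (μ.prod volume) :=
    (measurePreserving_prod_neg_add μ (volume : Measure ℝ)).integrable_comp_of_integrable hint
  -- Exchange the integrals, shift s = t + r at fixed r, and exchange back. At fixed s the group
  -- then acts on the single vector `G s`, and the homogeneous identity applies; the two factors -i
  -- multiply to -1.
  calc ∫ t, inner ℂ (h.adjSchr.slice t) (η t) = ∫ t, (-Complex.I) * ∫ r, f r t ∂μ := by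
        refine integral_congr_ae (Eventually.of_forall fun t => ?_)
        simp only [hf]
        rcases le_or_gt t 0 with h0 | h0
        · simp [hpos' _ h0]
        · rw [hη t h0.le, inner_smul_right]
          congr 1
          refine ((innerSL ℂ (h.adjSchr.slice t)).integral_comp_comm ?_).symm
          refine ((integrableOn_exp_neg_mul_Ioi_zero hlam).const_mul K).mono' ?_ ?_
          · exact (continuous_id.schr
              (hG.comp (continuous_const.add continuous_id))).aestronglyMeasurable
          · filter_upwards [self_mem_ae_restrict measurableSet_Ioi] with r hr
            exact hbG t h0.le r hr
    _ = (-Complex.I) * ∫ t, ∫ r, f r t ∂μ := integral_const_mul _ _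
    _ = (-Complex.I) * ∫ r, (∫ t, f r t) ∂μ := by rw [integral_integral_swap hint]
    _ = (-Complex.I) * ∫ r, (∫ s, f r (-r + s)) ∂μ := by
        congr 1
        refine integral_congr_ae (Eventually.of_forall fun r => ?_)
        exact (integral_add_left_eq_self (f r) (-r)).symm
    _ = (-Complex.I) * ∫ s, ∫ r, f r (-r + s) ∂μ := by rw [integral_integral_swap hshift]
    _ = (-Complex.I) * ∫ s, (-Complex.I) * inner ℂ (h.slice s) (G s) := by
        congr 1
        refine integral_congr_ae (Eventually.of_forall fun s => ?_)
        simp only [hf]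
        rw [← h.integral_inner_slice_schr s (G s)]
        refine integral_congr_ae (Eventually.of_forall fun r => ?_)
        simp only
        rw [show -r + s = s - r by ring, sub_add_cancel]
    _ = _ := by
        rw [integral_const_mul, ← mul_assoc, neg_mul_neg, Complex.I_mul_I, neg_one_mul]

end IsTest

/-! ### Continuous representatives of the bound states -/

/-- The mollifications of φ have the mollifications of ψ as derivatives, so they are uniformly
M-Lipschitz. Hence φ is M-Lipschitz on the full-measure set where they converge to it, and extends
from there. -/
theorem HasWeakDeriv.exists_lipschitz_ae_eq {φ ψ : ℝ → ℝ} (h : HasWeakDeriv φ ψ) {M : NNReal}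
    (hM : ∀ᵐ x, |ψ x| ≤ M) : ∃ φ₁ : ℝ → ℝ, LipschitzWith M φ₁ ∧ φ =ᵐ[volume] φ₁ := by
  obtain ⟨hφ, hψ, hweak⟩ := h
  have hd : ∀ n x, HasDerivAt (fun x => ∫ y, mollifier n (x - y) • φ y)
      (∫ y, deriv (mollifier n) (x - y) • φ y) x := by
    intro n x
    have h1 := (hasCompactSupport_mollifier n).hasDerivAt_convolution_left
      (ContinuousLinearMap.lsmul ℝ ℝ) ((contDiff_mollifier n).of_le (by norm_num)) hφ x
    rw [convolution_eq_swap] at h1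
    refine h1.congr_of_eventuallyEq (Eventually.of_forall fun x => ?_)
    rw [convolution_eq_swap]
    rfl
  have hd' : ∀ n x, ∫ y, deriv (mollifier n) (x - y) • φ y = ∫ y, ψ y * mollifier n (x - y) := by
    intro n x
    have h1 := hweak (fun y => mollifier n (x - y)) (contDiff_mollifier_sub n x)
      (hasCompactSupport_mollifier_sub n x)
    have h2 : deriv (fun y => mollifier n (x - y)) = fun y => -deriv (mollifier n) (x - y) := by
      ext y
      exact deriv_comp_const_sub (mollifier n) x y
    rw [h2] at h1
    simp only [mul_neg, integral_neg, neg_inj] at h1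
    rw [← h1]
    exact integral_congr_ae (Eventually.of_forall fun y => mul_comm _ _)
  have hlip : ∀ n, LipschitzWith M fun x => ∫ y, mollifier n (x - y) • φ y := by
    intro n
    refine lipschitzWith_of_nnnorm_deriv_le (fun x => (hd n x).differentiableAt) fun x => ?_
    rw [← NNReal.coe_le_coe, coe_nnnorm, (hd n x).deriv, hd']
    have hi : Integrable fun y => mollifier n (x - y) :=
      (contDiff_mollifier_sub n x).continuous.integrable_of_hasCompactSupport
        (hasCompactSupport_mollifier_sub n x)
    refine (norm_integral_le_of_norm_le (hi.const_mul (M : ℝ)) ?_).trans (le_of_eq ?_)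
    · filter_upwards [hM] with y hy
      rw [norm_mul, Real.norm_of_nonneg (mollifier_nonneg n _)]
      exact mul_le_mul_of_nonneg_right hy (mollifier_nonneg n _)
    · rw [integral_const_mul, integral_mollifier_sub, mul_one]
  have hlim := ae_tendsto_mollifier hφ
  have hon : LipschitzOnWith M φ
      {x | Tendsto (fun n => ∫ y, mollifier n (x - y) • φ y) atTop (𝓝 (φ x))} := by
    refine LipschitzOnWith.of_dist_le_mul fun x hx y hy => ?_
    exact le_of_tendsto (hx.dist hy) (Eventually.of_forall fun n => (hlip n).dist_le_mul x y)
  obtain ⟨φ₁, h1, h2⟩ := hon.extend_real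
  refine ⟨φ₁, h1, ?_⟩
  filter_upwards [hlim] with x hx using h2 hx

theorem le_of_ae_le_of_continuous {a b : ℝ → ℝ} (ha : Continuous a) (hb : Continuous b)
    (h : ∀ᵐ x, a x ≤ b x) (x : ℝ) : a x ≤ b x := by
  have hdense : Dense {x | a x ≤ b x} := Measure.dense_of_ae h
  have hcl : IsClosed {x | a x ≤ b x} := isClosed_le ha hb
  have : x ∈ closure {x | a x ≤ b x} := hdense x
  rwa [hcl.closure_eq] at this

/-- Continuous bound state profiles, with the equation tested against smooth functions. -/
structure IsProfile (g : ℝ → ℝ) (ω : ℝ) (φ : ℝ → ℝ) : Prop where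
  continuous : Continuous φ
  equation : ∀ θ : ℝ → ℝ, ContDiff ℝ (⊤ : ℕ∞) θ → HasCompactSupport θ →
    (∫ x, φ x * deriv (deriv θ) x) = (ω * ∫ x, φ x * θ x) - ∫ x, g (φ x ^ 2) * φ x * θ x

/-- The bound on the weak derivative yields a Lipschitz representative, for which the exponential
bound holds everywhere by density. A further integration by parts moves both derivatives onto the
test function. -/
theorem AssumptionT.exists_profile {g : ℝ → ℝ} {α₁ ωs a D : ℝ} {φ : ℝ → ℝ → ℝ}
    (hT : AssumptionT g α₁ ωs a D φ) {ω : ℝ} (hω : 0 < ω) (hωs : ω < ωs) :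
    ∃ φ₁ : ℝ → ℝ, IsProfile g ω φ₁ ∧ φ ω =ᵐ[volume] φ₁ ∧
      ∀ x, |φ₁ x| ≤ D * ω ^ (1 / α₁) * Real.exp (-a * ω ^ (1 / 2 : ℝ) * |x|) := by
  obtain ⟨φ', hb, hbd⟩ := hT.exists_deriv ω hω hωs
  have hD := hT.D_pos
  have ha := hT.a_pos
  have hpow : 0 < ω ^ (-(1 / 2 : ℝ)) := Real.rpow_pos_of_pos hω _
  have hM : ∀ᵐ x, |φ' x| ≤ ((D * ω ^ (1 / α₁) / ω ^ (-(1 / 2 : ℝ))).toNNReal : ℝ) := by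
    filter_upwards [hbd] with x hx
    rw [Real.coe_toNNReal _ (by positivity), le_div_iff₀ hpow]
    have h1 : Real.exp (-a * ω ^ (1 / 2 : ℝ) * |x|) ≤ 1 := by
      rw [Real.exp_le_one_iff]
      have : 0 ≤ a * ω ^ (1 / 2 : ℝ) * |x| := by positivity
      linarith
    have h2 : D * ω ^ (1 / α₁) * Real.exp (-a * ω ^ (1 / 2 : ℝ) * |x|) ≤ D * ω ^ (1 / α₁) :=
      mul_le_of_le_one_right (by positivity) h1
    linarith [abs_nonneg (φ ω x), mul_comm |φ' x| (ω ^ (-(1 / 2 : ℝ)))]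
  obtain ⟨φ₁, hlip, hae⟩ := hb.weakDeriv.exists_lipschitz_ae_eq hM
  refine ⟨φ₁, ⟨hlip.continuous, fun θ hθ hθc => ?_⟩, hae, ?_⟩
  · have hθ' : ContDiff ℝ (⊤ : ℕ∞) (deriv θ) := by
      have : ContDiff ℝ ((⊤ : ℕ∞) + 1) θ := by simpa using hθ
      exact (contDiff_succ_iff_deriv.1 this).2.2
    have h1 := hb.weakDeriv.2.2 (deriv θ) hθ' hθc.deriv
    have h2 := hb.equation θ hθ hθc
    have e1 : ∫ x, φ₁ x * deriv (deriv θ) x = ∫ x, φ ω x * deriv (deriv θ) x :=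
      integral_congr_ae (by filter_upwards [hae] with x hx; rw [hx])
    have e2 : ∫ x, φ₁ x * θ x = ∫ x, φ ω x * θ x :=
      integral_congr_ae (by filter_upwards [hae] with x hx; rw [hx])
    have e3 : ∫ x, g (φ₁ x ^ 2) * φ₁ x * θ x = ∫ x, g (φ ω x ^ 2) * φ ω x * θ x :=
      integral_congr_ae (by filter_upwards [hae] with x hx; rw [hx])
    rw [e1, e2, e3]
    linarith
  · refine le_of_ae_le_of_continuous hlip.continuous.abs (by fun_prop) ?_
    filter_upwards [hbd, hae] with x hx hx'
    rw [← hx']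
    have : 0 ≤ ω ^ (-(1 / 2 : ℝ)) * |φ' x| := by positivity
    linarith

/-! ### Travelling solitons and Galilean invariance -/

section SolitonEquation

variable {g : ℝ → ℝ} {ω : ℝ} {φ : ℝ → ℝ}

/-- The profile equation is tested against real functions; applying it to the real and imaginary
parts of a slice gives the complex version. -/
theorem IsProfile.integral_complex (hφ : IsProfile g ω φ) (hg : ContinuousOn g (Ici 0))
    {ψ : ℝ × ℝ → ℂ} (h : IsTest ψ) (t : ℝ) :
    ∫ y, ((φ y : ℂ) * dX (dX ψ) (t, y) - (ω : ℂ) * ((φ y : ℂ) * ψ (t, y)) +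
      ((g (φ y ^ 2) * φ y : ℝ) : ℂ) * ψ (t, y)) = 0 := by
  have hφc := hφ.continuous
  have hgc : Continuous fun y => g (φ y ^ 2) :=
    hg.comp_continuous (by fun_prop) fun y => mem_Ici.2 (sq_nonneg (φ y))
  have key : ∀ ℓ : ℂ →L[ℝ] ℝ, (∫ y, (φ y * ℓ (dX (dX ψ) (t, y)) - ω * (φ y * ℓ (ψ (t, y))) +
      (g (φ y ^ 2) * φ y) * ℓ (ψ (t, y)))) = 0 := by
    intro ℓ
    have hc : ∀ {χ : ℝ × ℝ → ℂ}, IsTest χ → HasCompactSupport fun y => ℓ (χ (t, y)) := fun h' =>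
      (h'.slice_hasCompactSupport t).comp_left (g := ℓ) (map_zero ℓ)
    have hcont : ∀ {χ : ℝ × ℝ → ℂ}, IsTest χ → Continuous fun y => ℓ (χ (t, y)) := fun h' =>
      ℓ.continuous.comp (h'.slice_contDiff t).continuous
    have hd : ∀ {χ : ℝ × ℝ → ℂ}, IsTest χ →
        deriv (fun y => ℓ (χ (t, y))) = fun y => ℓ (dX χ (t, y)) := by
      intro χ h'
      ext y
      exact (ℓ.hasFDerivAt.comp_hasDerivAt y (h'.hasDerivAt_snd t y)).deriv
    have i1 : Integrable fun y => φ y * ℓ (dX (dX ψ) (t, y)) :=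
      (hφc.mul (hcont h.dX.dX)).integrable_of_hasCompactSupport (hc h.dX.dX).mul_left
    have i2 : Integrable fun y => φ y * ℓ (ψ (t, y)) :=
      (hφc.mul (hcont h)).integrable_of_hasCompactSupport (hc h).mul_left
    have i3 : Integrable fun y => (g (φ y ^ 2) * φ y) * ℓ (ψ (t, y)) :=
      ((hgc.mul hφc).mul (hcont h)).integrable_of_hasCompactSupport (hc h).mul_left
    have := hφ.equation (fun y => ℓ (ψ (t, y))) (ℓ.contDiff.comp (h.slice_contDiff t)) (hc h)
    rw [hd h, hd h.dX] at this
    have i4 : Integrable fun y => φ y * ℓ (dX (dX ψ) (t, y)) - ω * (φ y * ℓ (ψ (t, y))) :=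
      i1.sub (i2.const_mul ω)
    rw [integral_add i4 i3, integral_sub i1 (i2.const_mul ω), integral_const_mul, this]
    ring
  have hint : Integrable fun y => ((φ y : ℂ) * dX (dX ψ) (t, y) - (ω : ℂ) * ((φ y : ℂ) * ψ (t, y)) +
      ((g (φ y ^ 2) * φ y : ℝ) : ℂ) * ψ (t, y)) := by
    have hφ' : Continuous fun y => (φ y : ℂ) := Complex.continuous_ofReal.comp hφc
    have hg' : Continuous fun y => ((g (φ y ^ 2) * φ y : ℝ) : ℂ) :=
      Complex.continuous_ofReal.comp (hgc.mul hφc)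
    have c1 := (h.dX.dX.slice_contDiff t).continuous
    have c2 := (h.slice_contDiff t).continuous
    refine Integrable.add (Integrable.sub ?_ (Integrable.const_mul ?_ _)) ?_
    · exact (hφ'.mul c1).integrable_of_hasCompactSupport (h.dX.dX.slice_hasCompactSupport t).mul_left
    · exact (hφ'.mul c2).integrable_of_hasCompactSupport (h.slice_hasCompactSupport t).mul_left
    · exact (hg'.mul c2).integrable_of_hasCompactSupport (h.slice_hasCompactSupport t).mul_left
  apply Complex.ext
  · rw [Complex.zero_re, ← key Complex.reCLM, ← Complex.reCLM_apply,
      ← Complex.reCLM.integral_comp_comm hint]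
    refine integral_congr_ae (Eventually.of_forall fun y => ?_)
    simp only [Complex.reCLM_apply, Complex.add_re, Complex.sub_re, Complex.re_ofReal_mul]
  · rw [Complex.zero_im, ← key Complex.imCLM, ← Complex.imCLM_apply,
      ← Complex.imCLM.integral_comp_comm hint]
    refine integral_congr_ae (Eventually.of_forall fun y => ?_)
    simp only [Complex.imCLM_apply, Complex.add_im, Complex.sub_im, Complex.im_ofReal_mul]

/-- A test function seen in the frame of a soliton. -/
noncomputable def galilean (ω v : ℝ) (χ : ℝ × ℝ → ℂ) (p : ℝ × ℝ) : ℂ :=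
  Complex.exp (Complex.I * ((ω * p.1 + v * p.2 / 2 + v ^ 2 * p.1 / 4 : ℝ) : ℂ)) *
    χ (p.1, p.2 + v * p.1)

variable {χ : ℝ × ℝ → ℂ}

theorem IsTest.galilean (h : IsTest χ) (ω v : ℝ) : IsTest (galilean ω v χ) where
  smooth := by
    unfold _root_.galilean
    refine ContDiff.mul ?_ (h.smooth.comp (by fun_prop))
    have h1 : ContDiff ℝ (⊤ : ℕ∞) fun p : ℝ × ℝ => ω * p.1 + v * p.2 / 2 + v ^ 2 * p.1 / 4 := by
      fun_prop
    exact (contDiff_const.mul (Complex.ofRealCLM.contDiff.comp h1)).cexp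
  compact := by
    obtain ⟨M, R, -, -, h2, h3⟩ := h.exists_bound
    refine HasCompactSupport.intro (K := Icc (-R) R ×ˢ Icc (-(R + |v| * R)) (R + |v| * R))
      (isCompact_Icc.prod isCompact_Icc) fun p hp => ?_
    suffices χ (p.1, p.2 + v * p.1) = 0 by rw [_root_.galilean, this, mul_zero]
    by_cases h1 : p.1 ∈ Icc (-R) R
    · refine h3 _ fun hh => hp ⟨h1, ?_⟩
      have a1 : |p.2 + v * p.1| ≤ R := abs_le.2 hh
      have a2 : |v * p.1| ≤ |v| * R := by
        rw [abs_mul]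
        exact mul_le_mul_of_nonneg_left (abs_le.2 h1) (abs_nonneg v)
      refine abs_le.1 ?_
      calc |p.2| = |(p.2 + v * p.1) - v * p.1| := by ring_nf
        _ ≤ |p.2 + v * p.1| + |v * p.1| := abs_sub _ _
        _ ≤ _ := add_le_add a1 a2
    · exact h2 _ h1

theorem hasDerivAt_galilean_phase_fst (ω v t y : ℝ) :
    HasDerivAt (fun t : ℝ => Complex.exp (Complex.I *
      ((ω * t + v * y / 2 + v ^ 2 * t / 4 : ℝ) : ℂ)))
      (Complex.exp (Complex.I * ((ω * t + v * y / 2 + v ^ 2 * t / 4 : ℝ) : ℂ)) *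
        (Complex.I * ((ω + v ^ 2 / 4 : ℝ) : ℂ))) t := by
  have h1 : HasDerivAt (fun t : ℝ => ω * t + v * y / 2 + v ^ 2 * t / 4) (ω + v ^ 2 / 4) t := by
    have := HasDerivAt.fun_add (((hasDerivAt_id t).const_mul ω).add_const (v * y / 2))
      (((hasDerivAt_id t).const_mul (v ^ 2)).div_const 4)
    simpa using this
  exact (h1.ofReal_comp.const_mul Complex.I).cexp

theorem hasDerivAt_galilean_phase_snd (ω v t y : ℝ) :
    HasDerivAt (fun y : ℝ => Complex.exp (Complex.I *
      ((ω * t + v * y / 2 + v ^ 2 * t / 4 : ℝ) : ℂ)))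
      (Complex.exp (Complex.I * ((ω * t + v * y / 2 + v ^ 2 * t / 4 : ℝ) : ℂ)) *
        (Complex.I * ((v / 2 : ℝ) : ℂ))) y := by
  have h1 : HasDerivAt (fun y : ℝ => ω * t + v * y / 2 + v ^ 2 * t / 4) (v / 2) y := by
    have := ((((hasDerivAt_id y).const_mul v).div_const 2).const_add (ω * t)).add_const
      (v ^ 2 * t / 4)
    simpa using this
  exact (h1.ofReal_comp.const_mul Complex.I).cexp

theorem dX_galilean (h : IsTest χ) (ω v : ℝ) : dX (galilean ω v χ) = fun p =>
    Complex.I * ((v / 2 : ℝ) : ℂ) * galilean ω v χ p + galilean ω v (dX χ) p := by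
  ext ⟨t, y⟩
  have h1 : HasDerivAt (fun y => χ (t, y + v * t)) (dX χ (t, y + v * t)) y :=
    (h.hasDerivAt_snd t (y + v * t)).comp_add_const y (v * t)
  refine (((h.galilean ω v).hasDerivAt_snd t y).unique
    ((hasDerivAt_galilean_phase_snd ω v t y).mul h1)).trans ?_
  simp only [galilean]
  ring

theorem dT_galilean (h : IsTest χ) (ω v : ℝ) : dT (galilean ω v χ) = fun p =>
    Complex.I * ((ω + v ^ 2 / 4 : ℝ) : ℂ) * galilean ω v χ p + galilean ω v (dT χ) p +
      v * galilean ω v (dX χ) p := by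
  ext ⟨t, y⟩
  have h0 : HasDerivAt (fun t : ℝ => (t, y + v * t)) ((1, v) : ℝ × ℝ) t := by
    refine (hasDerivAt_id t).prodMk ?_
    simpa using ((hasDerivAt_id t).const_mul v).const_add y
  have h1 : HasDerivAt (fun t => χ (t, y + v * t))
      (fderiv ℝ χ (t, y + v * t) (1, v)) t :=
    ((h.smooth.differentiable (by norm_num)) (t, y + v * t)).hasFDerivAt.comp_hasDerivAt t h0
  have h2 : fderiv ℝ χ (t, y + v * t) (1, v) = dT χ (t, y + v * t) + v * dX χ (t, y + v * t) := by
    rw [dT, dX, show ((1, v) : ℝ × ℝ) = (1, 0) + v • (0, 1) by simp, map_add, map_smul,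
      Complex.real_smul]
  rw [h2] at h1
  refine (((h.galilean ω v).hasDerivAt_fst t y).unique
    ((hasDerivAt_galilean_phase_fst ω v t y).mul h1)).trans ?_
  simp only [galilean]
  ring

/-- The transport term from the time derivative cancels the cross term of the second space
derivative, and the v²/4 terms cancel too. Only the frequency ω survives. -/
theorem galilean_adjSchr (h : IsTest χ) (ω v : ℝ) (p : ℝ × ℝ) :
    galilean ω v (adjSchr χ) p =
      adjSchr (galilean ω v χ) p - (ω : ℂ) * galilean ω v χ p := by
  have e1 : dX (dX (galilean ω v χ)) p =
      Complex.I * ((v / 2 : ℝ) : ℂ) * (Complex.I * ((v / 2 : ℝ) : ℂ) * galilean ω v χ p +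
        galilean ω v (dX χ) p) + (Complex.I * ((v / 2 : ℝ) : ℂ) * galilean ω v (dX χ) p +
          galilean ω v (dX (dX χ)) p) := by
    have hs := ((h.galilean ω v).hasDerivAt_snd p.1 p.2).const_mul (Complex.I * ((v / 2 : ℝ) : ℂ))
    have := hs.add ((h.dX.galilean ω v).hasDerivAt_snd p.1 p.2)
    have h2 := (h.galilean ω v).dX.hasDerivAt_snd p.1 p.2
    nth_rewrite 1 [dX_galilean h ω v] at h2
    rw [h2.unique this, dX_galilean h, dX_galilean h.dX]
  have e2 : galilean ω v (adjSchr χ) p =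
      -Complex.I * galilean ω v (dT χ) p + galilean ω v (dX (dX χ)) p := by
    simp only [galilean, adjSchr]
    ring
  rw [e2, adjSchr, e1, dT_galilean h]
  push_cast
  linear_combination (-((ω : ℂ) + v ^ 2 / 4) * galilean ω v χ p * (-1) - (v : ℂ) ^ 2 / 4 * galilean ω v χ p) *
    Complex.I_mul_I

/-- Travelling solitary waves solve the equation. -/
theorem IsProfile.soliton_equation (hφ : IsProfile g ω φ) (hg : ContinuousOn g (Ici 0))
    (v : ℝ) (h : IsTest χ) :
    ∫ p : ℝ × ℝ, (soliton φ ω v 0 0 p.1 p.2 * adjSchr χ p +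
      nlsF g (soliton φ ω v 0 0 p.1 p.2) * χ p) = 0 := by
  have hφc := hφ.continuous
  have hgc : Continuous fun y => g (φ y ^ 2) :=
    hg.comp_continuous (by fun_prop) fun y => mem_Ici.2 (sq_nonneg (φ y))
  have hnorm : ∀ t x, ‖soliton φ ω v 0 0 t x‖ ^ 2 = φ (x - 0 - v * t) ^ 2 := by
    intro t x
    rw [soliton, norm_mul, mul_comm Complex.I, Complex.norm_exp_ofReal_mul_I, one_mul,
      Complex.norm_real, Real.norm_eq_abs, sq_abs]
  have hR : Continuous fun p : ℝ × ℝ => soliton φ ω v 0 0 p.1 p.2 := by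
    unfold soliton
    refine Continuous.mul (by fun_prop) (Complex.continuous_ofReal.comp (hφc.comp (by fun_prop)))
  have hF : Continuous fun p : ℝ × ℝ => nlsF g (soliton φ ω v 0 0 p.1 p.2) := by
    simp only [nlsF, hnorm]
    refine Continuous.mul (Complex.continuous_ofReal.comp ?_) hR
    exact hgc.comp (by fun_prop : Continuous fun p : ℝ × ℝ => p.2 - 0 - v * p.1)
  have hint : Integrable fun p : ℝ × ℝ => soliton φ ω v 0 0 p.1 p.2 * adjSchr χ p +
      nlsF g (soliton φ ω v 0 0 p.1 p.2) * χ p :=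
    ((hR.mul h.adjSchr.continuous).integrable_of_hasCompactSupport h.adjSchr.compact.mul_left).add
      ((hF.mul h.continuous).integrable_of_hasCompactSupport h.compact.mul_left)
  set ψ := galilean ω v χ with hψ
  have hψt : IsTest ψ := h.galilean ω v
  rw [Measure.volume_eq_prod] at hint ⊢
  rw [integral_prod _ hint]
  have hφ' : Continuous fun y => (φ y : ℂ) := Complex.continuous_ofReal.comp hφc
  have hg' : Continuous fun y => ((g (φ y ^ 2) * φ y : ℝ) : ℂ) :=
    Complex.continuous_ofReal.comp (hgc.mul hφc)
  -- In the coordinate y = x - vt the soliton is φ(y) times the phase contained in ψ. The stationary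
  -- equation on the slice of ψ removes everything except the time derivative, whose integral over t
  -- vanishes.
  have inner_eq : ∀ t, (∫ x, (soliton φ ω v 0 0 t x * adjSchr χ (t, x) +
      nlsF g (soliton φ ω v 0 0 t x) * χ (t, x))) = -Complex.I * ∫ y, (φ y : ℂ) * dT ψ (t, y) := by
    intro t
    rw [← integral_add_right_eq_self _ (v * t), ← integral_const_mul,
      ← add_zero (∫ y, -Complex.I * ((φ y : ℂ) * dT ψ (t, y))),
      ← hφ.integral_complex hg hψt t, ← integral_add]
    · refine integral_congr_ae (Eventually.of_forall fun y => ?_)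
      have hph : Complex.exp (Complex.I * ((ω * t + v * (y + v * t) / 2 - v ^ 2 * t / 4 + 0 : ℝ) : ℂ))
          = Complex.exp (Complex.I * ((ω * t + v * y / 2 + v ^ 2 * t / 4 : ℝ) : ℂ)) := by
        congr 3
        ring
      have hs : soliton φ ω v 0 0 t (y + v * t) =
          Complex.exp (Complex.I * ((ω * t + v * y / 2 + v ^ 2 * t / 4 : ℝ) : ℂ)) * (φ y : ℂ) := by
        rw [soliton, hph]
        congr 3
        ring
      have h1 := galilean_adjSchr h ω v (t, y)
      have h2 : ψ (t, y) = Complex.exp (Complex.I *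
        ((ω * t + v * y / 2 + v ^ 2 * t / 4 : ℝ) : ℂ)) * χ (t, y + v * t) := rfl
      have h3 : galilean ω v (adjSchr χ) (t, y) = Complex.exp (Complex.I *
        ((ω * t + v * y / 2 + v ^ 2 * t / 4 : ℝ) : ℂ)) * adjSchr χ (t, y + v * t) := rfl
      simp only [nlsF, hnorm]
      rw [hs, show y + v * t - 0 - v * t = y by ring]
      have h4 : adjSchr ψ (t, y) = -Complex.I * dT ψ (t, y) + dX (dX ψ) (t, y) := rfl
      rw [h3, ← hψ, h4] at h1
      generalize Complex.exp (Complex.I * ((ω * t + v * y / 2 + v ^ 2 * t / 4 : ℝ) : ℂ)) = e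
        at h1 h2 ⊢
      push_cast
      linear_combination (φ y : ℂ) * h1 - (g (φ y ^ 2) : ℂ) * φ y * h2
    · exact ((hφ'.mul (hψt.dT.slice_contDiff t).continuous).integrable_of_hasCompactSupport
        (hψt.dT.slice_hasCompactSupport t).mul_left).const_mul _
    · have c1 := (hψt.dX.dX.slice_contDiff t).continuous
      have c2 := (hψt.slice_contDiff t).continuous
      refine Integrable.add (Integrable.sub ?_ (Integrable.const_mul ?_ _)) ?_
      · exact (hφ'.mul c1).integrable_of_hasCompactSupport
          (hψt.dX.dX.slice_hasCompactSupport t).mul_left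
      · exact (hφ'.mul c2).integrable_of_hasCompactSupport (hψt.slice_hasCompactSupport t).mul_left
      · exact (hg'.mul c2).integrable_of_hasCompactSupport (hψt.slice_hasCompactSupport t).mul_left
  simp only
  simp_rw [inner_eq]
  rw [integral_const_mul, integral_integral_swap]
  · have : ∀ y, ∫ t, (φ y : ℂ) * dT ψ (t, y) = 0 := by
      intro y
      rw [integral_const_mul]
      have hcs : ∀ {χ' : ℝ × ℝ → ℂ}, IsTest χ' → Integrable fun t => χ' (t, y) := by
        intro χ' h'
        refine (h'.continuous.comp (Continuous.prodMk_left y)).integrable_of_hasCompactSupport ?_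
        obtain ⟨M, R, -, -, -, h2⟩ := h'.exists_indicator_bound
        exact HasCompactSupport.intro isCompact_Icc fun t ht => h2 t ht y
      rw [integral_eq_zero_of_hasDerivAt_of_integrable (fun t => hψt.hasDerivAt_fst t y)
        (hcs hψt.dT) (hcs hψt), mul_zero]
    simp [this]
  · refine Continuous.integrable_of_hasCompactSupport (f := fun p : ℝ × ℝ => (φ p.2 : ℂ) * dT ψ p)
      ((hφ'.comp continuous_snd).mul hψt.dT.continuous) hψt.dT.compact.mul_left

end SolitonEquation

/-! ### Envelopes and weights of a soliton train -/

theorem hasSum_half_pow_succ : HasSum (fun j : ℕ => (1 / 2 : ℝ) ^ (j + 1)) 1 := by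
  simpa [pow_succ] using (hasSum_geometric_two.mul_right (1 / 2 : ℝ))

theorem sum_half_pow_succ_le (N : ℕ) : ∑ j ∈ Finset.range N, (1 / 2 : ℝ) ^ (j + 1) ≤ 1 :=
  sum_le_hasSum _ (fun _ _ => by positivity) hasSum_half_pow_succ

theorem min_sum_le {ι : Type*} (s : Finset ι) {f : ι → ℝ} (hf : ∀ i, 0 ≤ f i) {y : ℝ} (hy : 0 ≤ y) :
    min (∑ i ∈ s, f i) y ≤ ∑ i ∈ s, min (f i) y := by
  classical
  induction s using Finset.induction_on with
  | empty => simp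
  | insert i s hi ih =>
    rw [Finset.sum_insert hi, Finset.sum_insert hi]
    have h1 : min (f i + ∑ j ∈ s, f j) y ≤ min (f i) y + min (∑ j ∈ s, f j) y := by
      have h2 : 0 ≤ ∑ j ∈ s, f j := Finset.sum_nonneg fun j _ => hf j
      have := hf i
      rcases le_total (f i) y with h | h <;> rcases le_total (∑ j ∈ s, f j) y with h' | h' <;>
        simp only [min_eq_left, min_eq_right, h, h'] <;>
        first
          | exact min_le_left _ _
          | exact (min_le_right _ _).trans (by linarith)
    linarith

theorem integral_exp_neg_mul_abs {β : ℝ} (hβ : 0 < β) :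
    ∫ x : ℝ, Real.exp (-(β * |x|)) = 2 / β := by
  rw [integral_comp_abs (f := fun x => Real.exp (-(β * x)))]
  have := integral_exp_neg_mul_Ioi_zero hβ
  simp only [neg_mul] at this
  rw [this]
  ring

theorem integrable_exp_neg_mul_abs_sub {β : ℝ} (hβ : 0 < β) (m : ℝ) :
    Integrable fun x : ℝ => Real.exp (-(β * |x - m|)) := by
  have h : Integrable fun x : ℝ => Real.exp (-(β * |x|)) := by
    -- A nonintegrable function has integral zero by convention, so a nonzero value proves
    -- integrability.
    by_contra hne
    have h1 := integral_undef hne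
    rw [integral_exp_neg_mul_abs hβ] at h1
    exact (by positivity : (2 / β) ≠ 0) h1
  exact h.comp_sub_right m

/-- Amplitudes, decay rates and velocities of a soliton train. -/
structure TrainSeq (α lam : ℝ) (B β v : ℕ → ℝ) : Prop where
  one_le : 1 ≤ α
  lam_pos : 0 < lam
  B_nonneg : ∀ j, 0 ≤ B j
  B_le : ∀ j, B j ≤ (1 / 4 : ℝ) ^ (j + 1)
  β_pos : ∀ j, 0 < β j
  β_le : ∀ j, β j ≤ 2
  weight_le : ∀ j, (2 ^ (j + 1) * B j) ^ α * Real.exp j * (2 / β j) ≤ (1 / 2 : ℝ) ^ (j + 1)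
  separated : ∀ j n, j < n → ∀ t, 0 ≤ t → ∀ x,
    2 * lam * t ≤ β j * |x - v j * t| + β n * |x - v n * t|
  speed_le : ∀ j, β j * |v j| ≤ 2 * lam * j

/-- The pointwise bound for a soliton. -/
noncomputable def envelope (B β v : ℕ → ℝ) (j : ℕ) (t x : ℝ) : ℝ :=
  B j * Real.exp (-(β j * |x - v j * t|))

/-- A summable majorant for powers of the sum of the envelopes. -/
noncomputable def trainWeight (α : ℝ) (B β v : ℕ → ℝ) (t x : ℝ) : ℝ :=
  ∑' j, (2 ^ (j + 1) * B j) ^ α * Real.exp (-(β j * |x - v j * t|))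

/-- A majorant for the weight on a small time interval. -/
noncomputable def localWeight (α : ℝ) (B β v : ℕ → ℝ) (t x : ℝ) : ℝ :=
  ∑' j, (2 ^ (j + 1) * B j) ^ α * Real.exp j * Real.exp (-(β j * |x - v j * t|))

namespace TrainSeq

variable {α lam : ℝ} {B β v : ℕ → ℝ}

theorem exp_le_one (h : TrainSeq α lam B β v) (j : ℕ) (t x : ℝ) :
    Real.exp (-(β j * |x - v j * t|)) ≤ 1 := by
  rw [Real.exp_le_one_iff]
  have : 0 ≤ β j * |x - v j * t| := mul_nonneg (h.β_pos j).le (abs_nonneg _)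
  linarith

theorem envelope_nonneg (h : TrainSeq α lam B β v) (j : ℕ) (t x : ℝ) : 0 ≤ envelope B β v j t x :=
  mul_nonneg (h.B_nonneg j) (Real.exp_pos _).le

theorem B_le_half (h : TrainSeq α lam B β v) (j : ℕ) : B j ≤ (1 / 2 : ℝ) ^ (j + 1) :=
  (h.B_le j).trans (pow_le_pow_left₀ (by norm_num) (by norm_num) _)

theorem envelope_le (h : TrainSeq α lam B β v) (j : ℕ) (t x : ℝ) : envelope B β v j t x ≤ B j :=
  mul_le_of_le_one_right (h.B_nonneg j) (h.exp_le_one j t x)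

theorem summable_B (h : TrainSeq α lam B β v) : Summable B :=
  Summable.of_nonneg_of_le h.B_nonneg h.B_le_half hasSum_half_pow_succ.summable

theorem summable_envelope (h : TrainSeq α lam B β v) (t x : ℝ) :
    Summable fun j => envelope B β v j t x :=
  Summable.of_nonneg_of_le (fun j => h.envelope_nonneg j t x) (fun j => h.envelope_le j t x)
    h.summable_B

theorem tsum_envelope_nonneg (h : TrainSeq α lam B β v) (t x : ℝ) :
    0 ≤ ∑' j, envelope B β v j t x := tsum_nonneg fun j => h.envelope_nonneg j t x

theorem tsum_envelope_le_one (h : TrainSeq α lam B β v) (t x : ℝ) :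
    ∑' j, envelope B β v j t x ≤ 1 :=
  (h.summable_envelope t x).tsum_le_of_sum_le fun s =>
    (Finset.sum_le_sum fun j _ => (h.envelope_le j t x).trans (h.B_le_half j)).trans
      (sum_le_hasSum s (fun _ _ => by positivity) hasSum_half_pow_succ)

theorem coeff_nonneg (h : TrainSeq α lam B β v) (j : ℕ) : 0 ≤ (2 ^ (j + 1) * B j) ^ α :=
  Real.rpow_nonneg (mul_nonneg (by positivity) (h.B_nonneg j)) _

theorem coeff_le (h : TrainSeq α lam B β v) (j : ℕ) :
    (2 ^ (j + 1) * B j) ^ α ≤ (1 / 2 : ℝ) ^ (j + 1) := by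
  have h0 : 0 ≤ 2 ^ (j + 1) * B j := mul_nonneg (by positivity) (h.B_nonneg j)
  have h1 : 2 ^ (j + 1) * B j ≤ (1 / 2 : ℝ) ^ (j + 1) := by
    calc 2 ^ (j + 1) * B j ≤ 2 ^ (j + 1) * (1 / 4 : ℝ) ^ (j + 1) := by
          gcongr
          exact h.B_le j
      _ = _ := by rw [← mul_pow]; norm_num
  have h2 : 2 ^ (j + 1) * B j ≤ 1 := h1.trans (pow_le_one₀ (by norm_num) (by norm_num))
  exact (Real.rpow_le_self_of_le_one h0 h2 h.one_le).trans h1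

theorem term_nonneg (h : TrainSeq α lam B β v) (j : ℕ) (t x : ℝ) :
    0 ≤ (2 ^ (j + 1) * B j) ^ α * Real.exp (-(β j * |x - v j * t|)) :=
  mul_nonneg (h.coeff_nonneg j) (Real.exp_pos _).le

theorem term_le (h : TrainSeq α lam B β v) (j : ℕ) (t x : ℝ) :
    (2 ^ (j + 1) * B j) ^ α * Real.exp (-(β j * |x - v j * t|)) ≤ (1 / 2 : ℝ) ^ (j + 1) :=
  (mul_le_of_le_one_right (h.coeff_nonneg j) (h.exp_le_one j t x)).trans (h.coeff_le j)

theorem summable_term (h : TrainSeq α lam B β v) (t x : ℝ) :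
    Summable fun j : ℕ => (2 ^ (j + 1) * B j) ^ α * Real.exp (-(β j * |x - v j * t|)) :=
  Summable.of_nonneg_of_le (fun j => h.term_nonneg j t x) (fun j => h.term_le j t x)
    hasSum_half_pow_succ.summable

theorem trainWeight_nonneg (h : TrainSeq α lam B β v) (t x : ℝ) : 0 ≤ trainWeight α B β v t x :=
  tsum_nonneg fun j => h.term_nonneg j t x

theorem trainWeight_le_one (h : TrainSeq α lam B β v) (t x : ℝ) : trainWeight α B β v t x ≤ 1 :=
  ((h.summable_term t x).tsum_le_tsum (fun j => h.term_le j t x)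
    hasSum_half_pow_succ.summable).trans hasSum_half_pow_succ.tsum_eq.le

/-- The α-th power of 2^{j+1} times the j-th envelope is at most the j-th term of the weight, since
e^{-αy} ≤ e^{-y}. Taking roots and summing the factors 2^{-(j+1)} gives the claim. -/
theorem rpow_tsum_envelope_le (h : TrainSeq α lam B β v) (t x : ℝ) :
    (∑' j, envelope B β v j t x) ^ α ≤ trainWeight α B β v t x := by
  have hα : 0 < α := one_pos.trans_le h.one_le
  set Z := trainWeight α B β v t x with hZ
  have hZ0 : 0 ≤ Z := h.trainWeight_nonneg t x
  have key : ∀ j : ℕ, envelope B β v j t x ≤ (1 / 2 : ℝ) ^ (j + 1) * Z ^ (1 / α) := by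
    intro j
    have h0 : 0 ≤ 2 ^ (j + 1) * envelope B β v j t x :=
      mul_nonneg (by positivity) (h.envelope_nonneg j t x)
    have h1 : (2 ^ (j + 1) * envelope B β v j t x) ^ α ≤ Z := by
      refine le_trans ?_ ((h.summable_term t x).le_tsum j fun i _ => h.term_nonneg i t x)
      have e : 2 ^ (j + 1) * envelope B β v j t x =
          2 ^ (j + 1) * B j * Real.exp (-(β j * |x - v j * t|)) := by
        rw [envelope]; ring
      rw [e, Real.mul_rpow (mul_nonneg (by positivity) (h.B_nonneg j)) (Real.exp_pos _).le]
      exact mul_le_mul_of_nonneg_left (Real.rpow_le_self_of_le_one (Real.exp_pos _).le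
        (h.exp_le_one j t x) h.one_le) (h.coeff_nonneg j)
    have h2 : 2 ^ (j + 1) * envelope B β v j t x ≤ Z ^ (1 / α) := by
      have := Real.rpow_le_rpow (Real.rpow_nonneg h0 α) h1 (by positivity : 0 ≤ 1 / α)
      rwa [← Real.rpow_mul h0, mul_one_div_cancel hα.ne', Real.rpow_one] at this
    calc envelope B β v j t x
        = (1 / 2 : ℝ) ^ (j + 1) * (2 ^ (j + 1) * envelope B β v j t x) := by
          rw [← mul_assoc, ← mul_pow]; norm_num
      _ ≤ _ := by gcongr
  have hsum : ∑' j, envelope B β v j t x ≤ Z ^ (1 / α) := by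
    have h1 := hasSum_half_pow_succ.mul_right (Z ^ (1 / α))
    rw [one_mul] at h1
    exact (h.summable_envelope t x).tsum_le_of_sum_le fun s =>
      (Finset.sum_le_sum fun j _ => key j).trans (sum_le_hasSum s (fun _ _ => by positivity) h1)
  calc (∑' j, envelope B β v j t x) ^ α ≤ (Z ^ (1 / α)) ^ α :=
        Real.rpow_le_rpow (h.tsum_envelope_nonneg t x) hsum hα.le
    _ = Z := by rw [← Real.rpow_mul hZ0, one_div_mul_cancel hα.ne', Real.rpow_one]

theorem localTerm_nonneg (h : TrainSeq α lam B β v) (t x : ℝ) (j : ℕ) :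
    0 ≤ (2 ^ (j + 1) * B j) ^ α * Real.exp j * Real.exp (-(β j * |x - v j * t|)) := by
  have := h.coeff_nonneg j
  positivity

theorem localTerm_le (h : TrainSeq α lam B β v) (t x : ℝ) (j : ℕ) :
    (2 ^ (j + 1) * B j) ^ α * Real.exp j * Real.exp (-(β j * |x - v j * t|)) ≤
      (1 / 2 : ℝ) ^ (j + 1) := by
  have h0 : 0 ≤ (2 ^ (j + 1) * B j) ^ α * Real.exp j :=
    mul_nonneg (h.coeff_nonneg j) (Real.exp_pos _).le
  -- Since β ≤ 2, the bound `weight_le`, designed for the integral, also bounds the supremum.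
  have h1 : 1 ≤ 2 / β j := by
    rw [le_div_iff₀ (h.β_pos j), one_mul]
    exact h.β_le j
  exact (mul_le_of_le_one_right h0 (h.exp_le_one j t x)).trans
    ((le_mul_of_one_le_right h0 h1).trans (h.weight_le j))

theorem summable_localTerm (h : TrainSeq α lam B β v) (t x : ℝ) : Summable fun j : ℕ =>
    (2 ^ (j + 1) * B j) ^ α * Real.exp j * Real.exp (-(β j * |x - v j * t|)) :=
  Summable.of_nonneg_of_le (h.localTerm_nonneg t x) (h.localTerm_le t x)
    hasSum_half_pow_succ.summable

theorem localWeight_nonneg (h : TrainSeq α lam B β v) (t x : ℝ) : 0 ≤ localWeight α B β v t x :=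
  tsum_nonneg (h.localTerm_nonneg t x)

theorem continuous_localWeight (h : TrainSeq α lam B β v) :
    Continuous fun p : ℝ × ℝ => localWeight α B β v p.1 p.2 := by
  refine continuous_tsum (fun j => by fun_prop) hasSum_half_pow_succ.summable fun j p => ?_
  rw [Real.norm_of_nonneg (h.localTerm_nonneg _ _ j)]
  exact h.localTerm_le p.1 p.2 j

theorem continuous_trainWeight (h : TrainSeq α lam B β v) :
    Continuous fun p : ℝ × ℝ => trainWeight α B β v p.1 p.2 := by
  refine continuous_tsum (fun j => by fun_prop) hasSum_half_pow_succ.summable fun j p => ?_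
  rw [Real.norm_of_nonneg (h.term_nonneg j _ _)]
  exact h.term_le j p.1 p.2

/-- The integral of e^{-β|x|} is 2/β, so `weight_le` bounds the integral of the j-th term by
2^{-(j+1)}; translation invariance makes this independent of t. -/
theorem lintegral_localWeight_le (h : TrainSeq α lam B β v) (t : ℝ) :
    ∫⁻ x, ENNReal.ofReal (localWeight α B β v t x) ≤ 1 := by
  have hβ := h.β_pos
  have e : ∀ x, ENNReal.ofReal (localWeight α B β v t x) = ∑' j : ℕ, ENNReal.ofReal
      ((2 ^ (j + 1) * B j) ^ α * Real.exp j * Real.exp (-(β j * |x - v j * t|))) := fun x =>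
    ENNReal.ofReal_tsum_of_nonneg (h.localTerm_nonneg t x) (h.summable_localTerm t x)
  simp_rw [e]
  rw [lintegral_tsum fun j => by fun_prop]
  have hval : ∀ j : ℕ, ∫⁻ x, ENNReal.ofReal
      ((2 ^ (j + 1) * B j) ^ α * Real.exp j * Real.exp (-(β j * |x - v j * t|))) ≤
      ENNReal.ofReal ((1 / 2 : ℝ) ^ (j + 1)) := by
    intro j
    rw [← ofReal_integral_eq_lintegral_ofReal
      ((integrable_exp_neg_mul_abs_sub (hβ j) (v j * t)).const_mul _)
      (Eventually.of_forall fun x => h.localTerm_nonneg t x j)]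
    refine ENNReal.ofReal_le_ofReal ?_
    rw [integral_const_mul, integral_sub_right_eq_self (fun x => Real.exp (-(β j * |x|))) (v j * t),
      integral_exp_neg_mul_abs (hβ j)]
    exact h.weight_le j
  refine (ENNReal.tsum_le_tsum hval).trans ?_
  rw [← ENNReal.ofReal_tsum_of_nonneg (fun j => by positivity) hasSum_half_pow_succ.summable,
    hasSum_half_pow_succ.tsum_eq, ENNReal.ofReal_one]

theorem integrable_localWeight (h : TrainSeq α lam B β v) (t : ℝ) :
    Integrable (localWeight α B β v t) := by
  refine ⟨(h.continuous_localWeight.comp (Continuous.prodMk_right t)).aestronglyMeasurable, ?_⟩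
  rw [hasFiniteIntegral_iff_ofReal (Eventually.of_forall fun x => h.localWeight_nonneg t x)]
  exact (h.lintegral_localWeight_le t).trans_lt ENNReal.one_lt_top

theorem integral_localWeight_le (h : TrainSeq α lam B β v) (t : ℝ) :
    ∫ x, localWeight α B β v t x ≤ 1 := by
  rw [integral_eq_lintegral_of_nonneg_ae (Eventually.of_forall fun x => h.localWeight_nonneg t x)
    (h.integrable_localWeight t).1]
  exact ENNReal.toReal_le_of_le_ofReal zero_le_one
    ((h.lintegral_localWeight_le t).trans (by rw [ENNReal.ofReal_one]))

/-- The weight is dominated locally uniformly in time by an integrable function. -/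
theorem trainWeight_le_localWeight (h : TrainSeq α lam B β v) {t t₀ : ℝ}
    (ht : 2 * lam * |t - t₀| ≤ 1) (x : ℝ) :
    trainWeight α B β v t x ≤ localWeight α B β v t₀ x := by
  refine (h.summable_term t x).tsum_le_tsum (fun j => ?_) (h.summable_localTerm t₀ x)
  rw [mul_assoc, ← Real.exp_add]
  refine mul_le_mul_of_nonneg_left (Real.exp_le_exp.2 ?_) (h.coeff_nonneg j)
  -- Moving the centre from v_j t to v_j t₀ changes the exponent by at most β_j|v_j||t - t₀| ≤ j,
  -- which the factor e^j of `localWeight` pays for.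
  have h1 : |x - v j * t₀| ≤ |x - v j * t| + |v j| * |t - t₀| := by
    rw [← abs_mul]
    calc |x - v j * t₀| = |(x - v j * t) + v j * (t - t₀)| := by ring_nf
      _ ≤ _ := abs_add_le _ _
  have h2 := mul_le_mul_of_nonneg_left h1 (h.β_pos j).le
  have h3 := mul_le_mul_of_nonneg_right (h.speed_le j) (abs_nonneg (t - t₀))
  have h4 : (j : ℝ) * (2 * lam * |t - t₀|) ≤ j * 1 :=
    mul_le_mul_of_nonneg_left ht (Nat.cast_nonneg j)
  nlinarith

theorem integrable_trainWeight (h : TrainSeq α lam B β v) (t : ℝ) :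
    Integrable (trainWeight α B β v t) := by
  refine (h.integrable_localWeight t).mono'
    (h.continuous_trainWeight.comp (Continuous.prodMk_right t)).aestronglyMeasurable
    (Eventually.of_forall fun x => ?_)
  rw [Real.norm_of_nonneg (h.trainWeight_nonneg t x)]
  exact h.trainWeight_le_localWeight (by simp) x

theorem integral_trainWeight_le (h : TrainSeq α lam B β v) (t : ℝ) :
    ∫ x, trainWeight α B β v t x ≤ 1 :=
  (integral_mono (h.integrable_trainWeight t) (h.integrable_localWeight t)
    fun x => h.trainWeight_le_localWeight (by simp) x).trans (h.integral_localWeight_le t)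

/-- As the weight is at most one, its square is below the integrable local majorant. This gives the
L² majorant, locally uniform in time, used for the continuity of the interactions. -/
theorem trainWeight_le_sqrt (h : TrainSeq α lam B β v) {t t₀ : ℝ}
    (ht : 2 * lam * |t - t₀| ≤ 1) (x : ℝ) :
    trainWeight α B β v t x ≤ √(localWeight α B β v t₀ x) := by
  refine Real.le_sqrt_of_sq_le ?_
  have h0 := h.trainWeight_nonneg t x
  have h1 := h.trainWeight_le_one t x
  have h2 := h.trainWeight_le_localWeight ht x
  nlinarith

theorem memLp_sqrt_localWeight (h : TrainSeq α lam B β v) (t : ℝ) :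
    MemLp (fun x => √(localWeight α B β v t x)) 2 volume := by
  rw [memLp_two_iff_integrable_sq]
  · refine (h.integrable_localWeight t).congr (Eventually.of_forall fun x => ?_)
    exact (Real.sq_sqrt (h.localWeight_nonneg t x)).symm
  · exact (Real.continuous_sqrt.comp
      (h.continuous_localWeight.comp (Continuous.prodMk_right t))).aestronglyMeasurable

/-- The square of the minimum is at most the product, whose exponentials give e^{-2λt} by
separation. The amplitudes 4^{-(j+1)} leave factors 2^{-(j+1)} after the root, summable in both
indices. -/
theorem min_envelope_le (h : TrainSeq α lam B β v) {j n : ℕ} (hjn : j < n) {t : ℝ} (ht : 0 ≤ t)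
    (x : ℝ) : min (envelope B β v j t x) (envelope B β v n t x) ≤
      (1 / 2 : ℝ) ^ (j + 1) * ((1 / 2 : ℝ) ^ (n + 1) * Real.exp (-lam * t)) := by
  have hj := h.envelope_nonneg j t x
  have hn := h.envelope_nonneg n t x
  refine (pow_le_pow_iff_left₀ (le_min hj hn) (by positivity) two_ne_zero).1 ?_
  have h1 : min (envelope B β v j t x) (envelope B β v n t x) ^ 2 ≤
      envelope B β v j t x * envelope B β v n t x := by
    rw [sq]
    exact mul_le_mul (min_le_left _ _) (min_le_right _ _) (le_min hj hn) hj
  have h2 : Real.exp (-(β j * |x - v j * t|)) * Real.exp (-(β n * |x - v n * t|)) ≤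
      Real.exp (-lam * t) ^ 2 := by
    rw [← Real.exp_add, ← Real.exp_nat_mul]
    refine Real.exp_le_exp.2 ?_
    have := h.separated j n hjn t ht x
    push_cast
    linarith
  have e : ∀ k : ℕ, (1 / 4 : ℝ) ^ k = (1 / 2 : ℝ) ^ k * (1 / 2 : ℝ) ^ k := by
    intro k
    rw [← mul_pow]
    norm_num
  calc _ ≤ envelope B β v j t x * envelope B β v n t x := h1
    _ = B j * B n * (Real.exp (-(β j * |x - v j * t|)) * Real.exp (-(β n * |x - v n * t|))) := by
        simp only [envelope]; ring
    _ ≤ ((1 / 4 : ℝ) ^ (j + 1) * (1 / 4 : ℝ) ^ (n + 1)) * Real.exp (-lam * t) ^ 2 := by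
        gcongr
        · exact h.B_nonneg n
        · exact h.B_le j
        · exact h.B_le n
    _ = _ := by rw [e (j + 1), e (n + 1)]; ring

end TrainSeq

/-! ### Pointwise estimates for the interactions -/

/-- Waves bounded by the envelopes of a train. -/
structure Train (α lam : ℝ) (B β v : ℕ → ℝ) (R : ℕ → ℝ → ℝ → ℂ) : Prop extends
    TrainSeq α lam B β v where
  continuous : ∀ j, Continuous fun p : ℝ × ℝ => R j p.1 p.2
  norm_le : ∀ j t x, ‖R j t x‖ ≤ envelope B β v j t x

/-- The interaction terms of a train. -/
noncomputable def interaction (F : ℂ → ℂ) (R : ℕ → ℝ → ℝ → ℂ) (t x : ℝ) : ℂ :=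
  F (∑' j, R j t x) - ∑' j, F (R j t x)

namespace PowerLipschitz

variable {F : ℂ → ℂ} {L α : ℝ}

theorem norm_sub_le_of_norm_le (hF : PowerLipschitz F L α) {z w : ℂ} {s : ℝ} (hz : ‖z‖ ≤ s)
    (hw : ‖w‖ ≤ s) : ‖F z - F w‖ ≤ L * s ^ α * ‖z - w‖ := by
  have hα := hF.one_le
  have hL := hF.nonneg
  refine (hF.bound z w).trans ?_
  have h0 : 0 ≤ max (min ‖z‖ 2) (min ‖w‖ 2) := le_max_of_le_left (by positivity)
  gcongr
  exact max_le ((min_le_left _ _).trans hz) ((min_le_left _ _).trans hw)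

theorem norm_sub_le (hF : PowerLipschitz F L α) (z w : ℂ) :
    ‖F z - F w‖ ≤ L * 2 ^ α * ‖z - w‖ := by
  have hα := hF.one_le
  have hL := hF.nonneg
  refine (hF.bound z w).trans ?_
  have h0 : 0 ≤ max (min ‖z‖ 2) (min ‖w‖ 2) := le_max_of_le_left (by positivity)
  gcongr
  exact max_le (min_le_right _ _) (min_le_right _ _)

theorem continuous (hF : PowerLipschitz F L α) : Continuous F := by
  have hL := hF.nonneg
  have : LipschitzWith (L * 2 ^ α).toNNReal F := LipschitzWith.of_dist_le_mul fun z w => by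
    rw [dist_eq_norm, dist_eq_norm, Real.coe_toNNReal _ (by positivity)]
    exact hF.norm_sub_le z w
  exact this.continuous

theorem norm_le (hF : PowerLipschitz F L α) {z : ℂ} {s : ℝ} (hz : ‖z‖ ≤ s) :
    ‖F z‖ ≤ L * s ^ α * ‖z‖ := by
  have := hF.norm_sub_le_of_norm_le hz (w := 0) (by simpa using (norm_nonneg z).trans hz)
  simpa [hF.map_zero] using this

/-- Three regimes: |w| ≤ s; s ≤ |w| ≤ 1, where |w|^α ≤ |w| since α ≥ 1; and |w| ≥ 1, where the
global Lipschitz bound suffices. The part without the weight is quadratic in w, hence in L¹ for w in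
L². -/
theorem norm_add_sub_le (hF : PowerLipschitz F L α) {T w : ℂ} {s : ℝ} (hT : ‖T‖ ≤ s) :
    ‖F (T + w) - F T‖ ≤ L * 4 ^ α * (s ^ α + ‖w‖) * ‖w‖ := by
  have hα := hF.one_le
  have hL := hF.nonneg
  have hs0 : 0 ≤ s := (norm_nonneg T).trans hT
  have h24 : (2 : ℝ) ^ α ≤ 4 ^ α := Real.rpow_le_rpow (by norm_num) (by norm_num) (by linarith)
  rcases le_total ‖w‖ s with hw | hw
  · have h1 := hF.norm_sub_le_of_norm_le (z := T + w) (w := T) (s := 2 * s)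
      ((norm_add_le _ _).trans (by linarith)) (by linarith)
    rw [add_sub_cancel_left, Real.mul_rpow (by norm_num) hs0] at h1
    refine h1.trans ?_
    have : 2 ^ α * s ^ α ≤ 4 ^ α * (s ^ α + ‖w‖) := by
      gcongr
      linarith [norm_nonneg w]
    calc L * (2 ^ α * s ^ α) * ‖w‖ ≤ L * (4 ^ α * (s ^ α + ‖w‖)) * ‖w‖ := by gcongr
      _ = _ := by ring
  · rcases le_total ‖w‖ 1 with h1 | h1
    · have h2 := hF.norm_sub_le_of_norm_le (z := T + w) (w := T) (s := 2 * ‖w‖)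
        ((norm_add_le _ _).trans (by linarith)) (by linarith [norm_nonneg w])
      rw [add_sub_cancel_left, Real.mul_rpow (by norm_num) (norm_nonneg w)] at h2
      refine h2.trans ?_
      have h3 : ‖w‖ ^ α ≤ ‖w‖ := Real.rpow_le_self_of_le_one (norm_nonneg w) h1 hα
      have h4 : 0 ≤ s ^ α := Real.rpow_nonneg hs0 α
      have : 2 ^ α * ‖w‖ ^ α ≤ 4 ^ α * (s ^ α + ‖w‖) := by
        gcongr
        linarith
      calc L * (2 ^ α * ‖w‖ ^ α) * ‖w‖ ≤ L * (4 ^ α * (s ^ α + ‖w‖)) * ‖w‖ := by gcongr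
        _ = _ := by ring
    · have h2 := hF.norm_sub_le (T + w) T
      rw [add_sub_cancel_left] at h2
      refine h2.trans ?_
      have h4 : 0 ≤ s ^ α := Real.rpow_nonneg hs0 α
      have : (2 : ℝ) ^ α ≤ 4 ^ α * (s ^ α + ‖w‖) :=
        h24.trans (le_mul_of_one_le_right (by positivity) (by linarith))
      calc L * 2 ^ α * ‖w‖ ≤ L * (4 ^ α * (s ^ α + ‖w‖)) * ‖w‖ := by gcongr
        _ = _ := by ring

end PowerLipschitz

namespace Train

variable {α lam : ℝ} {B β v : ℕ → ℝ} {R : ℕ → ℝ → ℝ → ℂ} {F : ℂ → ℂ} {L : ℝ}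

theorem summable_norm (h : Train α lam B β v R) (t x : ℝ) : Summable fun j => ‖R j t x‖ :=
  Summable.of_nonneg_of_le (fun _ => norm_nonneg _) (fun j => h.norm_le j t x)
    (h.summable_envelope t x)

theorem norm_le_B (h : Train α lam B β v R) (j : ℕ) (t x : ℝ) : ‖R j t x‖ ≤ B j :=
  (h.norm_le j t x).trans (h.envelope_le j t x)

theorem norm_le_tsum (h : Train α lam B β v R) (j : ℕ) (t x : ℝ) :
    ‖R j t x‖ ≤ ∑' j, envelope B β v j t x :=
  (h.norm_le j t x).trans ((h.summable_envelope t x).le_tsum j fun i _ => h.envelope_nonneg i t x)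

theorem norm_tsum_le (h : Train α lam B β v R) (t x : ℝ) :
    ‖∑' j, R j t x‖ ≤ ∑' j, envelope B β v j t x :=
  tsum_of_norm_bounded (h.summable_envelope t x).hasSum fun j => h.norm_le j t x

theorem norm_tsum_le_one (h : Train α lam B β v R) (t x : ℝ) : ‖∑' j, R j t x‖ ≤ 1 :=
  (h.norm_tsum_le t x).trans (h.tsum_envelope_le_one t x)

theorem continuous_tsum (h : Train α lam B β v R) :
    Continuous fun p : ℝ × ℝ => ∑' j, R j p.1 p.2 :=
  _root_.continuous_tsum h.continuous h.summable_B fun j p => h.norm_le_B j p.1 p.2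

theorem norm_comp_le (h : Train α lam B β v R) (hF : PowerLipschitz F L α) (j : ℕ) (t x : ℝ) :
    ‖F (R j t x)‖ ≤ L * B j := by
  have hL := hF.nonneg
  have h1 := hF.norm_le (z := R j t x) (s := 1)
    ((h.norm_le_tsum j t x).trans (h.tsum_envelope_le_one t x))
  rw [Real.one_rpow, mul_one] at h1
  exact h1.trans (mul_le_mul_of_nonneg_left (h.norm_le_B j t x) hL)

theorem summable_comp (h : Train α lam B β v R) (hF : PowerLipschitz F L α) (t x : ℝ) :
    Summable fun j => F (R j t x) :=
  Summable.of_norm_bounded (h.summable_B.mul_left L) fun j => h.norm_comp_le hF j t x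

theorem continuous_tsum_comp (h : Train α lam B β v R) (hF : PowerLipschitz F L α) :
    Continuous fun p : ℝ × ℝ => ∑' j, F (R j p.1 p.2) :=
  _root_.continuous_tsum (fun j => hF.continuous.comp (h.continuous j)) (h.summable_B.mul_left L)
    fun j p => h.norm_comp_le hF j p.1 p.2

theorem continuous_interaction (h : Train α lam B β v R) (hF : PowerLipschitz F L α) :
    Continuous fun p : ℝ × ℝ => interaction F R p.1 p.2 :=
  (hF.continuous.comp h.continuous_tsum).sub (h.continuous_tsum_comp hF)

/-- The waves are added one at a time. All partial sums and single waves have modulus at most S, the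
sum of the envelopes, so F has Lipschitz constant L S^α ≤ L Z on them. -/
theorem norm_interaction_le (h : Train α lam B β v R) (hF : PowerLipschitz F L α) {t : ℝ}
    (ht : 0 ≤ t) (x : ℝ) :
    ‖interaction F R t x‖ ≤ 2 * L * trainWeight α B β v t x * Real.exp (-lam * t) := by
  have hL := hF.nonneg
  set S := ∑' j, envelope B β v j t x with hS
  set Z := trainWeight α B β v t x with hZ
  have hZ0 : 0 ≤ Z := h.trainWeight_nonneg t x
  have hSZ : S ^ α ≤ Z := h.rpow_tsum_envelope_le t x
  have hlip : ∀ {z w : ℂ}, ‖z‖ ≤ S → ‖w‖ ≤ S → ‖F z - F w‖ ≤ L * Z * ‖z - w‖ := by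
    intro z w hz hw
    refine (hF.norm_sub_le_of_norm_le hz hw).trans ?_
    gcongr
  have hpart : ∀ N : ℕ, ‖∑ j ∈ Finset.range N, R j t x‖ ≤
      ∑ j ∈ Finset.range N, envelope B β v j t x := fun N =>
    norm_sum_le_of_le _ fun j _ => h.norm_le j t x
  have hpartS : ∀ N : ℕ, ‖∑ j ∈ Finset.range N, R j t x‖ ≤ S := fun N =>
    (hpart N).trans ((h.summable_envelope t x).sum_le_tsum _ fun j _ => h.envelope_nonneg j t x)
  have hstep : ∀ N : ℕ, ‖F (∑ j ∈ Finset.range N, R j t x + R N t x) -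
      F (∑ j ∈ Finset.range N, R j t x) - F (R N t x)‖ ≤
        2 * L * Z * ((1 / 2 : ℝ) ^ (N + 1) * Real.exp (-lam * t)) := by
    intro N
    set P := ∑ j ∈ Finset.range N, R j t x with hP
    have hP1 := hpartS N
    have hR1 := h.norm_le_tsum N t x
    have hPR : ‖P + R N t x‖ ≤ S := by
      have := hpartS (N + 1)
      rwa [Finset.sum_range_succ] at this
    have h0 : ‖(0 : ℂ)‖ ≤ S := by simpa using (norm_nonneg _).trans hP1
    -- Whichever of P and R is larger, F of it is paired with F of the sum, so that both remaining
    -- terms cost only the smaller of the two.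
    have h1 : ‖F (P + R N t x) - F P - F (R N t x)‖ ≤ 2 * L * Z * min ‖P‖ ‖R N t x‖ := by
      rcases le_total ‖P‖ ‖R N t x‖ with hc | hc
      · rw [min_eq_left hc]
        have a1 := hlip hPR hR1
        have a2 := hlip hP1 h0
        rw [add_sub_cancel_right] at a1
        rw [hF.map_zero, sub_zero, sub_zero] at a2
        calc _ = ‖(F (P + R N t x) - F (R N t x)) - F P‖ := by congr 1; ring
          _ ≤ _ := norm_sub_le _ _
          _ ≤ _ := by linarith
      · rw [min_eq_right hc]
        have a1 := hlip hPR hP1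
        have a2 := hlip hR1 h0
        rw [add_sub_cancel_left] at a1
        rw [hF.map_zero, sub_zero, sub_zero] at a2
        calc _ ≤ _ := norm_sub_le _ _
          _ ≤ _ := by linarith
    have h2 : min ‖P‖ ‖R N t x‖ ≤ (1 / 2 : ℝ) ^ (N + 1) * Real.exp (-lam * t) := by
      calc min ‖P‖ ‖R N t x‖
          ≤ min (∑ j ∈ Finset.range N, envelope B β v j t x) (envelope B β v N t x) :=
            min_le_min (hpart N) (h.norm_le N t x)
        _ ≤ ∑ j ∈ Finset.range N, min (envelope B β v j t x) (envelope B β v N t x) :=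
            min_sum_le _ (fun j => h.envelope_nonneg j t x) (h.envelope_nonneg N t x)
        _ ≤ ∑ j ∈ Finset.range N,
            (1 / 2 : ℝ) ^ (j + 1) * ((1 / 2 : ℝ) ^ (N + 1) * Real.exp (-lam * t)) :=
            Finset.sum_le_sum fun j hj => h.min_envelope_le (Finset.mem_range.1 hj) ht x
        _ = (∑ j ∈ Finset.range N, (1 / 2 : ℝ) ^ (j + 1)) *
            ((1 / 2 : ℝ) ^ (N + 1) * Real.exp (-lam * t)) := by rw [Finset.sum_mul]
        _ ≤ _ := mul_le_of_le_one_left (by positivity) (sum_half_pow_succ_le N)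
    exact h1.trans (by gcongr)
  have hsum : ∀ N : ℕ, ‖F (∑ j ∈ Finset.range N, R j t x) - ∑ j ∈ Finset.range N, F (R j t x)‖ ≤
      ∑ j ∈ Finset.range N, 2 * L * Z * ((1 / 2 : ℝ) ^ (j + 1) * Real.exp (-lam * t)) := by
    intro N
    induction N with
    | zero => simp [hF.map_zero]
    | succ N ih =>
      rw [Finset.sum_range_succ, Finset.sum_range_succ, Finset.sum_range_succ]
      refine le_trans (le_of_eq ?_) ((norm_add_le _ _).trans (add_le_add ih (hstep N)))
      congr 1
      ring
  have hlim : Tendsto (fun N => F (∑ j ∈ Finset.range N, R j t x) -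
      ∑ j ∈ Finset.range N, F (R j t x)) atTop (𝓝 (interaction F R t x)) :=
    ((hF.continuous.tendsto _).comp (h.summable_norm t x).of_norm.hasSum.tendsto_sum_nat).sub
      (h.summable_comp hF t x).hasSum.tendsto_sum_nat
  refine le_of_tendsto hlim.norm (Eventually.of_forall fun N => (hsum N).trans ?_)
  rw [← Finset.mul_sum, ← Finset.sum_mul]
  have h3 : (∑ j ∈ Finset.range N, (1 / 2 : ℝ) ^ (j + 1)) * Real.exp (-lam * t) ≤
      Real.exp (-lam * t) := mul_le_of_le_one_left (Real.exp_pos _).le (sum_half_pow_succ_le N)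
  exact mul_le_mul_of_nonneg_left h3 (by positivity)

theorem norm_add_sub_le (h : Train α lam B β v R) (hF : PowerLipschitz F L α) (t x : ℝ) (w : ℂ) :
    ‖F (∑' j, R j t x + w) - F (∑' j, R j t x)‖ ≤
      L * 4 ^ α * (trainWeight α B β v t x + ‖w‖) * ‖w‖ := by
  have hL := hF.nonneg
  refine (hF.norm_add_sub_le (h.norm_tsum_le t x)).trans ?_
  gcongr
  exact h.rpow_tsum_envelope_le t x

end Train

/-! ### The forcing of the remainder in L² and L¹ -/

namespace PowerLipschitz

variable {F : ℂ → ℂ} {L α : ℝ} {T : ℝ → ℝ → ℂ}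

theorem memLp_comp_add_sub (hF : PowerLipschitz F L α) {T : ℝ → ℂ} (hT : Continuous T) (w : L2) :
    MemLp (fun x => F (T x + w x) - F (T x)) 2 volume := by
  refine MemLp.of_le_mul (c := L * 2 ^ α) (Lp.memLp w) ?_ (Eventually.of_forall fun x => ?_)
  · have h1 : AEStronglyMeasurable (fun x => T x + w x) volume :=
      hT.aestronglyMeasurable.add (Lp.aestronglyMeasurable w)
    exact (hF.continuous.comp_aestronglyMeasurable h1).sub
      (hF.continuous.comp hT).aestronglyMeasurable
  · simpa using hF.norm_sub_le (T x + w x) (T x)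

/-- The superposition operator `w ↦ F (T + w) - F T` on `L²`. -/
noncomputable def superposition (hF : PowerLipschitz F L α)
    (hT : Continuous fun p : ℝ × ℝ => T p.1 p.2) (t : ℝ) (w : L2) : L2 :=
  (hF.memLp_comp_add_sub (hT.comp (Continuous.prodMk_right t)) w).toLp _

theorem coeFn_superposition (hF : PowerLipschitz F L α)
    (hT : Continuous fun p : ℝ × ℝ => T p.1 p.2) (t : ℝ) (w : L2) :
    hF.superposition hT t w =ᵐ[volume] fun x => F (T t x + w x) - F (T t x) :=
  MemLp.coeFn_toLp _

theorem norm_superposition_sub_le (hF : PowerLipschitz F L α)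
    (hT : Continuous fun p : ℝ × ℝ => T p.1 p.2) (t : ℝ) (v w : L2) :
    ‖hF.superposition hT t v - hF.superposition hT t w‖ ≤ L * 2 ^ α * ‖v - w‖ := by
  refine Lp.norm_le_mul_norm_of_ae_le_mul ?_
  filter_upwards [hF.coeFn_superposition hT t v, hF.coeFn_superposition hT t w,
    Lp.coeFn_sub v w, Lp.coeFn_sub (hF.superposition hT t v) (hF.superposition hT t w)]
    with x h1 h2 h3 h4
  rw [h3, h4, Pi.sub_apply, Pi.sub_apply, h1, h2, sub_sub_sub_cancel_right]
  simpa using hF.norm_sub_le (T t x + v x) (T t x + w x)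

theorem superposition_zero (hF : PowerLipschitz F L α)
    (hT : Continuous fun p : ℝ × ℝ => T p.1 p.2) (t : ℝ) : hF.superposition hT t 0 = 0 := by
  refine Lp.ext ?_
  filter_upwards [hF.coeFn_superposition hT t 0, Lp.coeFn_zero ℂ 2 (volume : Measure ℝ)]
    with x h1 h2
  rw [h1, h2]
  simp

theorem continuous_superposition_left (hF : PowerLipschitz F L α)
    (hT : Continuous fun p : ℝ × ℝ => T p.1 p.2) (w : L2) :
    Continuous fun t => hF.superposition hT t w := by
  refine continuous_toLp_two_of_dominated
    (fun t => hF.memLp_comp_add_sub (hT.comp (Continuous.prodMk_right t)) w)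
    (fun t₀ => ⟨fun x => L * 2 ^ α * ‖w x‖, (Lp.memLp w).norm.const_mul _,
      Eventually.of_forall fun t => Eventually.of_forall fun x => ?_⟩)
    fun t₀ => Eventually.of_forall fun x => Continuous.continuousAt ?_
  · simpa using hF.norm_sub_le (T t x + w x) (T t x)
  · have h1 : Continuous fun t => T t x := hT.comp (Continuous.prodMk_left x)
    exact (hF.continuous.comp (h1.add continuous_const)).sub (hF.continuous.comp h1)

theorem continuous_superposition (hF : PowerLipschitz F L α)
    (hT : Continuous fun p : ℝ × ℝ => T p.1 p.2) :
    Continuous fun p : ℝ × L2 => hF.superposition hT p.1 p.2 := by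
  have hL := hF.nonneg
  refine continuous_prod_of_continuous_lipschitzWith' _ (L * 2 ^ α).toNNReal (fun t => ?_)
    fun w => hF.continuous_superposition_left hT w
  refine LipschitzWith.of_dist_le_mul fun v w => ?_
  rw [dist_eq_norm, dist_eq_norm, Real.coe_toNNReal _ (by positivity)]
  exact hF.norm_superposition_sub_le hT t v w

end PowerLipschitz

theorem integral_norm_sq_L2 (w : L2) : ∫ x, ‖w x‖ ^ 2 = ‖w‖ ^ 2 := by
  have h := inner_self_eq_norm_sq (𝕜 := ℂ) w
  rw [L2.inner_def] at h
  have h1 : ∀ x, inner ℂ (w x) (w x) = ((‖w x‖ ^ 2 : ℝ) : ℂ) := fun x => by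
    rw [inner_self_eq_norm_sq_to_K]; simp
  simp_rw [h1] at h
  rw [integral_complex_ofReal] at h
  simpa using h

theorem integrable_norm_sq_L2 (w : L2) : Integrable fun x => ‖w x‖ ^ 2 :=
  (memLp_two_iff_integrable_sq_norm (Lp.aestronglyMeasurable w)).1 (Lp.memLp w)

namespace TrainSeq

variable {α lam : ℝ} {B β v : ℕ → ℝ}

theorem memLp_trainWeight (h : TrainSeq α lam B β v) (t : ℝ) :
    MemLp (trainWeight α B β v t) 2 volume := by
  refine (h.memLp_sqrt_localWeight t).mono
    (h.continuous_trainWeight.comp (Continuous.prodMk_right t)).aestronglyMeasurable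
    (Eventually.of_forall fun x => ?_)
  rw [Real.norm_of_nonneg (h.trainWeight_nonneg t x), Real.norm_of_nonneg (Real.sqrt_nonneg _)]
  exact h.trainWeight_le_sqrt (by simp) x

/-- A weight with values in [0, 1] has its square below itself, so the L¹ bound is an L² bound. -/
theorem eLpNorm_trainWeight_le (h : TrainSeq α lam B β v) (t : ℝ) :
    eLpNorm (trainWeight α B β v t) 2 volume ≤ 1 := by
  have h1 : ∀ x, ENNReal.ofReal (trainWeight α B β v t x) ≤
      ENNReal.ofReal (localWeight α B β v t x) := fun x =>
    ENNReal.ofReal_le_ofReal (h.trainWeight_le_localWeight (by simp) x)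
  rw [eLpNorm_eq_lintegral_rpow_enorm_toReal two_ne_zero ENNReal.ofNat_ne_top]
  refine ENNReal.rpow_le_one ?_ (by positivity)
  refine (lintegral_mono fun x => ?_).trans (h.lintegral_localWeight_le t)
  refine le_trans ?_ (h1 x)
  rw [Real.enorm_eq_ofReal (h.trainWeight_nonneg t x)]
  have : ENNReal.ofReal (trainWeight α B β v t x) ≤ 1 :=
    ENNReal.ofReal_le_one.2 (h.trainWeight_le_one t x)
  simp only [ENNReal.toReal_ofNat, ENNReal.rpow_ofNat, sq]
  exact mul_le_of_le_one_left' this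

theorem integrable_weight_mul (h : TrainSeq α lam B β v) (t : ℝ) (w : L2) :
    Integrable fun x => trainWeight α B β v t x * ‖w x‖ :=
  (h.memLp_trainWeight t).integrable_mul (Lp.memLp w).norm

theorem integral_weight_mul_le (h : TrainSeq α lam B β v) (t : ℝ) (w : L2) :
    ∫ x, trainWeight α B β v t x * ‖w x‖ ≤ ‖w‖ := by
  have hm : MemLp (fun x => ‖w x‖) 2 volume := (Lp.memLp w).norm
  have h1 := abs_real_inner_le_norm ((h.memLp_trainWeight t).toLp _) (hm.toLp _)
  have h2 : inner ℝ ((h.memLp_trainWeight t).toLp _) (hm.toLp _) =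
      ∫ x, trainWeight α B β v t x * ‖w x‖ := by
    rw [L2.inner_def]
    refine integral_congr_ae ?_
    filter_upwards [(h.memLp_trainWeight t).coeFn_toLp, hm.coeFn_toLp] with x h3 h4
    rw [h3, h4]
    simp [mul_comm]
  have h3 : ‖(h.memLp_trainWeight t).toLp _‖ ≤ 1 := by
    rw [Lp.norm_toLp]
    exact ENNReal.toReal_le_of_le_ofReal zero_le_one
      ((h.eLpNorm_trainWeight_le t).trans (by rw [ENNReal.ofReal_one]))
  have h4 : ‖hm.toLp _‖ = ‖w‖ := by
    rw [Lp.norm_toLp, eLpNorm_norm, Lp.norm_def]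
  rw [← h2]
  refine (le_abs_self _).trans (h1.trans ?_)
  rw [h4]
  exact mul_le_of_le_one_left (norm_nonneg _) h3

end TrainSeq

namespace Train

variable {α lam : ℝ} {B β v : ℕ → ℝ} {R : ℕ → ℝ → ℝ → ℂ} {F : ℂ → ℂ} {L : ℝ}

/-- Negative times are replaced by zero: the solitons are separated only for t ≥ 0, while the fixed
point argument runs over all real times. -/
theorem memLp_interaction (h : Train α lam B β v R) (hF : PowerLipschitz F L α) (t : ℝ) :
    MemLp (interaction F R (max t 0)) 2 volume := by
  have hL := hF.nonneg
  refine MemLp.of_le_mul (c := 2 * L) (h.toTrainSeq.memLp_trainWeight (max t 0))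
    ((h.continuous_interaction hF).comp (Continuous.prodMk_right _)).aestronglyMeasurable
    (Eventually.of_forall fun x => ?_)
  have h0 := h.trainWeight_nonneg (max t 0) x
  rw [Real.norm_of_nonneg h0]
  refine (h.norm_interaction_le hF (le_max_right t 0) x).trans
    (mul_le_of_le_one_right (by positivity) (Real.exp_le_one_iff.2 ?_))
  have := mul_nonneg h.lam_pos.le (le_max_right t 0)
  linarith

/-- The interaction terms as a square-integrable function. -/
noncomputable def interactionLp (h : Train α lam B β v R) (hF : PowerLipschitz F L α) (t : ℝ) : L2 :=
  (h.memLp_interaction hF t).toLp _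

theorem coeFn_interactionLp (h : Train α lam B β v R) (hF : PowerLipschitz F L α) {t : ℝ}
    (ht : 0 ≤ t) : h.interactionLp hF t =ᵐ[volume] interaction F R t := by
  have h1 : interaction F R (max t 0) = interaction F R t := by rw [max_eq_left ht]
  exact (h.memLp_interaction hF t).coeFn_toLp.trans h1.eventuallyEq

theorem continuous_interactionLp (h : Train α lam B β v R) (hF : PowerLipschitz F L α) :
    Continuous (h.interactionLp hF) := by
  have hL := hF.nonneg
  have hlam := h.lam_pos
  refine continuous_toLp_two_of_dominated (h.memLp_interaction hF)
    (fun t₀ => ⟨fun x => 2 * L * √(localWeight α B β v (max t₀ 0) x),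
      (h.memLp_sqrt_localWeight _).const_mul _, ?_⟩)
    fun t₀ => Eventually.of_forall fun x => Continuous.continuousAt ?_
  · have hc : ContinuousAt (fun t : ℝ => 2 * lam * |max t 0 - max t₀ 0|) t₀ := by fun_prop
    have h0 : (fun t : ℝ => 2 * lam * |max t 0 - max t₀ 0|) t₀ < 1 := by simp
    filter_upwards [hc.eventually_lt_const h0] with t ht
    refine Eventually.of_forall fun x => ?_
    have h1 := h.norm_interaction_le hF (le_max_right t 0) x
    have h2 := h.trainWeight_nonneg (max t 0) x
    have h3 := h.trainWeight_le_sqrt ht.le x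
    have h4 : Real.exp (-lam * max t 0) ≤ 1 := by
      rw [Real.exp_le_one_iff]
      have := mul_nonneg hlam.le (le_max_right t 0)
      linarith
    calc _ ≤ _ := h1
      _ ≤ 2 * L * trainWeight α B β v (max t 0) x := mul_le_of_le_one_right (by positivity) h4
      _ ≤ _ := by gcongr
  · exact (h.continuous_interaction hF).comp
      (f := fun t : ℝ => ((max t 0, x) : ℝ × ℝ)) (by fun_prop)

theorem norm_interactionLp_le (h : Train α lam B β v R) (hF : PowerLipschitz F L α) {t : ℝ}
    (ht : 0 ≤ t) : ‖h.interactionLp hF t‖ ≤ 2 * L * Real.exp (-lam * t) := by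
  have hL := hF.nonneg
  have h0 : 0 ≤ 2 * L * Real.exp (-lam * t) := by positivity
  rw [Lp.norm_def]
  refine ENNReal.toReal_le_of_le_ofReal h0 ?_
  rw [eLpNorm_congr_ae (h.coeFn_interactionLp hF ht)]
  have h1 : ∀ᵐ x, ‖interaction F R t x‖ ≤
      2 * L * Real.exp (-lam * t) * ‖trainWeight α B β v t x‖ := Eventually.of_forall fun x => by
    rw [Real.norm_of_nonneg (h.trainWeight_nonneg t x)]
    have := h.norm_interaction_le hF ht x
    linarith
  refine (eLpNorm_le_mul_eLpNorm_of_ae_le_mul h1 2).trans ?_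
  exact mul_le_of_le_one_right' (h.toTrainSeq.eLpNorm_trainWeight_le t)

/-- The nonlinear term in the equation for the remainder. -/
noncomputable def forcing (h : Train α lam B β v R) (hF : PowerLipschitz F L α) (t : ℝ) (w : L2) :
    L2 := hF.superposition (T := fun t x => ∑' j, R j t x) h.continuous_tsum t w + h.interactionLp hF t

theorem coeFn_forcing (h : Train α lam B β v R) (hF : PowerLipschitz F L α) {t : ℝ} (ht : 0 ≤ t)
    (w : L2) : h.forcing hF t w =ᵐ[volume]
      fun x => F (∑' j, R j t x + w x) - ∑' j, F (R j t x) := by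
  filter_upwards [Lp.coeFn_add (hF.superposition (T := fun t x => ∑' j, R j t x) h.continuous_tsum t w) (h.interactionLp hF t),
    hF.coeFn_superposition (T := fun t x => ∑' j, R j t x) h.continuous_tsum t w, h.coeFn_interactionLp hF ht] with x h1 h2 h3
  rw [forcing, h1, Pi.add_apply, h2, h3, interaction]
  ring

theorem norm_forcing_apply_le (h : Train α lam B β v R) (hF : PowerLipschitz F L α) {t : ℝ}
    (ht : 0 ≤ t) (w : L2) : ∀ᵐ x, ‖h.forcing hF t w x‖ ≤
      L * 4 ^ α * (trainWeight α B β v t x * ‖w x‖ + ‖w x‖ ^ 2) +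
        2 * L * Real.exp (-lam * t) * trainWeight α B β v t x := by
  filter_upwards [Lp.coeFn_add (hF.superposition (T := fun t x => ∑' j, R j t x) h.continuous_tsum t w) (h.interactionLp hF t),
    hF.coeFn_superposition (T := fun t x => ∑' j, R j t x) h.continuous_tsum t w, h.coeFn_interactionLp hF ht] with x h1 h2 h3
  rw [forcing, h1, Pi.add_apply, h2, h3]
  have h4 := h.norm_add_sub_le hF t x (w x)
  have h5 := h.norm_interaction_le hF ht x
  refine (norm_add_le _ _).trans ?_
  linarith

theorem integrable_forcing (h : Train α lam B β v R) (hF : PowerLipschitz F L α) {t : ℝ}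
    (ht : 0 ≤ t) (w : L2) : Integrable (h.forcing hF t w) :=
  (((((h.toTrainSeq.integrable_weight_mul t w).add (integrable_norm_sq_L2 w)).const_mul _).add
    ((h.integrable_trainWeight t).const_mul _))).mono' (Lp.aestronglyMeasurable _)
    (h.norm_forcing_apply_le hF ht w)

/-- Cauchy–Schwarz with ‖Z‖₂ ≤ 1 handles Z|w|, the term |w|² integrates to ‖w‖² ≤ e^{-λt}, and the
interactions carry Z, of integral at most one. -/
theorem integral_norm_forcing_le (h : Train α lam B β v R) (hF : PowerLipschitz F L α) {t : ℝ}
    (ht : 0 ≤ t) {w : L2} (hw : ‖w‖ ≤ Real.exp (-lam * t)) :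
    ∫ x, ‖h.forcing hF t w x‖ ≤ (2 * L * 4 ^ α + 2 * L) * Real.exp (-lam * t) := by
  have hL := hF.nonneg
  have i1 := h.toTrainSeq.integrable_weight_mul t w
  have i2 := integrable_norm_sq_L2 w
  have i3 := h.integrable_trainWeight t
  refine (integral_mono_ae (h.integrable_forcing hF ht w).norm
    (((i1.add i2).const_mul _).add (i3.const_mul _)) (h.norm_forcing_apply_le hF ht w)).trans ?_
  have e : ∫ x, (L * 4 ^ α * (trainWeight α B β v t x * ‖w x‖ + ‖w x‖ ^ 2) +
        2 * L * Real.exp (-lam * t) * trainWeight α B β v t x) =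
      L * 4 ^ α * (∫ x, trainWeight α B β v t x * ‖w x‖) + L * 4 ^ α * (∫ x, ‖w x‖ ^ 2) +
        2 * L * Real.exp (-lam * t) * ∫ x, trainWeight α B β v t x := by
    have a1 := integral_add ((i1.add i2).const_mul (L * 4 ^ α))
      (i3.const_mul (2 * L * Real.exp (-lam * t)))
    have a2 := integral_add i1 i2
    simp only [Pi.add_apply] at a1 a2
    rw [a1, integral_const_mul, integral_const_mul, a2]
    ring
  simp only [Pi.add_apply]
  rw [e, integral_norm_sq_L2]
  have b1 := h.toTrainSeq.integral_weight_mul_le t w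
  have b2 := h.integral_trainWeight_le t
  have b3 : Real.exp (-lam * t) ≤ 1 := by
    rw [Real.exp_le_one_iff]
    have := mul_nonneg h.lam_pos.le ht
    linarith
  have b4 : ‖w‖ ^ 2 ≤ Real.exp (-lam * t) := by
    have := norm_nonneg w
    nlinarith
  have c1 : L * 4 ^ α * (∫ x, trainWeight α B β v t x * ‖w x‖) ≤
      L * 4 ^ α * Real.exp (-lam * t) := by
    gcongr
    exact b1.trans hw
  have c2 : L * 4 ^ α * ‖w‖ ^ 2 ≤ L * 4 ^ α * Real.exp (-lam * t) := by gcongr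
  have c3 : 2 * L * Real.exp (-lam * t) * ∫ x, trainWeight α B β v t x ≤
      2 * L * Real.exp (-lam * t) := mul_le_of_le_one_right (by positivity) b2
  linarith

theorem continuous_forcing (h : Train α lam B β v R) (hF : PowerLipschitz F L α) :
    Continuous fun p : ℝ × L2 => h.forcing hF p.1 p.2 :=
  (hF.continuous_superposition (T := fun t x => ∑' j, R j t x) h.continuous_tsum).add
    ((h.continuous_interactionLp hF).comp continuous_fst)

theorem norm_forcing_sub_le (h : Train α lam B β v R) (hF : PowerLipschitz F L α) (t : ℝ)
    (w w' : L2) : ‖h.forcing hF t w - h.forcing hF t w'‖ ≤ L * 2 ^ α * ‖w - w'‖ := by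
  rw [forcing, forcing, add_sub_add_right_eq_sub]
  exact hF.norm_superposition_sub_le _ t w w'

theorem norm_forcing_zero_le (h : Train α lam B β v R) (hF : PowerLipschitz F L α) {t : ℝ}
    (ht : 0 ≤ t) : ‖h.forcing hF t 0‖ ≤ 2 * L * Real.exp (-lam * t) := by
  rw [forcing, hF.superposition_zero, zero_add]
  exact h.norm_interactionLp_le hF ht

end Train

/-! ### The sup bound and the construction of the remainder -/

/-- A pointwise bound for the Duhamel integral of a forcing that decays in `L¹`. -/
theorem ae_norm_le_of_duhamel {G η : ℝ → L2} (hG : Continuous G) {K K₁ lam : ℝ} (hlam : 0 < lam)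
    (hGb : ∀ s, 0 ≤ s → ‖G s‖ ≤ K * Real.exp (-lam * s))
    (hGi : ∀ s, 0 ≤ s → Integrable (G s))
    (hG1 : ∀ s, 0 ≤ s → ∫ x, ‖G s x‖ ≤ K₁ * Real.exp (-lam * s))
    (hη : ∀ t, 0 ≤ t → η t = (-Complex.I) • ∫ r in Ioi (0 : ℝ), schr r (G (t + r)))
    {t : ℝ} (ht : 0 ≤ t) :
    ∀ᵐ x, ‖η t x‖ ≤ K₁ * √(Real.pi / lam) * Real.exp (-lam * t) := by
  have hK : 0 ≤ K := by
    have := hGb 0 le_rfl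
    rw [mul_zero, Real.exp_zero, mul_one] at this
    exact (norm_nonneg _).trans this
  refine ae_norm_le_of_integral_le (locallyIntegrable_L2 _) fun θ hθ hθc hθ0 => ?_
  set h : SchwartzMap ℝ ℂ := HasCompactSupport.toSchwartzMap (f := fun x => (θ x : ℂ))
    (hθc.comp_left (g := fun r : ℝ => (r : ℂ)) rfl) (Complex.ofRealCLM.contDiff.comp hθ) with hh
  have happ : ∀ x, h x = θ x := fun x => rfl
  have e1 : ∫ x, (θ x : ℂ) * η t x = inner ℂ (h.toLp 2 volume) (η t) := by
    rw [SchwartzMap.toLp, inner_toLp_eq_integral]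
    simp [happ]
  have hc : Continuous fun r => schr r (G (t + r)) :=
    continuous_id.schr (hG.comp (continuous_const.add continuous_id))
  have hi : IntegrableOn (fun r => schr r (G (t + r))) (Ioi 0) := by
    refine Integrable.mono' ((integrableOn_exp_neg_mul_Ioi_zero hlam).const_mul K)
      hc.aestronglyMeasurable ?_
    refine (ae_restrict_iff' measurableSet_Ioi).2 (Eventually.of_forall fun r hr => ?_)
    rw [LinearIsometry.norm_map]
    refine (hGb _ (add_nonneg ht (le_of_lt hr))).trans ?_
    gcongr K * Real.exp ?_
    nlinarith
  have e2 : inner ℂ (h.toLp 2 volume) (η t) =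
      -Complex.I * ∫ r in Ioi (0 : ℝ), inner ℂ (h.toLp 2 volume) (schr r (G (t + r))) := by
    rw [hη t ht, inner_smul_right, integral_inner hi]
  have hnorm : ∫ x, ‖h x‖ = ∫ x, θ x := integral_congr_ae (Eventually.of_forall fun x => by
    simp [happ, abs_of_nonneg (hθ0 x)])
  have hI0 : 0 ≤ ∫ x, θ x := integral_nonneg hθ0
  -- The dispersive singularity is integrable in dimension one. Γ(1/2)λ^{-1/2} is the small factor
  -- that makes the sup norm of the remainder small for large λ.
  have hgamma : ∫ r in Ioi (0 : ℝ), r ^ (-(1 / 2) : ℝ) * Real.exp (-(lam * r)) =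
      √(Real.pi / lam) := by
    have := Real.integral_rpow_mul_exp_neg_mul_Ioi (a := 1 / 2) (by norm_num) hlam
    rw [show (1 / 2 - 1 : ℝ) = -(1 / 2) by norm_num, Real.Gamma_one_half_eq, ← Real.sqrt_eq_rpow,
      ← Real.sqrt_mul' _ Real.pi_pos.le] at this
    rw [this]
    congr 1
    ring
  have hgi : IntegrableOn (fun r : ℝ => r ^ (-(1 / 2) : ℝ) * Real.exp (-(lam * r))) (Ioi 0) := by
    by_contra hne
    have := integral_undef hne
    rw [hgamma] at this
    have hp : 0 < √(Real.pi / lam) := Real.sqrt_pos.2 (by positivity)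
    exact hp.ne' this
  have hb : ∀ r ∈ Ioi (0 : ℝ), ‖inner ℂ (h.toLp 2 volume) (schr r (G (t + r)))‖ ≤
      (∫ x, θ x) * K₁ * Real.exp (-lam * t) * (r ^ (-(1 / 2) : ℝ) * Real.exp (-(lam * r))) := by
    intro r hr
    have hr0 : (0 : ℝ) < r := hr
    refine (norm_inner_toLp_schr_le hr0.ne' h _ (hGi _ (by positivity))).trans ?_
    rw [hnorm, abs_of_pos hr0]
    have h1 := hG1 (t + r) (by positivity)
    calc _ ≤ r ^ (-(1 / 2) : ℝ) * (∫ x, θ x) * (K₁ * Real.exp (-lam * (t + r))) := by gcongr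
      _ = (∫ x, θ x) * K₁ * r ^ (-(1 / 2) : ℝ) * Real.exp (-lam * (t + r)) := by ring
      _ = _ := by
        rw [show -lam * (t + r) = -lam * t + -(lam * r) by ring, Real.exp_add]
        ring
  rw [e1, e2, norm_mul, norm_neg, Complex.norm_I, one_mul]
  refine (norm_integral_le_of_norm_le (hgi.const_mul _)
    ((ae_restrict_iff' measurableSet_Ioi).2 (Eventually.of_forall hb))).trans (le_of_eq ?_)
  rw [integral_const_mul, hgamma]
  ring

/-- The decay rates for which the remainder of size `ε` is constructed. -/
structure AdmissibleRate (L α ε lam : ℝ) : Prop where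
  lipschitz_le : 2 * (L * 2 ^ α) ≤ lam
  norm_le : 2 * (2 * L) / lam ≤ ε
  sup_le : (2 * L * 4 ^ α + 2 * L) * √(Real.pi / lam) ≤ ε

theorem eventually_admissibleRate (L α : ℝ) {ε : ℝ} (hε : 0 < ε) :
    ∀ᶠ lam in atTop, AdmissibleRate L α ε lam := by
  have h2 : Tendsto (fun lam : ℝ => 2 * (2 * L) / lam) atTop (𝓝 0) :=
    tendsto_const_nhds.div_atTop tendsto_id
  have h3 : Tendsto (fun lam : ℝ => (2 * L * 4 ^ α + 2 * L) * √(Real.pi / lam)) atTop (𝓝 0) := by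
    have : Tendsto (fun lam : ℝ => √(Real.pi / lam)) atTop (𝓝 0) := by
      have h4 : Tendsto (fun lam : ℝ => Real.pi / lam) atTop (𝓝 0) :=
        tendsto_const_nhds.div_atTop tendsto_id
      simpa [Function.comp_def] using (Real.continuous_sqrt.tendsto 0).comp h4
    simpa using this.const_mul (2 * L * 4 ^ α + 2 * L)
  filter_upwards [eventually_ge_atTop (2 * (L * 2 ^ α)), h2.eventually_le_const hε,
    h3.eventually_le_const hε] with lam h1 h2 h3
  exact ⟨h1, h2, h3⟩

/-- The remainder, together with the forcing that generates it. -/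
theorem Train.exists_remainder {α lam : ℝ} {B β v : ℕ → ℝ} {R : ℕ → ℝ → ℝ → ℂ} {F : ℂ → ℂ}
    {L ε : ℝ} (h : Train α lam B β v R) (hF : PowerLipschitz F L α) (hε : ε ≤ 1)
    (hlam : AdmissibleRate L α ε lam) :
    ∃ (η G : ℝ → L2) (K : ℝ), Continuous η ∧ Continuous G ∧
      (∀ t, 0 ≤ t → ‖G t‖ ≤ K * Real.exp (-lam * t)) ∧
      (∀ t, 0 ≤ t → G t =ᵐ[volume] fun x => F (∑' j, R j t x + η t x) - ∑' j, F (R j t x)) ∧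
      (∀ t, 0 ≤ t → η t = (-Complex.I) • ∫ r in Ioi (0 : ℝ), schr r (G (t + r))) ∧
      (∀ t, 0 ≤ t → ‖η t‖ ≤ ε * Real.exp (-lam * t)) ∧
      ∀ t, 0 ≤ t → ∀ᵐ x, ‖η t x‖ ≤ ε * Real.exp (-lam * t) := by
  have hL := hF.nonneg
  obtain ⟨η, hηc, hη, hηb⟩ := exists_decaying_duhamel_solution (V := schr)
    (N := h.forcing hF) (K := 2 * L) (Lip := L * 2 ^ α) (lam := lam) continuous_schr
    (h.continuous_forcing hF) (h.norm_forcing_sub_le hF)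
    (fun t ht => h.norm_forcing_zero_le hF ht) (by positivity) h.lam_pos hlam.lipschitz_le
  have hηε : ∀ t, 0 ≤ t → ‖η t‖ ≤ ε * Real.exp (-lam * t) := fun t ht =>
    (hηb t ht).trans (mul_le_mul_of_nonneg_right hlam.norm_le (Real.exp_pos _).le)
  have hη1 : ∀ t, 0 ≤ t → ‖η t‖ ≤ Real.exp (-lam * t) := fun t ht =>
    (hηε t ht).trans (mul_le_of_le_one_left (Real.exp_pos _).le hε)
  have hGc : Continuous fun t => h.forcing hF t (η t) :=
    (h.continuous_forcing hF).comp (continuous_id.prodMk hηc)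
  have hGb : ∀ t, 0 ≤ t → ‖h.forcing hF t (η t)‖ ≤
      (L * 2 ^ α + 2 * L) * Real.exp (-lam * t) := by
    intro t ht
    have h1 := h.norm_forcing_sub_le hF t (η t) 0
    rw [sub_zero] at h1
    have h2 := h.norm_forcing_zero_le hF ht
    have h3 := norm_le_norm_add_norm_sub' (h.forcing hF t (η t)) (h.forcing hF t 0)
    have h4 : L * 2 ^ α * ‖η t‖ ≤ L * 2 ^ α * Real.exp (-lam * t) := by
      gcongr
      exact hη1 t ht
    linarith
  refine ⟨η, fun t => h.forcing hF t (η t), _, hηc, hGc, hGb,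
    fun t ht => h.coeFn_forcing hF ht (η t), hη, hηε, fun t ht => ?_⟩
  -- The L¹ bound on the forcing requires ‖η(s)‖ ≤ e^{-λs}, which is where ε ≤ 1 enters.
  filter_upwards [ae_norm_le_of_duhamel hGc h.lam_pos hGb
    (fun s hs => h.integrable_forcing hF hs (η s))
    (fun s hs => h.integral_norm_forcing_le hF hs (hη1 s hs)) hη ht] with x hx
  exact hx.trans (mul_le_mul_of_nonneg_right hlam.sup_le (Real.exp_pos _).le)

/-! ### From the train and the remainder to a solution -/

theorem locallyIntegrable_of_bound {u : ℝ × ℝ → ℂ} (hu : AEStronglyMeasurable u volume) {C : ℝ}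
    (hC : ∀ p, ‖u p‖ ≤ C) : LocallyIntegrable u volume :=
  (locallyIntegrable_const C).mono hu
    (Eventually.of_forall fun p => (hC p).trans (le_abs_self C))

theorem IsTest.integrable_bdd_mul {χ u : ℝ × ℝ → ℂ} (h : IsTest χ)
    (hu : AEStronglyMeasurable u volume) {C : ℝ} (hC : ∀ p, ‖u p‖ ≤ C) :
    Integrable (fun p => u p * χ p) volume :=
  h.integrable.bdd_mul hu (Eventually.of_forall hC)

namespace Train

variable {α lam : ℝ} {B β v : ℕ → ℝ} {R : ℕ → ℝ → ℝ → ℂ} {L : ℝ} {g : ℝ → ℝ}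

theorem nlsF_eq_truncF (h : Train α lam B β v R) (j : ℕ) (t x : ℝ) :
    nlsF g (R j t x) = truncF g (R j t x) := by
  rw [truncF_eq_nlsF]
  linarith [(h.norm_le_tsum j t x).trans (h.tsum_envelope_le_one t x)]

/-- The sum of the waves solves the equation with the sum of the nonlinear terms. -/
theorem integral_train_eq_zero (h : Train α lam B β v R) (hF : PowerLipschitz (truncF g) L α)
    {χ : ℝ × ℝ → ℂ} (hχ : IsTest χ)
    (hR : ∀ j, ∫ p : ℝ × ℝ, (R j p.1 p.2 * adjSchr χ p + nlsF g (R j p.1 p.2) * χ p) = 0) :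
    ∫ p : ℝ × ℝ, ((∑' j, R j p.1 p.2) * adjSchr χ p +
      (∑' j, truncF g (R j p.1 p.2)) * χ p) = 0 := by
  set f : ℕ → ℝ × ℝ → ℂ := fun j p =>
    R j p.1 p.2 * adjSchr χ p + truncF g (R j p.1 p.2) * χ p with hf
  have hfint : ∀ j, Integrable (f j) volume := fun j =>
    (hχ.adjSchr.integrable_bdd_mul (h.continuous j).aestronglyMeasurable
      fun p => h.norm_le_B j p.1 p.2).add
    (hχ.integrable_bdd_mul (hF.continuous.comp (h.continuous j)).aestronglyMeasurable
      fun p => h.norm_comp_le hF j p.1 p.2)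
  have hfb : ∀ j p, ‖f j p‖ ≤ B j * (‖adjSchr χ p‖ + L * ‖χ p‖) := by
    intro j p
    refine (norm_add_le _ _).trans ?_
    rw [norm_mul, norm_mul]
    have h1 := mul_le_mul_of_nonneg_right (h.norm_le_B j p.1 p.2) (norm_nonneg (adjSchr χ p))
    have h2 := mul_le_mul_of_nonneg_right (h.norm_comp_le hF j p.1 p.2) (norm_nonneg (χ p))
    linarith
  have hmaj : Integrable (fun p => ‖adjSchr χ p‖ + L * ‖χ p‖) volume :=
    hχ.adjSchr.integrable.norm.add (hχ.integrable.norm.const_mul L)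
  have hsum : Summable fun j => ∫ p, ‖f j p‖ := by
    refine Summable.of_nonneg_of_le (fun j => integral_nonneg fun p => norm_nonneg _) (fun j => ?_)
      (h.summable_B.mul_right (∫ p, (‖adjSchr χ p‖ + L * ‖χ p‖)))
    rw [← integral_const_mul]
    exact integral_mono (hfint j).norm (hmaj.const_mul _) (hfb j)
  have h1 := integral_tsum_of_summable_integral_norm hfint hsum
  have h2 : ∀ j, ∫ p, f j p = 0 := fun j => by
    rw [← hR j]
    simp only [hf, h.nlsF_eq_truncF]
  simp only [h2, tsum_zero] at h1
  rw [h1]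
  refine integral_congr_ae (Eventually.of_forall fun p => ?_)
  have s1 := (h.summable_norm p.1 p.2).of_norm
  have s2 := h.summable_comp hF p.1 p.2
  simp only [hf]
  rw [(s1.mul_right _).tsum_add (s2.mul_right _), tsum_mul_right, tsum_mul_right]

variable {η G : ℝ → L2} {W : ℝ → ℝ → ℂ} {K : ℝ}

/-- A remainder given by Duhamel's formula solves the equation with its forcing. -/
theorem integral_remainder_eq_zero (h : Train α lam B β v R) (hF : PowerLipschitz (truncF g) L α)
    (hη : Continuous η) (hG : Continuous G)
    (hGb : ∀ t, 0 ≤ t → ‖G t‖ ≤ K * Real.exp (-lam * t))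
    (hGae : ∀ t, 0 ≤ t → G t =ᵐ[volume] fun x =>
      truncF g (∑' j, R j t x + η t x) - ∑' j, truncF g (R j t x))
    (hduh : ∀ t, 0 ≤ t → η t = (-Complex.I) • ∫ r in Ioi (0 : ℝ), schr r (G (t + r)))
    (hW : StronglyMeasurable fun p : ℝ × ℝ => W p.1 p.2) (hW1 : ∀ t x, ‖W t x‖ ≤ 1)
    (hWη : ∀ t, 0 ≤ t → W t =ᵐ[volume] η t)
    {χ : ℝ × ℝ → ℂ} (hχ : IsTest χ) (hpos : ∀ t ≤ 0, ∀ x, χ (t, x) = 0) :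
    ∫ p : ℝ × ℝ, (W p.1 p.2 * adjSchr χ p +
      (truncF g (∑' j, R j p.1 p.2 + W p.1 p.2) - ∑' j, truncF g (R j p.1 p.2)) * χ p) = 0 := by
  have hL := hF.nonneg
  have hTW : StronglyMeasurable fun p : ℝ × ℝ => ∑' j, R j p.1 p.2 + W p.1 p.2 :=
    h.continuous_tsum.stronglyMeasurable.add hW
  have hint : Integrable (fun p : ℝ × ℝ => W p.1 p.2 * adjSchr χ p +
      (truncF g (∑' j, R j p.1 p.2 + W p.1 p.2) - ∑' j, truncF g (R j p.1 p.2)) * χ p) volume := by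
    refine (hχ.adjSchr.integrable_bdd_mul hW.aestronglyMeasurable fun p => hW1 p.1 p.2).add
      (hχ.integrable_bdd_mul (C := L * 2 ^ α * 2 + ∑' j, L * B j) ?_ fun p => ?_)
    · exact ((hF.continuous.comp_stronglyMeasurable hTW).sub
        (h.continuous_tsum_comp hF).stronglyMeasurable).aestronglyMeasurable
    · refine (norm_sub_le _ _).trans (add_le_add ?_ ?_)
      · have h1 := hF.norm_sub_le (∑' j, R j p.1 p.2 + W p.1 p.2) 0
        rw [hF.map_zero, sub_zero, sub_zero] at h1
        refine h1.trans ?_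
        gcongr
        refine (norm_add_le _ _).trans ?_
        linarith [h.norm_tsum_le_one p.1 p.2, hW1 p.1 p.2]
      · exact tsum_of_norm_bounded (h.summable_B.mul_left L).hasSum
          fun j => h.norm_comp_le hF j p.1 p.2
  rw [Measure.volume_eq_prod] at hint ⊢
  rw [integral_prod _ hint]
  -- Each slice becomes a pairing with the L² curves; the two resulting time integrals cancel by the
  -- weak Duhamel formula. Nonpositive times contribute nothing, as the test function vanishes
  -- there.
  have hslice : ∀ t, ∫ x, (W t x * adjSchr χ (t, x) +
      (truncF g (∑' j, R j t x + W t x) - ∑' j, truncF g (R j t x)) * χ (t, x)) =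
      inner ℂ (hχ.adjSchr.slice t) (η t) + inner ℂ (hχ.slice t) (G t) := by
    intro t
    rcases le_or_gt t 0 with ht | ht
    · simp only [hpos t ht, hχ.adjSchr_eq_zero hpos t ht, mul_zero, add_zero, integral_zero]
      rw [hχ.slice_eq_zero (hpos t ht), hχ.adjSchr.slice_eq_zero (hχ.adjSchr_eq_zero hpos t ht)]
      simp
    · have i1 : ∀ {θ : ℝ × ℝ → ℂ}, IsTest θ → ∀ w : L2, Integrable fun x => θ (t, x) * w x := by
        intro θ hθ w
        have := (Lp.memLp w).integrable_mul (p := 2) (q := 2)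
          ((hθ.slice_contDiff t).continuous.memLp_two_of_hasCompactSupport
            (hθ.slice_hasCompactSupport t))
        simpa [Pi.mul_def, mul_comm] using this
      rw [IsTest.inner_slice, IsTest.inner_slice, ← integral_add (i1 hχ.adjSchr _) (i1 hχ _)]
      refine integral_congr_ae ?_
      filter_upwards [hWη t ht.le, hGae t ht.le] with x h1 h2
      rw [h2, h1]
      ring
  simp only [hslice]
  have c1 : Continuous fun t => inner ℂ (hχ.adjSchr.slice t) (η t) :=
    hχ.adjSchr.continuous_slice.inner hη
  have c2 : Continuous fun t => inner ℂ (hχ.slice t) (G t) := hχ.continuous_slice.inner hG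
  have s1 : HasCompactSupport fun t => inner ℂ (hχ.adjSchr.slice t) (η t) :=
    hχ.adjSchr.slice_hasCompactSupport'.mono' (subset_closure.trans' fun t ht => by
      contrapose! ht
      simp [Function.notMem_support.1 ht])
  have s2 : HasCompactSupport fun t => inner ℂ (hχ.slice t) (G t) :=
    hχ.slice_hasCompactSupport'.mono' (subset_closure.trans' fun t ht => by
      contrapose! ht
      simp [Function.notMem_support.1 ht])
  rw [integral_add (c1.integrable_of_hasCompactSupport s1) (c2.integrable_of_hasCompactSupport s2),
    hχ.integral_inner_slice_duhamel hpos hG h.lam_pos hGb hduh, neg_add_cancel]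

/-- The train has source ∑ F(R_j) and the remainder has F(T + W) - ∑ F(R_j); they add up to F(T +
W). Since |T + W| ≤ 2 everywhere, F agrees with the original nonlinearity. -/
theorem isNLSSolution (h : Train α lam B β v R) (hF : PowerLipschitz (truncF g) L α)
    (hR : ∀ j χ, IsTest χ →
      ∫ p : ℝ × ℝ, (R j p.1 p.2 * adjSchr χ p + nlsF g (R j p.1 p.2) * χ p) = 0)
    (hη : Continuous η) (hG : Continuous G)
    (hGb : ∀ t, 0 ≤ t → ‖G t‖ ≤ K * Real.exp (-lam * t))
    (hGae : ∀ t, 0 ≤ t → G t =ᵐ[volume] fun x =>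
      truncF g (∑' j, R j t x + η t x) - ∑' j, truncF g (R j t x))
    (hduh : ∀ t, 0 ≤ t → η t = (-Complex.I) • ∫ r in Ioi (0 : ℝ), schr r (G (t + r)))
    (hW : StronglyMeasurable fun p : ℝ × ℝ => W p.1 p.2) (hW1 : ∀ t x, ‖W t x‖ ≤ 1)
    (hWη : ∀ t, 0 ≤ t → W t =ᵐ[volume] η t) :
    IsNLSSolution g fun t x => ∑' j, R j t x + W t x := by
  have hL := hF.nonneg
  have hT1 := h.norm_tsum_le_one
  have hu : StronglyMeasurable fun p : ℝ × ℝ => ∑' j, R j p.1 p.2 + W p.1 p.2 :=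
    h.continuous_tsum.stronglyMeasurable.add hW
  have hu2 : ∀ t x, ‖∑' j, R j t x + W t x‖ ≤ 2 := fun t x =>
    (norm_add_le _ _).trans (by linarith [hT1 t x, hW1 t x])
  have hFu : ∀ t x, nlsF g (∑' j, R j t x + W t x) = truncF g (∑' j, R j t x + W t x) :=
    fun t x => (truncF_eq_nlsF (hu2 t x)).symm
  have hWt : ∀ t, StronglyMeasurable (W t) := fun t => hW.comp_measurable measurable_prodMk_left
  have hTt : ∀ t, Continuous fun x => ∑' j, R j t x := fun t =>
    h.continuous_tsum.comp (Continuous.prodMk_right t)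
  refine ⟨fun t _ r => ?_, fun t₀ ht₀ r => ?_, ?_, ?_, fun χ hχ1 hχ2 hχ3 => ?_⟩
  · exact MemLp.of_bound
      ((hTt t).aestronglyMeasurable.add (hWt t).aestronglyMeasurable) 2
      (Eventually.of_forall (hu2 t))
  · set μ : Measure ℝ := volume.restrict (Icc (-r) r) with hμ
    have h1 : Tendsto (fun t => eLpNorm ((fun x => ∑' j, R j t x) - fun x => ∑' j, R j t₀ x) 2 μ)
        (𝓝[Ici 0] t₀) (𝓝 0) := by
      refine tendsto_eLpNorm_two_of_dominated (b := fun _ => 2)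
        (fun t => (hTt t).aestronglyMeasurable) (hTt t₀).aestronglyMeasurable (memLp_const 2)
        (Eventually.of_forall fun t => Eventually.of_forall fun x => ?_)
        (Eventually.of_forall fun x => ?_)
      · exact (norm_sub_le _ _).trans (by linarith [hT1 t x, hT1 t₀ x])
      · exact ((h.continuous_tsum.comp (Continuous.prodMk_left x)).tendsto t₀).mono_left
          nhdsWithin_le_nhds
    have h2 : Tendsto (fun t => eLpNorm (W t - W t₀) 2 μ) (𝓝[Ici 0] t₀) (𝓝 0) := by
      have h3 : Tendsto (fun t => ‖η t - η t₀‖ₑ) (𝓝[Ici 0] t₀) (𝓝 0) := by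
        have : Continuous fun t => ‖η t - η t₀‖ₑ := (hη.sub continuous_const).enorm
        have h4 := this.tendsto t₀
        rw [sub_self, enorm_zero] at h4
        exact h4.mono_left nhdsWithin_le_nhds
      refine tendsto_of_tendsto_of_tendsto_of_le_of_le' tendsto_const_nhds h3
        (Eventually.of_forall fun _ => zero_le) ?_
      filter_upwards [self_mem_nhdsWithin] with t ht
      rw [Lp.enorm_def]
      refine (eLpNorm_mono_measure _ Measure.restrict_le_self).trans (le_of_eq ?_)
      exact eLpNorm_congr_ae (((hWη t ht).sub (hWη t₀ ht₀)).trans (Lp.coeFn_sub _ _).symm)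
    have h5 := h1.add h2
    rw [add_zero] at h5
    refine tendsto_of_tendsto_of_tendsto_of_le_of_le tendsto_const_nhds h5
      (fun _ => zero_le) fun t => ?_
    refine le_trans (le_of_eq ?_) (eLpNorm_add_le
      ((hTt t).aestronglyMeasurable.sub (hTt t₀).aestronglyMeasurable)
      ((hWt t).aestronglyMeasurable.sub (hWt t₀).aestronglyMeasurable) one_le_two)
    congr 1
    funext x
    simp only [Pi.add_apply, Pi.sub_apply]
    ring
  · exact (locallyIntegrable_of_bound hu.aestronglyMeasurable
      fun p => hu2 p.1 p.2).locallyIntegrableOn _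
  · simp only [hFu]
    refine (locallyIntegrable_of_bound (C := L * 2 ^ α * 2)
      (hF.continuous.comp_stronglyMeasurable hu).aestronglyMeasurable
      fun p => ?_).locallyIntegrableOn _
    exact hF.norm_le (hu2 p.1 p.2) |>.trans (by gcongr; exact hu2 p.1 p.2)
  · have hχ : IsTest χ := ⟨hχ1, hχ2⟩
    have hpos : ∀ t ≤ 0, ∀ x, χ (t, x) = 0 := fun t ht x =>
      image_eq_zero_of_notMem_tsupport fun hmem => absurd (hχ3 hmem).1 (not_lt.2 ht)
    have e1 := h.integral_train_eq_zero hF hχ fun j => hR j χ hχ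
    have e2 := h.integral_remainder_eq_zero hF hη hG hGb hGae hduh hW hW1 hWη hχ hpos
    simp only [hχ.deriv_add_iteratedDeriv_eq, hFu]
    have i1 : Integrable (fun p : ℝ × ℝ => (∑' j, R j p.1 p.2) * adjSchr χ p +
        (∑' j, truncF g (R j p.1 p.2)) * χ p) volume :=
      (hχ.adjSchr.integrable_bdd_mul h.continuous_tsum.aestronglyMeasurable
        fun p => hT1 p.1 p.2).add
      (hχ.integrable_bdd_mul (h.continuous_tsum_comp hF).aestronglyMeasurable
        fun p => tsum_of_norm_bounded (h.summable_B.mul_left L).hasSum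
          fun j => h.norm_comp_le hF j p.1 p.2)
    have i2 : Integrable (fun p : ℝ × ℝ => (∑' j, R j p.1 p.2 + W p.1 p.2) * adjSchr χ p +
        truncF g (∑' j, R j p.1 p.2 + W p.1 p.2) * χ p) volume :=
      (hχ.adjSchr.integrable_bdd_mul hu.aestronglyMeasurable fun p => hu2 p.1 p.2).add
      (hχ.integrable_bdd_mul (C := L * 2 ^ α * 2)
        (hF.continuous.comp_stronglyMeasurable hu).aestronglyMeasurable fun p =>
          hF.norm_le (hu2 p.1 p.2) |>.trans (by gcongr; exact hu2 p.1 p.2))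
    have e3 := integral_sub i2 i1
    rw [e1, sub_zero] at e3
    rw [← e3, ← e2]
    refine integral_congr_ae (Eventually.of_forall fun p => ?_)
    simp only []
    ring

end Train

/-! ### Changes on null sets -/

theorem soliton_ae_eq {φ ψ : ℝ → ℝ} (h : φ =ᵐ[volume] ψ) (ω v x₀ γ t : ℝ) :
    ∀ᵐ x, soliton φ ω v x₀ γ t x = soliton ψ ω v x₀ γ t x := by
  have hq : MeasurePreserving (fun x : ℝ => x - x₀ - v * t) volume volume :=
    (measurePreserving_sub_right volume (v * t)).comp (measurePreserving_sub_right volume x₀)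
  filter_upwards [hq.quasiMeasurePreserving.ae h] with x hx
  rw [soliton, soliton, hx]

theorem soliton_ae_eq_prod {φ ψ : ℝ → ℝ} (h : φ =ᵐ[volume] ψ) (ω v x₀ γ : ℝ) :
    ∀ᵐ p : ℝ × ℝ, soliton φ ω v x₀ γ p.1 p.2 = soliton ψ ω v x₀ γ p.1 p.2 := by
  have hq : Measure.QuasiMeasurePreserving (fun p : ℝ × ℝ => p.2 - x₀ - v * p.1)
      (volume.prod volume) volume :=
    QuasiMeasurePreserving.prod_of_right (by fun_prop) (Eventually.of_forall fun t =>
      ((measurePreserving_sub_right volume (v * t)).comp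
        (measurePreserving_sub_right volume x₀)).quasiMeasurePreserving)
  rw [Measure.volume_eq_prod]
  filter_upwards [hq.ae h] with p hp
  rw [soliton, soliton, hp]

/-- Equality on almost every point of each slice serves the continuity in time, and equality almost
everywhere in space-time serves the distributional equation. -/
theorem IsNLSSolution.congr {g : ℝ → ℝ} {u u' : ℝ → ℝ → ℂ} (hu : IsNLSSolution g u)
    (h : ∀ t, u t =ᵐ[volume] u' t) (hp : ∀ᵐ p : ℝ × ℝ, u p.1 p.2 = u' p.1 p.2) :
    IsNLSSolution g u' where
  memLp_loc t ht r := (memLp_congr_ae (ae_restrict_of_ae (h t))).1 (hu.memLp_loc t ht r)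
  continuous_loc t₀ ht₀ r := by
    refine (hu.continuous_loc t₀ ht₀ r).congr fun t => eLpNorm_congr_ae (ae_restrict_of_ae ?_)
    filter_upwards [h t, h t₀] with x h1 h2
    rw [h1, h2]
  locallyIntegrable := hu.locallyIntegrable.congr (ae_restrict_of_ae hp)
  locallyIntegrable_nonlinearity := by
    refine hu.locallyIntegrable_nonlinearity.congr (ae_restrict_of_ae ?_)
    filter_upwards [hp] with p h1
    rw [h1]
  equation χ h1 h2 h3 := by
    rw [← hu.equation χ h1 h2 h3]
    refine integral_congr_ae ?_
    filter_upwards [hp] with p h4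
    rw [h4]

/-! ### Choice of frequencies and velocities -/

/-- For j < n, replacing β_j by the smaller β_n and using the triangle inequality bounds the
separation below by β_n(v_n - v_j)t. Here β_n v_n = 2λn while β_n v_j ≤ 2λj, so at least 2λt
remains. -/
theorem trainSeq_of_antitone {α lam : ℝ} {B β : ℕ → ℝ} (hα : 1 ≤ α) (hlam : 0 < lam)
    (hB0 : ∀ j, 0 ≤ B j) (hB : ∀ j, B j ≤ (1 / 4 : ℝ) ^ (j + 1)) (hβ0 : ∀ j, 0 < β j)
    (hβ2 : ∀ j, β j ≤ 2) (hβ : Antitone β)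
    (hw : ∀ j : ℕ, (2 ^ (j + 1) * B j) ^ α * Real.exp j * (2 / β j) ≤ (1 / 2 : ℝ) ^ (j + 1)) :
    TrainSeq α lam B β (fun j => 2 * lam * j / β j) where
  one_le := hα
  lam_pos := hlam
  B_nonneg := hB0
  B_le := hB
  β_pos := hβ0
  β_le := hβ2
  weight_le := hw
  separated j n hjn t ht x := by
    have hj := hβ0 j
    have hn := hβ0 n
    have hle := hβ hjn.le
    have h1 : (2 * lam * n / β n - 2 * lam * j / β j) * t ≤
        |x - 2 * lam * j / β j * t| + |x - 2 * lam * n / β n * t| := by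
      have h2 := le_abs_self (x - 2 * lam * j / β j * t)
      have h3 := neg_le_abs (x - 2 * lam * n / β n * t)
      linarith
    have h4 := mul_le_mul_of_nonneg_left h1 hn.le
    have h5 : β n * (2 * lam * n / β n) = 2 * lam * n := mul_div_cancel₀ _ hn.ne'
    have h6 : β n * (2 * lam * j / β j) ≤ 2 * lam * j := by
      rw [← mul_div_assoc, mul_comm, mul_div_assoc]
      exact mul_le_of_le_one_right (by positivity) ((div_le_one hj).2 hle)
    have h7 : (j : ℝ) + 1 ≤ n := by exact_mod_cast hjn
    have h8 : β n * |x - 2 * lam * j / β j * t| ≤ β j * |x - 2 * lam * j / β j * t| := by gcongr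
    have h9 : 2 * lam * ((j : ℝ) + 1) ≤ 2 * lam * n := by gcongr
    have h10 : 2 * lam ≤ β n * (2 * lam * n / β n) - β n * (2 * lam * j / β j) := by linarith
    have h11 := mul_le_mul_of_nonneg_right h10 ht
    linarith
  speed_le j := by
    have hj := hβ0 j
    rw [abs_of_nonneg (by positivity), mul_div_cancel₀ _ hj.ne']

/-- With ω = m^{2α} the amplitude is Dm² and the rate am^α. One of the two powers of m in the
amplitude, raised to α, cancels the m^α of the rate; the other makes the sum converge. -/
theorem exists_trainSeq {ωs a D α lam : ℝ} (hωs : 0 < ωs) (ha : 0 < a) (ha1 : a < 1) (hD : 0 < D)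
    (hα : 1 ≤ α) (hlam : 0 < lam) :
    ∃ ω v : ℕ → ℝ, (∀ j, 0 < ω j ∧ ω j < ωs) ∧ Function.Injective v ∧
      TrainSeq α lam (fun j => D * ω j ^ (1 / α)) (fun j => a * ω j ^ (1 / 2 : ℝ)) v := by
  -- The bound 2Dk ≤ a absorbs the factor 2/a of the weight and, as a < 1, gives Dk ≤ 1. The bound k
  -- ≤ ωs keeps the frequencies admissible.
  set k : ℝ := min (min 1 ωs) (a / (2 * D)) with hk
  have hk0 : 0 < k := lt_min (lt_min one_pos hωs) (by positivity)
  have hk1 : k ≤ 1 := (min_le_left _ _).trans (min_le_left _ _)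
  have hkω : k ≤ ωs := (min_le_left _ _).trans (min_le_right _ _)
  have hkD : 2 * (D * k) ≤ a := by
    have := (le_div_iff₀ (by positivity)).1 (min_le_right (min 1 ωs) (a / (2 * D)))
    rw [← hk] at this
    linarith
  -- Of 16^{-(j+1)}, a factor 2^{j+1} is spent on the weighting and 4^{j+1} on e^j, leaving the
  -- required 2^{-(j+1)}.
  set m : ℕ → ℝ := fun j => k * (1 / 16 : ℝ) ^ (j + 1) with hm
  have hm0 : ∀ j, 0 < m j := fun j => by positivity
  have hmk : ∀ j, m j < k := fun j =>
    mul_lt_of_lt_one_right hk0 (pow_lt_one₀ (by norm_num) (by norm_num) (by omega))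
  have hm1 : ∀ j, m j ≤ 1 := fun j => (hmk j).le.trans hk1
  have hmanti : Antitone m := antitone_nat_of_succ_le fun j => by
    simp only [hm]
    gcongr ?_ * ?_
    exact pow_le_pow_of_le_one (by norm_num) (by norm_num) (by omega)
  have hα0 : α ≠ 0 := by linarith
  have e1 : ∀ j, (m j ^ (2 * α)) ^ (1 / α) = m j ^ 2 := fun j => by
    rw [← Real.rpow_mul (hm0 j).le, mul_one_div, mul_div_cancel_right₀ _ hα0, Real.rpow_two]
  have e2 : ∀ j, (m j ^ (2 * α)) ^ (1 / 2 : ℝ) = m j ^ α := fun j => by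
    rw [← Real.rpow_mul (hm0 j).le]
    congr 1
    ring
  set β : ℕ → ℝ := fun j => a * m j ^ α with hβdef
  have hβ0 : ∀ j, 0 < β j := fun j => mul_pos ha (Real.rpow_pos_of_pos (hm0 j) _)
  have hβ : Antitone β := fun i j hij => by
    simp only [hβdef]
    have := (hm0 j).le
    gcongr
    exact hmanti hij
  have hpow1 : ∀ j, m j ^ α ≤ 1 := fun j =>
    Real.rpow_le_one (hm0 j).le (hm1 j) (by linarith)
  refine ⟨fun j => m j ^ (2 * α), fun j => 2 * lam * j / β j,
    fun j => ⟨Real.rpow_pos_of_pos (hm0 j) _, ?_⟩, ?_, ?_⟩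
  · refine (Real.rpow_le_self_of_le_one (hm0 j).le (hm1 j) (by linarith)).trans_lt ?_
    exact (hmk j).trans_le hkω
  · have hmono : StrictMono fun j : ℕ => 2 * lam * j / β j := by
      refine strictMono_nat_of_lt_succ fun j => ?_
      have h1 := hβ (Nat.le_succ j)
      calc 2 * lam * (j : ℝ) / β j ≤ 2 * lam * j / β (j + 1) := by
            gcongr
        _ < 2 * lam * ((j + 1 : ℕ) : ℝ) / β (j + 1) := by
            have := hβ0 (j + 1)
            gcongr
            exact Nat.lt_succ_self j
    exact hmono.injective
  · simp only [e1, e2]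
    refine trainSeq_of_antitone hα hlam (fun j => by positivity) (fun j => ?_) hβ0
      (fun j => ?_) hβ fun j => ?_
    · calc D * m j ^ 2 = (D * k) * m j * (1 / 16 : ℝ) ^ (j + 1) := by simp only [hm]; ring
        _ ≤ 1 * 1 * (1 / 4 : ℝ) ^ (j + 1) := by
          have := hm0 j
          gcongr
          · linarith
          · exact hm1 j
          · norm_num
        _ = _ := by ring
    · have := mul_le_of_le_one_right ha.le (hpow1 j)
      linarith
    · have hmα := Real.rpow_pos_of_pos (hm0 j) α
      have s1 : (2 ^ (j + 1) * (D * m j ^ 2)) ^ α =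
          (D * k * (1 / 8 : ℝ) ^ (j + 1)) ^ α * m j ^ α := by
        rw [← Real.mul_rpow (by positivity) (hm0 j).le]
        congr 1
        have : (1 / 8 : ℝ) ^ (j + 1) = 2 ^ (j + 1) * (1 / 16 : ℝ) ^ (j + 1) := by
          rw [← mul_pow]; norm_num
        rw [this]
        simp only [hm]
        ring
      have s2 : (D * k * (1 / 8 : ℝ) ^ (j + 1)) ^ α ≤ D * k * (1 / 8 : ℝ) ^ (j + 1) := by
        refine Real.rpow_le_self_of_le_one (by positivity) ?_ hα
        exact mul_le_one₀ (by linarith) (by positivity) (pow_le_one₀ (by norm_num) (by norm_num))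
      have s3 : Real.exp j ≤ 4 ^ (j + 1) := by
        have h4 : Real.exp 1 ≤ 4 := by linarith [Real.exp_one_lt_d9]
        calc Real.exp j = Real.exp 1 ^ j := by rw [← Real.exp_nat_mul, mul_one]
          _ ≤ 4 ^ j := pow_le_pow_left₀ (Real.exp_pos _).le h4 _
          _ ≤ _ := pow_le_pow_right₀ (by norm_num) (Nat.le_succ j)
      rw [s1]
      calc (D * k * (1 / 8 : ℝ) ^ (j + 1)) ^ α * m j ^ α * Real.exp j * (2 / (a * m j ^ α))
          = (D * k * (1 / 8 : ℝ) ^ (j + 1)) ^ α * Real.exp j * (2 / a) := by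
            field_simp
        _ ≤ D * k * (1 / 8 : ℝ) ^ (j + 1) * 4 ^ (j + 1) * (2 / a) := by gcongr
        _ = 2 * (D * k) / a * ((1 / 8 : ℝ) * 4) ^ (j + 1) := by rw [mul_pow]; ring
        _ ≤ 1 * ((1 / 8 : ℝ) * 4) ^ (j + 1) := by
            gcongr
            exact (div_le_one ha).2 hkD
        _ = _ := by norm_num

/-! ### Conclusion -/

theorem IsProfile.continuous_soliton {g φ : ℝ → ℝ} {ω : ℝ} (hφ : IsProfile g ω φ) (v : ℝ) :
    Continuous fun p : ℝ × ℝ => soliton φ ω v 0 0 p.1 p.2 := by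
  have h := hφ.continuous
  unfold soliton
  fun_prop

theorem norm_soliton (φ : ℝ → ℝ) (ω v x₀ γ t x : ℝ) :
    ‖soliton φ ω v x₀ γ t x‖ = |φ (x - x₀ - v * t)| := by
  rw [soliton, norm_mul, mul_comm Complex.I, Complex.norm_exp_ofReal_mul_I, one_mul,
    Complex.norm_real, Real.norm_eq_abs]

theorem normL2Linfty_le {w : ℝ → ℂ} {f : L2} (hw : w =ᵐ[volume] f) {C : ℝ} (h2 : ‖f‖ ≤ C)
    (hsup : ∀ᵐ x, ‖f x‖ ≤ C) : normL2Linfty w ≤ ENNReal.ofReal (2 * C) := by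
  have hC : 0 ≤ C := (norm_nonneg _).trans h2
  rw [normL2Linfty, two_mul, ENNReal.ofReal_add hC hC, eLpNorm_congr_ae hw, eLpNorm_congr_ae hw]
  refine add_le_add ?_ ?_
  · rw [← Lp.enorm_def, ← ofReal_norm]
    exact ENNReal.ofReal_le_ofReal h2
  · rw [eLpNorm_exponent_top]
    exact eLpNormEssSup_le_of_ae_bound hsup

theorem theorem3p2 (g : ℝ → ℝ) (C₀ α₁ α₂ ωs a D : ℝ)
    (hF : AssumptionF g C₀ α₁ α₂) (hα₁ : 1 ≤ α₁) (ρ : ℝ) (hρ : 0 < ρ) :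
    ∃ lam₀ : ℝ, 0 < lam₀ ∧
      ∀ φ : ℝ → ℝ → ℝ, AssumptionT g α₁ ωs a D φ →
      ∀ lam : ℝ, lam₀ ≤ lam →
      ∃ (ω v γ : ℕ → ℝ) (η : ℝ → ℝ → ℂ),
        (∀ j, 0 < ω j ∧ ω j < ωs) ∧
        Function.Injective v ∧
        (∀ t : ℝ, 0 ≤ t → ∀ᵐ x : ℝ,
          Summable (fun j => ‖soliton (φ (ω j)) (ω j) (v j) 0 (γ j) t x‖)) ∧
        (∀ t : ℝ, 0 ≤ t → AEStronglyMeasurable (η t) volume) ∧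
        IsNLSSolution g
          (fun t x => (∑' j, soliton (φ (ω j)) (ω j) (v j) 0 (γ j) t x) + η t x) ∧
        (⨆ (t : ℝ) (_ : 0 ≤ t), ENNReal.ofReal (Real.exp (lam * t)) * normL2Linfty (η t)) ≤
          ENNReal.ofReal ρ := by
  obtain ⟨L, hL⟩ := hF.exists_powerLipschitz hα₁
  -- The norm is the sum of two norms, each bounded by εe^{-λt}, hence ρ/2. The bound ε ≤ 1 keeps
  -- |u| within the truncation radius.
  set ε : ℝ := min 1 (ρ / 2) with hε
  have hε0 : 0 < ε := lt_min one_pos (by positivity)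
  have hε1 : ε ≤ 1 := min_le_left _ _
  have hερ : 2 * ε ≤ ρ := by linarith [min_le_right 1 (ρ / 2)]
  obtain ⟨lam₁, hlam₁⟩ := eventually_atTop.1 (eventually_admissibleRate L α₁ hε0)
  -- The threshold is fixed before the family φ, from L, α₁ and ρ alone.
  refine ⟨max lam₁ 1, by positivity, fun φ hT lam hlam => ?_⟩
  have hlam0 : 0 < lam := one_pos.trans_le ((le_max_right _ _).trans hlam)
  have hadm := hlam₁ lam ((le_max_left _ _).trans hlam)
  obtain ⟨ω, v, hω, hv, hseq⟩ :=
    exists_trainSeq hT.ωs_pos hT.a_pos hT.a_lt_one hT.D_pos hα₁ hlam0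
  choose φ₁ hφ₁ hae hbd using fun j => hT.exists_profile (hω j).1 (hω j).2
  have htrain : Train α₁ lam (fun j => D * ω j ^ (1 / α₁)) (fun j => a * ω j ^ (1 / 2 : ℝ)) v
      (fun j => soliton (φ₁ j) (ω j) (v j) 0 0) := by
    refine ⟨hseq, fun j => (hφ₁ j).continuous_soliton (v j), fun j t x => ?_⟩
    rw [norm_soliton, sub_zero, envelope]
    simpa only [neg_mul] using hbd j (x - v j * t)
  obtain ⟨η, G, K, hηc, hGc, hGb, hGae, hduh, hη2, hηsup⟩ :=
    htrain.exists_remainder hL hε1 hadm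
  obtain ⟨W₀, hW₀, hW₀η⟩ := exists_measurable_representative hηc
  -- For t ≥ 0 this alters the representative only on a null set, and it yields |W| ≤ 1 at every
  -- point.
  set W : ℝ → ℝ → ℂ := fun t x => if ‖W₀ t x‖ ≤ 1 then W₀ t x else 0 with hWdef
  have hW : StronglyMeasurable fun p : ℝ × ℝ => W p.1 p.2 :=
    StronglyMeasurable.ite (measurableSet_le hW₀.norm.measurable measurable_const) hW₀
      stronglyMeasurable_const
  have hW1 : ∀ t x, ‖W t x‖ ≤ 1 := fun t x => by
    simp only [hWdef]
    split_ifs with h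
    · exact h
    · simp
  have hWη : ∀ t, 0 ≤ t → W t =ᵐ[volume] η t := by
    intro t ht
    filter_upwards [hW₀η t, hηsup t ht] with x h1 h2
    have h3 : Real.exp (-lam * t) ≤ 1 := by
      rw [Real.exp_le_one_iff]
      have := mul_nonneg hlam0.le ht
      linarith
    have h4 : ‖W₀ t x‖ ≤ 1 := by
      rw [h1]
      exact h2.trans (mul_le_one₀ hε1 (Real.exp_pos _).le h3)
    simp only [hWdef]
    rw [if_pos h4, h1]
  have hsol := htrain.isNLSSolution hL
    (fun j χ hχ => (hφ₁ j).soliton_equation hF.continuousOn (v j) hχ)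
    hηc hGc hGb hGae hduh hW hW1 hWη
  have hsame : ∀ t, ∀ᵐ x, ∀ j, soliton (φ₁ j) (ω j) (v j) 0 0 t x =
      soliton (φ (ω j)) (ω j) (v j) 0 0 t x := fun t =>
    ae_all_iff.2 fun j => soliton_ae_eq (hae j).symm (ω j) (v j) 0 0 t
  have hsame' : ∀ᵐ p : ℝ × ℝ, ∀ j, soliton (φ₁ j) (ω j) (v j) 0 0 p.1 p.2 =
      soliton (φ (ω j)) (ω j) (v j) 0 0 p.1 p.2 :=
    ae_all_iff.2 fun j => soliton_ae_eq_prod (hae j).symm (ω j) (v j) 0 0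
  -- All phases can be zero: the smallness of the interactions comes from the moduli of the waves
  -- only.
  refine ⟨ω, v, fun _ => 0, W, hω, hv, fun t ht => ?_, fun t ht => ?_, ?_, ?_⟩
  · filter_upwards [hsame t] with x hx
    simpa only [hx] using htrain.summable_norm t x
  · exact (hW.comp_measurable measurable_prodMk_left).aestronglyMeasurable
  · refine hsol.congr (fun t => ?_) ?_
    · filter_upwards [hsame t] with x hx
      simp only [hx]
    · filter_upwards [hsame'] with p hp
      simp only [hp]
  · refine iSup₂_le fun t ht => ?_
    refine (mul_le_mul_right (normL2Linfty_le (hWη t ht) (hη2 t ht) (hηsup t ht)) _).trans ?_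
    rw [← ENNReal.ofReal_mul (Real.exp_pos _).le]
    refine ENNReal.ofReal_le_ofReal (le_trans (le_of_eq ?_) hερ)
    rw [show Real.exp (lam * t) * (2 * (ε * Real.exp (-lam * t))) =
      2 * ε * (Real.exp (lam * t) * Real.exp (-lam * t)) by ring, ← Real.exp_add]
    simp
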